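/- **Setting.** Let $G$ be a Lie group with Lie algebra $\mathfrak g$ and let $s\in (S^2\mathfrak g)^G$; write $s=\sum_{i,j}s^{ij}\,\xi_i\otimes\xi_j$ in a basis $(\xi_i)$ and $s^\sharp(a)=s(a,\cdot)$. Let $\mathfrak d=\mathfrak g\oplus\mathfrak p$, $\mathfrak p\cong\mathfrak g^*$, be the Drinfel'd double: $\mathfrak g$ is a Lagrangian subalgebra, $\mathfrak p$ is an ideal, and the invariant metric restricts to $s$ on $\mathfrak p$. It is a groupoid over $\mathfrak g$ with source $\mathsf s(x+a)=x$, target $\mathsf t(x+a)=x+s^\sharp(a)$ and composition $u\circ w$, defined for $\mathsf s(u)=\mathsf t(w)$, which has the source of $w$ and adds the $\mathfrak p$-components. Put $\mathfrak g^*_{\bar\Delta}=\{a-\tfrac12 s^\sharp(a)\mid a\in\mathfrak p\}$. A permutation graph $\Gamma$ is a finite oriented graph whose incidence maps $\mathsf{in},\mathsf{out}:E_\Gamma\to V_\Gamma$ (the vertex an edge enters, respectively leaves) are bijections; put $\overline{\sigma}(v)=\mathsf{out}(\mathsf{in}^{-1}(v))$. The algebra $\mathfrak d^{V_\Gamma}$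 acts on the factor $e$ of $G^{E_\Gamma}$ by $-\mathsf s(\xi_{\mathsf{in}(e)})^R+\mathsf t(\xi_{\mathsf{out}(e)})^L$. A quasi-Poisson $G^{V_\Gamma}$-manifold $(M,\rho,\pi)$ is a manifold with a smooth $G^{V_\Gamma}$-action, with infinitesimal action $\rho$, and an invariant bivector field $\pi$ such that $\tfrac12[\pi,\pi]=\rho(\phi)$, where $\phi(a,b,c)=\tfrac14\sum_v c_v([s^\sharp a_v,s^\sharp b_v])$. A $\overline{\sigma}^!$-twisted moment map is a smooth map $\mu:M\to G^{V_\Gamma}$ which is equivariant for $(g\cdot h)_v=g_{\overline\sigma(v)}h_vg_v^{-1}$ and satisfies $(\mu_v)_*\pi=\tfrac12\sum s^{ij}\big(\xi_i^L\otimes\rho_v(\xi_j)+\xi_i^R\otimes\rho_{\overline\sigma(v)}(\xi_j)\big)$ for all $v$, where $\rho_v$ is the action of the $v$-th factor. Put $\tilde\mu_e=(\mu_{\mathsf{in}(e)})^{-1}$. The corresponding quasi-Hamiltonian $(\mathfrak d,\mathfrak g)^{V_\Gamma}\times G^{E_\Gamma}$-structure is the morphism of Manin pairs $R:(\mathbb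 TM,TM)\dashrightarrow(\mathfrak d^{V_\Gamma},\mathfrak g^{V_\Gamma})\times G^{E_\Gamma}$ over $\tilde\mu$ with $\rho(x)\sim_R x$ for $x\in\mathfrak g^{V_\Gamma}$ and $\mathfrak k\circ R=\mathrm{gr}(\pi^\sharp)=\{\pi(\alpha,\cdot)+\alpha\}$, where $\mathfrak k=(\mathfrak g^*_{\bar\Delta})^{V_\Gamma}$. For vertices $P\neq Q$, the fused graph $\Gamma^*$ identifies $P$ and $Q$; if the edge $e_P$ exiting $P$ is the edge $e^Q$ entering $Q$, this edge is deleted, and otherwise $e_P$ and $e^Q$ are composed to one edge. The relation $R_{(P,Q)}$ from $\mathfrak d^{V_\Gamma}\times G^{E_\Gamma}$ to $\mathfrak d^{V_{\Gamma^*}}\times G^{E_{\Gamma^*}}$ relates $(\xi,g)$ to $(\xi^*,g^*)$ if $\xi_Q,\xi_P$ are composable, $\xi^*$ is $\xi_Q\circ\xi_P$ at the merged vertex and agrees with $\xi$ elsewhere, and $g^*$ is $g_{e_P}g_{e^Q}$ on the composed edge (if there is one) and agrees with $g$ on the other edges. The fusion of $R$ is $R^*=R_{(P,Q)}\circ R$.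 **Proposition.** Let $(M,\rho,\pi)$ be a quasi-Poisson $G^{V_\Gamma}$-manifold with $\overline{\sigma}^!$-twisted moment map $\mu$, let $R$ be a corresponding quasi-Hamiltonian structure, let $P\ne Q$ be vertices and $R^*$ the fusion of $R$ at $(P,Q)$. Let $\tau=\tau_{(P,Q)}\in\wedge^2(\mathfrak g^{V_\Gamma})$ be the insertion of $$\psi=\tfrac12\sum_{i,j}s^{ij}\,(\xi_i,0)\wedge(0,\xi_j)\in\wedge^2(\mathfrak g\oplus\mathfrak g)$$ at the factors $P,Q$. Then $R^*$ is a morphism of Manin pairs $(\mathbb TM,TM)\dashrightarrow(\mathfrak d,\mathfrak g)^{V_{\Gamma^*}}\times G^{E_{\Gamma^*}}$ over the fused map $\tilde\mu^*$; it is compatible with the $G^{V_{\Gamma^*}}$-action on $M$ in which the group at the merged vertex acts diagonally through the factors $P$ and $Q$; and the unique bivector field $\pi^*$ with $(\mathfrak g^*_{\bar\Delta})^{V_{\Gamma^*}}\circ R^*=\mathrm{gr}((\pi^*)^\sharp)$ is $$\pi^*=\pi+\rho(\tau).$$ With this action and bivector field, $M$ is a quasi-Poisson $G^{V_{\Gamma^*}}$-manifold,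 and the map $\mu^*$ with $\tilde\mu^*_e=(\mu^*_{\mathsf{in}(e)})^{-1}$ is a twisted moment map for it. Consequently fusion agrees up to sign with the fusion of Alekseev, Kosmann-Schwarzbach and Meinrenken, whose bivector field at $(P,Q)$ is $\pi^{\mathrm{AKM}}_{(P,Q)}=\pi-\rho(\tau_{(P,Q)})$: one has $\pi^*-\pi=-(\pi^{\mathrm{AKM}}_{(P,Q)}-\pi)$, equivalently $\pi^*=\pi^{\mathrm{AKM}}_{(Q,P)}$. -/

import Mathlib

open scoped Manifold ContDiff TensorProduct

namespace Fusion

noncomputable section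

/-! ## Permutation graphs and the fused graph -/

/-- A permutation graph: an oriented graph whose incidence maps are both bijections.
The edge `e` runs from the vertex `out e` to the vertex `inn e`. -/
structure PermGraph (V E : Type*) where
  /-- the vertex entered by an edge -/
  inn : E ≃ V
  /-- the vertex left by an edge -/
  out : E ≃ V

namespace PermGraph

variable {V E : Type*} (Γ : PermGraph V E)

/-- The edge entering `v`. -/
def edgeIn (v : V) : E := Γ.inn.symm v

/-- The edge exiting `v`. -/
def edgeOut (v : V) : E := Γ.out.symm v

/-- The permutation of the vertices given by walking along the graph against the direction
of the edges. -/
def backward (v : V) : V := Γ.out (Γ.edgeIn v)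

end PermGraph

/-- The map identifying the two vertices `P` and `Q`. The set of vertices after the identification
is modelled on `{v // v ≠ Q}`, the common image of `P` and `Q` being `P`. -/
def collapse {V : Type*} [DecidableEq V] {P Q : V} (h : P ≠ Q) (v : V) : {v : V // v ≠ Q} :=
  if hv : v = Q then ⟨P, h⟩ else ⟨v, hv⟩

section FusedGraph

variable {V E : Type*} [DecidableEq V] [DecidableEq E] (Γ : PermGraph V E) {P Q : V}

/-- The vertex left by an edge of the fused graph. The edges of the fused graph are modelled on
the edges of `Γ` other than the one entering `Q`. If the edge exiting `P` is not the edge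
entering `Q`, then it stands for the composite of these two edges,
which starts where the edge entering `Q` starts. -/
def fuseOut (h : P ≠ Q) (e : {e : E // e ≠ Γ.edgeIn Q}) : {v : V // v ≠ Q} :=
  if e.1 = Γ.edgeOut P then collapse h (Γ.out (Γ.edgeIn Q)) else collapse h (Γ.out e.1)

theorem fuseOut_bijective (h : P ≠ Q) : Function.Bijective (fuseOut Γ h) := by
  have hP : Γ.out (Γ.edgeOut P) = P := by simp [PermGraph.edgeOut]
  have hQ : Γ.out (Γ.edgeOut Q) = Q := by simp [PermGraph.edgeOut]
  have hinj : ∀ a b, Γ.out a = Γ.out b → a = b := fun a b hab => Γ.out.injective hab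
  constructor
  · rintro ⟨a, ha⟩ ⟨b, hb⟩ hab
    have hab' := congrArg Subtype.val hab
    simp only [fuseOut, collapse] at hab'
    apply Subtype.ext
    change a = b
    grind
  · rintro ⟨v, hv⟩
    by_cases h1 : v = P
    · by_cases h2 : Γ.edgeOut Q = Γ.edgeIn Q
      · refine ⟨⟨Γ.edgeOut P, ?_⟩, Subtype.ext ?_⟩
        · grind
        · simp only [fuseOut, collapse]
          grind
      · refine ⟨⟨Γ.edgeOut Q, h2⟩, Subtype.ext ?_⟩
        simp only [fuseOut, collapse]
        grind
    · by_cases h2 : Γ.edgeOut v = Γ.edgeIn Q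
      · have hv' : Γ.out (Γ.edgeOut v) = v := by simp [PermGraph.edgeOut]
        refine ⟨⟨Γ.edgeOut P, ?_⟩, Subtype.ext ?_⟩
        · grind
        · simp only [fuseOut, collapse]
          grind
      · have hv' : Γ.out (Γ.edgeOut v) = v := by simp [PermGraph.edgeOut]
        refine ⟨⟨Γ.edgeOut v, h2⟩, Subtype.ext ?_⟩
        simp only [fuseOut, collapse]
        grind

/-- The fused graph. The vertices `P` and `Q` are identified. If the edge exiting `P` is the edge
entering `Q`, this edge is discarded; otherwise these two edges are composed to a single edge (named
after the edge exiting `P`). In both cases the remaining edges are those different from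
the edge entering `Q`, and the vertex they enter is unchanged. -/
def PermGraph.fuse (h : P ≠ Q) : PermGraph {v : V // v ≠ Q} {e : E // e ≠ Γ.edgeIn Q} where
  inn := Γ.inn.subtypeEquiv fun e => by simp [PermGraph.edgeIn, Equiv.eq_symm_apply]
  out := Equiv.ofBijective (fuseOut Γ h) (fuseOut_bijective Γ h)

/-- The map `G^E → G^{E*}` underlying fusion: the label of a composed edge is the product of the
labels of the edge exiting `P` and the edge entering `Q`; all other labels are kept. -/
def fuseHol {G : Type*} [Mul G] (P Q : V) (g : E → G) (e : {e : E // e ≠ Γ.edgeIn Q}) : G :=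
  if e.1 = Γ.edgeOut P then g (Γ.edgeOut P) * g (Γ.edgeIn Q) else g e.1

end FusedGraph

/-! ## Lie groups, their Lie algebras and the double

`G` is a Lie group modelled on the vector space `F`. As in Mathlib, the tangent space at the
identity is, as a normed space, `F`; elements of the Lie algebra are therefore written as elements
of `F`. -/

section Lie

variable {F : Type*} [NormedAddCommGroup F] [NormedSpace ℝ F]
  (G : Type*) [TopologicalSpace G] [ChartedSpace F G] [Group G] [LieGroup 𝓘(ℝ, F) ∞ G]

theorem lieGroup_three : LieGroup 𝓘(ℝ, F) (minSmoothness ℝ 3) G := by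
  refine LieGroup.of_le (n := ∞) ?_
  rw [minSmoothness_of_isRCLikeNormedField]
  exact WithTop.coe_le_coe.2 le_top

variable [FiniteDimensional ℝ F]

/-- The bracket of the Lie algebra of `G` (that of Mathlib: left invariant vector fields). -/
def lieBr (x y : F) : F :=
  Bracket.bracket (L := GroupLieAlgebra 𝓘(ℝ, F) G) (M := GroupLieAlgebra 𝓘(ℝ, F) G) x y

/-- `ad x` -/
def ad (x : F) : F →L[ℝ] F :=
  LinearMap.toContinuousLinearMap
    { toFun := lieBr G x
      map_add' := fun y z => by
        have := lieGroup_three (F := F) G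
        exact lie_add (L := GroupLieAlgebra 𝓘(ℝ, F) G) (M := GroupLieAlgebra 𝓘(ℝ, F) G) x y z
      map_smul' := fun c y => by
        have := lieGroup_three (F := F) G
        exact lie_smul (R := ℝ) (L := GroupLieAlgebra 𝓘(ℝ, F) G)
          (M := GroupLieAlgebra 𝓘(ℝ, F) G) c x y }

/-- The contragredient representation of the Lie algebra on its dual. -/
def coad (x : F) (a : F →L[ℝ] ℝ) : F →L[ℝ] ℝ := -(a.comp (ad G x))

variable {G}

/-- The adjoint action of the group on its Lie algebra. -/
def Ad (g : G) : F →L[ℝ] F :=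
  (mfderiv 𝓘(ℝ, F) 𝓘(ℝ, F) (fun h : G => g * h * g⁻¹) 1 :)

/-- The left translation `x ↦ x^L(g)`, giving the values at `g` of left invariant vector fields. -/
def leftInv (g : G) : F →L[ℝ] TangentSpace 𝓘(ℝ, F) g :=
  (mfderiv 𝓘(ℝ, F) 𝓘(ℝ, F) (fun h : G => g * h) 1 :)

/-- The right translation `x ↦ x^R(g)`, giving the values at `g` of right invariant
vector fields. -/
def rightInv (g : G) : F →L[ℝ] TangentSpace 𝓘(ℝ, F) g :=
  (mfderiv 𝓘(ℝ, F) 𝓘(ℝ, F) (fun h : G => h * g) 1 :)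

end Lie

section Double

variable {F : Type*} [NormedAddCommGroup F] [NormedSpace ℝ F] [FiniteDimensional ℝ F]

/-- The linear map `s^♯ : 𝔤* → 𝔤`, `a ↦ s(a, ·)`, of a 2-tensor `s`. -/
def sharp (s : F ⊗[ℝ] F) : (F →L[ℝ] ℝ) →ₗ[ℝ] F where
  toFun a := TensorProduct.lid ℝ F (LinearMap.rTensor F (a : F →ₗ[ℝ] ℝ) s)
  map_add' a b := by simp [LinearMap.rTensor_add]
  map_smul' c a := by simp [LinearMap.rTensor_smul]

variable (F) in
/-- The underlying vector space `𝔤 ⊕ 𝔭`, with `𝔭 ≅ 𝔤*`, of the Drinfel'd double `𝔡` of `𝔤`.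
The subalgebra `𝔤` consists of the pairs `(x, 0)`. -/
abbrev Double := F × (F →L[ℝ] ℝ)

/-- The linear form `⟨·, v⟩` given by the metric of the double: `𝔤` is isotropic, `𝔤` and `𝔭 ≅ 𝔤*`
are paired canonically, and the metric restricts to `s` on `𝔭`. -/
def pairWith (s : F ⊗[ℝ] F) (v : Double F) : Double F →L[ℝ] ℝ :=
  (ContinuousLinearMap.apply ℝ ℝ (v.1 + sharp s v.2)).comp (ContinuousLinearMap.snd ℝ F (F →L[ℝ] ℝ))
    + v.2.comp (ContinuousLinearMap.fst ℝ F (F →L[ℝ] ℝ))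

/-- The metric of the double, `⟨x + a, y + b⟩ = a(y) + b(x) + s(a, b)`. -/
def pairing (s : F ⊗[ℝ] F) (u v : Double F) : ℝ := u.2 v.1 + v.2 u.1 + v.2 (sharp s u.2)

/-- The bracket of the double, `[x + a, y + b] = [x, y] + ad*_x b - ad*_y a + ad*_{s(a)} b`:
the one for which `𝔤` is a subalgebra, `𝔭` is an ideal and the metric is invariant. -/
def doubleBr (G : Type*) [TopologicalSpace G] [ChartedSpace F G] [Group G]
    [LieGroup 𝓘(ℝ, F) ∞ G] (s : F ⊗[ℝ] F) (u v : Double F) : Double F :=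
  (lieBr G u.1 v.1, coad G u.1 v.2 - coad G v.1 u.2 + coad G (sharp s u.2) v.2)

/-- The source map of the groupoid `𝔡 ⇉ 𝔤`. -/
def src (u : Double F) : F := u.1

/-- The target map of the groupoid `𝔡 ⇉ 𝔤`. -/
def tgt (s : F ⊗[ℝ] F) (u : Double F) : F := u.1 + sharp s u.2

/-- The composition of the groupoid `𝔡 ⇉ 𝔤`: the product `u ∘ w`, which is meaningful when
`src u = tgt w`, has the source of `w`, and the components in `𝔭` add up. -/
def comp (u w : Double F) : Double F := (w.1, u.2 + w.2)

/-- The canonical Lagrangian complement `{a - ½ s(a, ·) | a ∈ 𝔭}` of `𝔤` in `𝔡`. -/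
def complement (s : F ⊗[ℝ] F) : Set (Double F) :=
  {u | ∃ a : F →L[ℝ] ℝ, u = (-(1 / 2 : ℝ) • sharp s a, a)}

/-- The element of `𝔡^V` given by an element of `𝔤^V`. -/
def unit {V : Type*} (x : V → F) : V → Double F := fun v => (x v, 0)

/-- The bivector `x ∧ y = x ⊗ y - y ⊗ x`, as a bilinear form on the dual space. -/
def wedge {W : Type*} [AddCommGroup W] [Module ℝ W] [TopologicalSpace W] [IsTopologicalAddGroup W]
    [ContinuousConstSMul ℝ W] (x y : W) : LinearMap.BilinForm ℝ (W →L[ℝ] ℝ) :=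
  LinearMap.mk₂ ℝ (fun a b => a x * b y - a y * b x)
    (by intros; simp; ring) (by intros; simp; ring)
    (by intros; simp; ring) (by intros; simp; ring)

/-- The bivector `τ ∈ ∧²(𝔤^V)`: the insertion of `ψ = ½ ∑ s^{ij} (ξ_i, 0) ∧ (0, ξ_j)` at the factors
`P` and `Q`, for `s = ∑ s^{ij} ξ_i ⊗ ξ_j` in the basis `ξ`. -/
def fusionTensor {V ι : Type*} [DecidableEq V] [Fintype ι] (ξ : Module.Basis ι ℝ F) (s : F ⊗[ℝ] F)
    (P Q : V) : LinearMap.BilinForm ℝ ((V → F) →L[ℝ] ℝ) :=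
  (1 / 2 : ℝ) • ∑ i, ∑ j, (ξ.tensorProduct ξ).repr s (i, j) •
    wedge (Pi.single P (ξ i) : V → F) (Pi.single Q (ξ j))

end Double

/-! ## Manifolds: 1-forms, bivector fields, group actions -/

section Manifold

variable {F : Type*} [NormedAddCommGroup F] [NormedSpace ℝ F]
  {A : Type*} [NormedAddCommGroup A] [NormedSpace ℝ A]
  {M : Type*} [TopologicalSpace M] [ChartedSpace A M] [IsManifold 𝓘(ℝ, A) ∞ M]

variable (A) in
/-- The tangent space at `m`. -/
abbrev Tan (m : M) := TangentSpace 𝓘(ℝ, A) m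

variable (A) in
/-- The cotangent space at `m`. -/
abbrev Cot (m : M) := TangentSpace 𝓘(ℝ, A) m →L[ℝ] ℝ

/-- Smooth vector fields. -/
def SmoothVec (X : (m : M) → Tan A m) : Prop :=
  ContMDiff 𝓘(ℝ, A) (𝓘(ℝ, A).prod 𝓘(ℝ, A)) ∞ fun m => (⟨m, X m⟩ : TangentBundle 𝓘(ℝ, A) M)

/-- Smooth 1-forms: those whose values on smooth vector fields are smooth functions. -/
def SmoothForm (α : (m : M) → Cot A m) : Prop :=
  ∀ X : (m : M) → Tan A m, SmoothVec X → ContMDiff 𝓘(ℝ, A) 𝓘(ℝ, ℝ) ∞ fun m => α m (X m)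

variable (A) in
/-- The differential of a real function. -/
def dif (f : M → ℝ) (m : M) : Cot A m := (mfderiv 𝓘(ℝ, A) 𝓘(ℝ, ℝ) f m :)

/-- A 1-form `α` read in the preferred chart `φ` at `m`, as a function on the model space
with values in linear forms: the pull back of `α` under `φ⁻¹`. -/
def formInChart (α : (m : M) → Cot A m) (m : M) (y : A) : A →L[ℝ] ℝ :=
  (α ((extChartAt 𝓘(ℝ, A) m).symm y)).comp
    (mfderiv 𝓘(ℝ, A) 𝓘(ℝ, A) (extChartAt 𝓘(ℝ, A) m).symm y)

/-- The covector `ι_X dα` at `m`: in a chart,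
`dα(X, Y) = (D α)(X)(Y) - (D α)(Y)(X)`. -/
def iotaD (α : (m : M) → Cot A m) (m : M) (X : Tan A m) : Cot A m :=
  let φ := extChartAt 𝓘(ℝ, A) m
  let J : Tan A m →L[ℝ] A := mfderiv 𝓘(ℝ, A) 𝓘(ℝ, A) φ m
  let B : A →L[ℝ] A →L[ℝ] ℝ := fderiv ℝ (formInChart α m) (φ m)
  (B (J X) - B.flip (J X)).comp J

variable (A) in
/-- A bivector field, given by its values `π(α, β)` on covectors. -/
abbrev Bivector (M : Type*) [TopologicalSpace M] [ChartedSpace A M] :=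
  (m : M) → LinearMap.BilinForm ℝ (Cot A m)

/-- The bracket `{f, g} = π(df, dg)`. -/
def poisson (π : Bivector A M) (f g : M → ℝ) (m : M) : ℝ := π m (dif A f m) (dif A g m)

variable {V : Type*} [Fintype V] [DecidableEq V]
  {G : Type*} [TopologicalSpace G] [ChartedSpace F G] [Group G]

variable (F A) in
/-- The infinitesimal action at `m` of the `v`-th factor of `𝔤^V`,
for an action of `G^V` on `M`: the element `x` is sent to the derivative at `0` of `exp(-tx) • m`,
so that `𝔤^V → 𝔛(M)` preserves brackets. -/
def infActAt (Φ : (V → G) →* Equiv.Perm M) (v : V) (m : M) : F →L[ℝ] Tan A m :=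
  -(mfderiv 𝓘(ℝ, F) 𝓘(ℝ, A) (fun g : G => Φ (Pi.mulSingle v g) m) 1 :)

variable (F A) in
/-- The infinitesimal action `ρ` of `𝔤^V` at `m`, for an action of `G^V` on `M`. -/
def infAct (Φ : (V → G) →* Equiv.Perm M) (m : M) : (V → F) →L[ℝ] Tan A m :=
  ∑ v, (infActAt F A Φ v m).comp (ContinuousLinearMap.proj v)

/-- The bivector field `ρ(τ)`, for `τ ∈ ∧²(𝔤^V)`. -/
def pushBivector (Φ : (V → G) →* Equiv.Perm M) (τ : LinearMap.BilinForm ℝ ((V → F) →L[ℝ] ℝ)) :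
    Bivector A M :=
  fun m => LinearMap.mk₂ ℝ
    (fun α β : Cot A m => τ (α.comp (infAct F A Φ m)) (β.comp (infAct F A Φ m)))
    (by intros; simp) (by intros; simp) (by intros; simp) (by intros; simp)

end Manifold

/-! ## Quasi-Poisson manifolds and twisted moment maps -/

section QuasiPoisson

variable {F : Type*} [NormedAddCommGroup F] [NormedSpace ℝ F] [FiniteDimensional ℝ F]
  {A : Type*} [NormedAddCommGroup A] [NormedSpace ℝ A]
  {M : Type*} [TopologicalSpace M] [ChartedSpace A M] [IsManifold 𝓘(ℝ, A) ∞ M]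
  {V : Type*} [Fintype V] [DecidableEq V]
  {G : Type*} [TopologicalSpace G] [ChartedSpace F G] [Group G] [LieGroup 𝓘(ℝ, F) ∞ G]

/-- `(M, Φ, π)` is a quasi-Poisson `G^V`-manifold: `Φ` is a smooth action of `G^V` on `M`, and `π` is
a smooth invariant bivector field with `½[π, π] = ρ(φ)`, where `φ ∈ ∧³(𝔤^V)` is the invariant element
`φ(a, b, c) = ¼ ∑_v c_v([s^♯ a_v, s^♯ b_v])`. The last equation is evaluated on differentials of
functions: `½[π, π](df, dg, dh)` is the Jacobiator of the bracket `{f, g} = π(df, dg)`. -/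
structure IsQuasiPoisson (s : F ⊗[ℝ] F) (Φ : (V → G) →* Equiv.Perm M) (π : Bivector A M) :
    Prop where
  /-- each factor (hence the product of the finitely many factors) acts smoothly -/
  smooth_action : ∀ v, ContMDiff (𝓘(ℝ, F).prod 𝓘(ℝ, A)) 𝓘(ℝ, A) ∞
    fun p : G × M => Φ (Pi.mulSingle v p.1) p.2
  skew : ∀ m α, π m α α = 0
  smooth : ∀ f g : M → ℝ, ContMDiff 𝓘(ℝ, A) 𝓘(ℝ, ℝ) ∞ f → ContMDiff 𝓘(ℝ, A) 𝓘(ℝ, ℝ) ∞ g →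
    ContMDiff 𝓘(ℝ, A) 𝓘(ℝ, ℝ) ∞ (poisson π f g)
  invariant : ∀ (g : V → G) (m : M) (α β : Cot A (Φ g m)),
    π (Φ g m) α β = π m (α.comp (mfderiv 𝓘(ℝ, A) 𝓘(ℝ, A) (Φ g) m))
      (β.comp (mfderiv 𝓘(ℝ, A) 𝓘(ℝ, A) (Φ g) m))
  jacobi : ∀ f g h : M → ℝ, ContMDiff 𝓘(ℝ, A) 𝓘(ℝ, ℝ) ∞ f → ContMDiff 𝓘(ℝ, A) 𝓘(ℝ, ℝ) ∞ g →
    ContMDiff 𝓘(ℝ, A) 𝓘(ℝ, ℝ) ∞ h → ∀ m,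
    poisson π f (poisson π g h) m + poisson π g (poisson π h f) m + poisson π h (poisson π f g) m
      = (1 / 4) * ∑ v, (dif A h m).comp (infActAt F A Φ v m)
          (lieBr G (sharp s ((dif A f m).comp (infActAt F A Φ v m)))
            (sharp s ((dif A g m).comp (infActAt F A Φ v m))))

/-- `μ : M → G^V` is a moment map twisted by the permutation of the vertices which walks against the
edges of `Γ` (denoted `w` here): it is equivariant for the action `(g • h)_v = g_{w v} h_v g_v⁻¹` of
`G^V` on itself, and
`(μ_v)_* π = ½ ∑ s^{ij} (ξ_i^L ⊗ ρ_v(ξ_j) + ξ_i^R ⊗ ρ_{w v}(ξ_j))` for every vertex `v`. -/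
structure IsTwistedMomentMap {E : Type*} (Γ : PermGraph V E) (s : F ⊗[ℝ] F)
    (Φ : (V → G) →* Equiv.Perm M) (π : Bivector A M) (μ : M → V → G) : Prop where
  smooth : ∀ v, ContMDiff 𝓘(ℝ, A) 𝓘(ℝ, F) ∞ fun m => μ m v
  equivariant : ∀ (g : V → G) (m : M) (v : V),
    μ (Φ g m) v = g (Γ.backward v) * μ m v * (g v)⁻¹
  moment : ∀ (m : M) (v : V) (θ : Cot F (μ m v)) (β : Cot A m),
    π m (θ.comp (mfderiv 𝓘(ℝ, A) 𝓘(ℝ, F) (fun x => μ x v) m)) β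
      = (1 / 2) * (β (infActAt F A Φ v m (sharp s (θ.comp (leftInv (μ m v)))))
          + β (infActAt F A Φ (Γ.backward v) m (sharp s (θ.comp (rightInv (μ m v))))))

/-- The map `μ̃ : M → G^E`, `μ̃_e = (μ_{in(e)})⁻¹`, given by a map `μ : M → G^V`. -/
def edgeMap {E : Type*} (Γ : PermGraph V E) (μ : M → V → G) (m : M) (e : E) : G :=
  (μ m (Γ.inn e))⁻¹

/-- The map `μ : M → G^V` with a given associated map `μ̃ : M → G^E`. -/
def vertexMap {E : Type*} (Γ : PermGraph V E) (μ' : M → E → G) (m : M) (v : V) : G :=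
  (μ' m (Γ.edgeIn v))⁻¹

end QuasiPoisson

/-! ## Quasi-Hamiltonian structures: morphisms of Manin pairs
`R : (𝕋M, TM) ⇢ (𝔡^V, 𝔤^V) × G^E` -/

section Manin

variable {F : Type*} [NormedAddCommGroup F] [NormedSpace ℝ F] [FiniteDimensional ℝ F]
  {A : Type*} [NormedAddCommGroup A] [NormedSpace ℝ A]
  {M : Type*} [TopologicalSpace M] [ChartedSpace A M] [IsManifold 𝓘(ℝ, A) ∞ M]
  {V E : Type*} [Fintype V] [DecidableEq V]
  {G : Type*} [TopologicalSpace G] [ChartedSpace F G] [Group G] [LieGroup 𝓘(ℝ, F) ∞ G]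

variable (V F A) in
/-- The fibre over `(n, m)` of the product of the action Courant algebroid `𝔡^V × G^E` and of `𝕋M`
(with the metric of the latter negated); it does not depend on `n`. A triple `(ξ, X, α)` in a relation
`R` means `X + α ∼_R ξ`. -/
abbrev Fibre (m : M) := (V → Double F) × Tan A m × Cot A m

/-- The metric `⟨ξ, ξ'⟩ - ⟨X + α, X' + α'⟩`. -/
def fibrePairing (s : F ⊗[ℝ] F) {m : M} (r r' : Fibre F A V m) : ℝ :=
  (∑ v, pairing s (r.1 v) (r'.1 v)) - (r.2.2 r'.2.1 + r'.2.2 r.2.1)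

/-- The action of `𝔡^V` on the factor `e` of `G^E`:
the vector field `-𝗌(ξ_{in(e)})^R + 𝗍(ξ_{out(e)})^L`. -/
def anchorAt (Γ : PermGraph V E) (s : F ⊗[ℝ] F) (ξ : V → Double F) (e : E) (g : G) : Tan F g :=
  -rightInv g (src (ξ (Γ.inn e))) + leftInv g (tgt s (ξ (Γ.out e)))

variable (V F A M) in
/-- Sections, along the graph of a map `M → G^E` (identified with `M`), of the product Courant
algebroid. -/
structure Sec where
  /-- the component in `𝔡^V` -/
  ξ : M → V → Double F
  /-- the vector field -/
  X : (m : M) → Tan A m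
  /-- the 1-form -/
  α : (m : M) → Cot A m

/-- The value of a section. -/
def Sec.val (e : Sec F A M V) (m : M) : Fibre F A V m := (e.ξ m, e.X m, e.α m)

/-- Smooth sections. -/
structure Sec.Smooth (e : Sec F A M V) : Prop where
  ξ : ContMDiff 𝓘(ℝ, A) 𝓘(ℝ, V → Double F) ∞ e.ξ
  X : SmoothVec e.X
  α : SmoothForm e.α

/-- The derivative of the `𝔡^V`-component of a section. -/
def Sec.dξ (e : Sec F A M V) (m : M) : Tan A m →L[ℝ] (V → Double F) :=
  (mfderiv 𝓘(ℝ, A) 𝓘(ℝ, V → Double F) e.ξ m :)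

/-- The Courant bracket of two sections along the graph, computed from their extensions to
`G^E × M` which are constant in the direction of `G^E`. The components are
`[ξ₁, ξ₂] + L_{X₁} ξ₂ - L_{X₂} ξ₁`, `[X₁, X₂]` and
`L_{X₁} α₂ - ι_{X₂} dα₁ - ⟨dξ₁, ξ₂⟩`, with `L_X = d ι_X + ι_X d` on 1-forms.
(The term `⟨dξ₁, ξ₂⟩` comes with a minus sign as the metric of `𝕋M` is negated; the
derivatives in the direction of `G^E` vanish for the chosen extensions.) For a Lagrangian
subbundle along the graph whose anchor is tangent to the graph, the bracket computed from other
extensions of two sections of the subbundle differs from this one by a section of the subbundle. -/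
def Sec.bracket (G : Type*) [TopologicalSpace G] [ChartedSpace F G] [Group G]
    [LieGroup 𝓘(ℝ, F) ∞ G] (s : F ⊗[ℝ] F) (e₁ e₂ : Sec F A M V) : Sec F A M V where
  ξ m v := doubleBr G s (e₁.ξ m v) (e₂.ξ m v) + e₂.dξ m (e₁.X m) v - e₁.dξ m (e₂.X m) v
  X := VectorField.mlieBracket 𝓘(ℝ, A) e₁.X e₂.X
  α m := dif A (fun x => e₂.α x (e₁.X x)) m + iotaD e₂.α m (e₁.X m) - iotaD e₁.α m (e₂.X m)
    - ∑ v, (pairWith s (e₂.ξ m v)).comp ((ContinuousLinearMap.proj v).comp (e₁.dξ m))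

/-- `R` is a morphism of Manin pairs `(𝕋M, TM) ⇢ (𝔡^V, 𝔤^V) × G^E` over `μ : M → G^E`:
a Dirac structure supported on the graph of `μ` (a smooth, Lagrangian, involutive
subbundle, with anchor tangent to the graph) such that `R ∘ TM ⊆ 𝔤^V` and `ker R ∩ TM = 0`. -/
structure IsManinMorphism (Γ : PermGraph V E) (s : F ⊗[ℝ] F) (μ : M → E → G)
    (R : (m : M) → Submodule ℝ (Fibre F A V m)) : Prop where
  smooth_map : ∀ e, ContMDiff 𝓘(ℝ, A) 𝓘(ℝ, F) ∞ fun m => μ m e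
  smooth : ∀ m, ∀ r ∈ R m, ∃ e : Sec F A M V, e.Smooth ∧ (∀ x, e.val x ∈ R x) ∧ e.val m = r
  lagrangian : ∀ m r, r ∈ R m ↔ ∀ r' ∈ R m, fibrePairing s r r' = 0
  anchor : ∀ m, ∀ r ∈ R m, ∀ e,
    mfderiv 𝓘(ℝ, A) 𝓘(ℝ, F) (fun x => μ x e) m r.2.1 = anchorAt Γ s r.1 e (μ m e)
  involutive : ∀ e₁ e₂ : Sec F A M V, e₁.Smooth → e₂.Smooth →
    (∀ x, e₁.val x ∈ R x) → (∀ x, e₂.val x ∈ R x) → ∀ x, (Sec.bracket G s e₁ e₂).val x ∈ R x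
  image_le : ∀ m (ξ : V → Double F) (X : Tan A m), (ξ, X, 0) ∈ R m → ∃ x : V → F, ξ = unit x
  ker_inf : ∀ m (X : Tan A m), (0, X, 0) ∈ R m → X = 0

/-- `R` is compatible with the action of `𝔤^V` on `M`: `ρ(x) ∼_R x` for all `x ∈ 𝔤^V`. -/
def CompatibleWithAction (Φ : (V → G) →* Equiv.Perm M)
    (R : (m : M) → Submodule ℝ (Fibre F A V m)) : Prop :=
  ∀ m (x : V → F), (unit x, infAct F A Φ m x, 0) ∈ R m

/-- `𝔨 ∘ R = gr(π^♯)`, for the canonical Lagrangian complement `𝔨` of `𝔤^V` in `𝔡^V`, where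
`gr(π^♯) = {π(α, ·) + α}`. -/
def IsGraphOf (s : F ⊗[ℝ] F) (R : (m : M) → Submodule ℝ (Fibre F A V m)) (π : Bivector A M) : Prop :=
  ∀ m (X : Tan A m) (α : Cot A m),
    (∃ κ : V → Double F, (∀ v, κ v ∈ complement s) ∧ (κ, X, α) ∈ R m) ↔ ∀ β : Cot A m, β X = π m α β

/-- `R` is the quasi-Hamiltonian structure over `μ : M → G^E` corresponding to the quasi-Poisson
structure `(Φ, π)`. -/
structure Corresponds (Γ : PermGraph V E) (s : F ⊗[ℝ] F) (Φ : (V → G) →* Equiv.Perm M)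
    (π : Bivector A M) (μ : M → E → G) (R : (m : M) → Submodule ℝ (Fibre F A V m)) : Prop where
  morphism : IsManinMorphism Γ s μ R
  compatible : CompatibleWithAction Φ R
  graph : IsGraphOf s R π

end Manin

/-! ## Fusion -/

section Fuse

variable {F : Type*} [NormedAddCommGroup F] [NormedSpace ℝ F] [FiniteDimensional ℝ F]
  {A : Type*} [NormedAddCommGroup A] [NormedSpace ℝ A]
  {M : Type*} [TopologicalSpace M] [ChartedSpace A M] [IsManifold 𝓘(ℝ, A) ∞ M]
  {V E : Type*} [Fintype V] [DecidableEq V] [DecidableEq E]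
  {G : Type*} [TopologicalSpace G] [ChartedSpace F G] [Group G] [LieGroup 𝓘(ℝ, F) ∞ G]
  (Γ : PermGraph V E) (s : F ⊗[ℝ] F) {P Q : V}

/-- The relation `(ξ, g) ∼ (ξ*, g*)` from `𝔡^V × G^E` to `𝔡^{V*} × G^{E*}` defining fusion at
`(P, Q)`: the edge labels are related by the map `G^E → G^{E*}`, the elements `ξ_Q` and `ξ_P` are
composable with composite the label of `ξ*` at the merged vertex, and `ξ*` agrees with `ξ` at the
other vertices. -/
def FusionRel (P Q : V) (x : (V → Double F) × (E → G))
    (y : ({v : V // v ≠ Q} → Double F) × ({e : E // e ≠ Γ.edgeIn Q} → G)) : Prop :=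
  y.2 = fuseHol Γ P Q x.2 ∧ src (x.1 Q) = tgt s (x.1 P) ∧
    ∀ v, y.1 v = if v.1 = P then comp (x.1 Q) (x.1 P) else x.1 v.1

/-- The fused morphism `R* = R_{(P,Q)} ∘ R`, for a relation `R` over `μ : M → G^E`. -/
def fuseMorphism (P Q : V) (μ : M → E → G) (R : (m : M) → Submodule ℝ (Fibre F A V m)) (m : M) :
    Submodule ℝ (Fibre F A {v : V // v ≠ Q} m) where
  carrier := {r | ∃ ξ : V → Double F, (ξ, r.2) ∈ R m ∧
    FusionRel Γ s P Q (ξ, μ m) (r.1, fuseHol Γ P Q (μ m))}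
  zero_mem' := ⟨0, (R m).zero_mem, rfl, by simp [src, tgt], fun v => by
    by_cases hv : v.1 = P <;> simp [hv, comp, Prod.zero_eq_mk]⟩
  add_mem' := by
    rintro r r' ⟨ξ, h1, -, h2, h3⟩ ⟨ξ', h1', -, h2', h3'⟩
    refine ⟨ξ + ξ', (R m).add_mem h1 h1', rfl, ?_, fun v => ?_⟩
    · simp only [src, tgt, Pi.add_apply, Prod.fst_add, Prod.snd_add, map_add] at *
      rw [h2, h2']
      abel
    · have e := h3 v
      have e' := h3' v
      by_cases hv : v.1 = P
      · simp only [hv, if_true, comp] at e e' ⊢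
        simp only [Prod.fst_add, Pi.add_apply, Prod.snd_add, e, e', Prod.mk_add_mk]
        exact Prod.ext rfl (by simp only; abel)
      · simp only [hv, if_false] at e e' ⊢
        simp [e, e']
  smul_mem' := by
    rintro c r ⟨ξ, h1, -, h2, h3⟩
    refine ⟨c • ξ, (R m).smul_mem c h1, rfl, ?_, fun v => ?_⟩
    · simp only [src, tgt, Pi.smul_apply, Prod.smul_fst, Prod.smul_snd, map_smul] at *
      rw [h2, smul_add]
    · have e := h3 v
      by_cases hv : v.1 = P
      · simp only [hv, if_true, comp] at e ⊢
        simp [e, smul_add]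
      · simp only [hv, if_false] at e ⊢
        simp [e]

/-- The action of `G^{V*}` obtained from an action of `G^V` on letting the group at the merged
vertex act diagonally through the factors `P` and `Q`. -/
def fuseAction (h : P ≠ Q) (Φ : (V → G) →* Equiv.Perm M) :
    ({v : V // v ≠ Q} → G) →* Equiv.Perm M :=
  Φ.comp
    { toFun := fun g v => g (collapse h v)
      map_one' := rfl
      map_mul' := fun _ _ => rfl }

/-- The bivector field `π - ρ(τ)` of the fusion at `(P, Q)` of a quasi-Poisson manifold, in the
convention of Alekseev, Kosmann-Schwarzbach and Meinrenken. -/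
def akmFusion {ι : Type*} [Fintype ι] (ξ : Module.Basis ι ℝ F) (P Q : V)
    (Φ : (V → G) →* Equiv.Perm M) (π : Bivector A M) : Bivector A M :=
  π - pushBivector Φ (fusionTensor ξ s P Q)

end Fuse

end

end Fusion

/-!
# Fusion of quasi-Poisson manifolds and of quasi-Hamiltonian structures

A quasi-Hamiltonian structure `R` corresponding to `(Φ, π)` is determined by its two defining
conditions: it consists of the triples `(ξ, X, α)` for which `ξ_v = x_v + (a_v - ½ s^♯(a_v))` with
`a_v = ρ_v^* α`, and `X = ρ(x) + π(α, ·)` (`StdForm`, `Corresponds.stdForm`). Conversely, a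
relation of this form is Lagrangian, contains `ρ(x) ∼ x`, is transversal to `TM`, and determines
the bivector field `π` as its graph.

The fused morphism is again of this form, for the diagonal action and `π + ρ(τ)` (`StdForm.fuse`).
Indeed the composite of `ξ_Q` and `ξ_P` has the source of `ξ_P`, and composability says that the
source of `ξ_Q` is that of `ξ_P` shifted by `s^♯(a_P)`. In the decomposition of the double along
`𝔤` and the complement, the `𝔤`-component of the composite differs from those of `ξ_P` and `ξ_Q`
by `½ s^♯(a_Q)` and `-½ s^♯(a_P)`; the image of these two shifts under `ρ` is the vector field
`-ρ(τ)(α, ·)`, which the correction of the bivector field compensates.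

That the fused morphism is a morphism of Manin pairs is then checked directly. Its anchor is
tangent to the graph of the fused map because the contributions at the inner end of a composed
edge cancel by composability (`fuse_anchor`). It is involutive (`fuse_involutive`), because a
section of it lifts to a unique section of `R`, and because the target and the composition of the
double are compatible with the brackets and the metrics: the double is a groupoid in the category
of Lie algebras (`tgt_doubleBr`, `comp_doubleBr`, `pairWith_comp`). This requires the
infinitesimal form of the invariance of `s` (`sharp_coad`), and hence that the derivative of `Ad`
at the identity is the bracket of left invariant vector fields (`exists_hasFDerivAt_Ad`).

The axioms of a quasi-Poisson manifold with a moment map follow from the properties of the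
morphism. Involutivity on the sections of `R` over Hamiltonian vector fields is the Jacobi
identity up to the trivector `φ` (`jacobi_of_involutive`); the trivector is the `𝔤`-component of
the bracket of two elements of the complement. The anchor condition on the elements over the
complement is the moment map condition (`moment_of_anchor`). Invariance of `ρ(τ)` under the
diagonal action follows from that of `s` and the equivariance of the infinitesimal action
(`der_infActAt`).
-/

namespace Fusion

open VectorField Filter
open scoped Topology

/-! ### The map `s^♯` of a symmetric tensor -/

section LinearAlgebra

variable {F : Type*} [NormedAddCommGroup F] [NormedSpace ℝ F]

theorem sharp_tmul (x y : F) (a : F →L[ℝ] ℝ) : sharp (x ⊗ₜ[ℝ] y) a = a x • y := by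
  simp [sharp]

theorem sharp_add_tensor (s t : F ⊗[ℝ] F) (a : F →L[ℝ] ℝ) :
    sharp (s + t) a = sharp s a + sharp t a := by
  simp [sharp]

theorem sharp_zero_tensor (a : F →L[ℝ] ℝ) : sharp (0 : F ⊗[ℝ] F) a = 0 := by
  simp [sharp]

theorem sharp_comm (s : F ⊗[ℝ] F) (a b : F →L[ℝ] ℝ) :
    b (sharp (TensorProduct.comm ℝ F F s) a) = a (sharp s b) := by
  induction s using TensorProduct.induction_on with
  | zero => simp [sharp_zero_tensor]
  | tmul x y => simp [sharp_tmul, mul_comm]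
  | add s t hs ht => simp [sharp_add_tensor, hs, ht]

theorem sharp_symm {s : F ⊗[ℝ] F} (hs : TensorProduct.comm ℝ F F s = s) (a b : F →L[ℝ] ℝ) :
    b (sharp s a) = a (sharp s b) := by
  conv_lhs => rw [← hs]
  exact sharp_comm s a b

theorem sharp_map (f : F →L[ℝ] F) (s : F ⊗[ℝ] F) (a : F →L[ℝ] ℝ) :
    sharp (TensorProduct.map f.toLinearMap f.toLinearMap s) a = f (sharp s (a.comp f)) := by
  induction s using TensorProduct.induction_on with
  | zero => simp [sharp_zero_tensor]
  | tmul x y => simp [sharp_tmul]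
  | add s t hs ht => simp [sharp_add_tensor, hs, ht]

/-- The coordinates of `s` in a basis enter only through `s^♯`. -/
theorem sum_repr_sharp {ι : Type*} [Fintype ι] (ξ : Module.Basis ι ℝ F) (s : F ⊗[ℝ] F)
    (a b : F →L[ℝ] ℝ) :
    ∑ i, ∑ j, (ξ.tensorProduct ξ).repr s (i, j) * (a (ξ i) * b (ξ j)) = b (sharp s a) := by
  induction s using TensorProduct.induction_on with
  | zero => simp [sharp_zero_tensor]
  | tmul x y =>
    simp only [Module.Basis.tensorProduct_repr_tmul_apply, sharp_tmul, map_smul, smul_eq_mul]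
    have ha : a x = ∑ i, ξ.repr x i * a (ξ i) := by
      have h := congrArg a (ξ.sum_repr x)
      rw [map_sum] at h
      simpa using h.symm
    have hb : b y = ∑ i, ξ.repr y i * b (ξ i) := by
      have h := congrArg b (ξ.sum_repr y)
      rw [map_sum] at h
      simpa using h.symm
    rw [ha, hb, Finset.sum_mul_sum]
    exact Finset.sum_congr rfl fun i _ => Finset.sum_congr rfl fun j _ => by ring
  | add s t hs ht =>
    simp only [map_add, Finsupp.add_apply, add_mul, Finset.sum_add_distrib, hs, ht,
      sharp_add_tensor]

variable {V : Type*} [DecidableEq V]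

theorem fusionTensor_apply {ι : Type*} [Fintype ι] (ξ : Module.Basis ι ℝ F) (s : F ⊗[ℝ] F)
    (P Q : V) (a b : (V → F) →L[ℝ] ℝ) :
    fusionTensor ξ s P Q a b = (1 / 2) *
      (b.comp (ContinuousLinearMap.single ℝ (fun _ => F) Q)
        (sharp s (a.comp (ContinuousLinearMap.single ℝ (fun _ => F) P)))
      - a.comp (ContinuousLinearMap.single ℝ (fun _ => F) Q)
        (sharp s (b.comp (ContinuousLinearMap.single ℝ (fun _ => F) P)))) := by
  rw [← sum_repr_sharp ξ, ← sum_repr_sharp ξ]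
  simp only [fusionTensor, wedge, LinearMap.smul_apply, LinearMap.sum_apply,
    LinearMap.mk₂_apply, smul_eq_mul, ← Finset.sum_sub_distrib]
  congr 1
  refine Finset.sum_congr rfl fun i _ => Finset.sum_congr rfl fun j _ => ?_
  simp
  ring

end LinearAlgebra

/-! ### Vector fields, 1-forms and functions in charts -/

section Charts

variable {A : Type*} [NormedAddCommGroup A] [NormedSpace ℝ A]
  {M : Type*} [TopologicalSpace M] [ChartedSpace A M]

/-- A vector field read in the preferred chart at `x₀`, as a function on the model space. -/
noncomputable def vecInChart (X : (m : M) → Tan A m) (x₀ : M) (u : A) : A :=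
  (mfderiv 𝓘(ℝ, A) 𝓘(ℝ, A) (extChartAt 𝓘(ℝ, A) x₀) ((extChartAt 𝓘(ℝ, A) x₀).symm u) : A →L[ℝ] A)
    (X ((extChartAt 𝓘(ℝ, A) x₀).symm u))

theorem dif_eq_fderiv_self {f : M → ℝ} {x₀ : M}
    (hf : MDifferentiableAt 𝓘(ℝ, A) 𝓘(ℝ, ℝ) f x₀) :
    (dif A f x₀ : A →L[ℝ] ℝ) =
      fderiv ℝ (f ∘ (extChartAt 𝓘(ℝ, A) x₀).symm) (extChartAt 𝓘(ℝ, A) x₀ x₀) := by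
  have h := hf.mfderiv
  rw [ModelWithCorners.range_eq_univ, fderivWithin_univ] at h
  exact h

variable [IsManifold 𝓘(ℝ, A) ∞ M]

theorem minSmoothness_two_le : minSmoothness ℝ 2 ≤ ∞ := by
  rw [minSmoothness_of_isRCLikeNormedField]
  exact WithTop.coe_le_coe.2 le_top

theorem isManifold_two : IsManifold 𝓘(ℝ, A) 2 M :=
  IsManifold.of_le (n := ∞) (by exact WithTop.coe_le_coe.2 le_top)

theorem isManifold_one : IsManifold 𝓘(ℝ, A) 1 M :=
  IsManifold.of_le (n := ∞) (by exact WithTop.coe_le_coe.2 le_top)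

theorem mfderiv_extChartAt_comp_symm {x₀ : M} {u : A} (hu : u ∈ (extChartAt 𝓘(ℝ, A) x₀).target) :
    ((mfderiv 𝓘(ℝ, A) 𝓘(ℝ, A) (extChartAt 𝓘(ℝ, A) x₀) ((extChartAt 𝓘(ℝ, A) x₀).symm u) :
      A →L[ℝ] A)).comp (mfderiv 𝓘(ℝ, A) 𝓘(ℝ, A) (extChartAt 𝓘(ℝ, A) x₀).symm u : A →L[ℝ] A) =
      ContinuousLinearMap.id ℝ A := by
  have := isManifold_one (A := A) (M := M)
  have h := mfderiv_extChartAt_comp_mfderivWithin_extChartAt_symm (I := 𝓘(ℝ, A)) hu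
  rw [ModelWithCorners.range_eq_univ, mfderivWithin_univ] at h
  exact h

theorem mfderiv_symm_comp_extChartAt {x₀ : M} {u : A} (hu : u ∈ (extChartAt 𝓘(ℝ, A) x₀).target) :
    (mfderiv 𝓘(ℝ, A) 𝓘(ℝ, A) (extChartAt 𝓘(ℝ, A) x₀).symm u : A →L[ℝ] A).comp
      ((mfderiv 𝓘(ℝ, A) 𝓘(ℝ, A) (extChartAt 𝓘(ℝ, A) x₀) ((extChartAt 𝓘(ℝ, A) x₀).symm u) :
      A →L[ℝ] A)) =
      ContinuousLinearMap.id ℝ A := by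
  have := isManifold_one (A := A) (M := M)
  have h := mfderivWithin_extChartAt_symm_comp_mfderiv_extChartAt (I := 𝓘(ℝ, A)) hu
  rw [ModelWithCorners.range_eq_univ, mfderivWithin_univ] at h
  exact h

theorem mpullbackWithin_eq_vecInChart (X : (m : M) → Tan A m) {x₀ : M} {u : A}
    (hu : u ∈ (extChartAt 𝓘(ℝ, A) x₀).target) :
    mpullbackWithin 𝓘(ℝ, A) 𝓘(ℝ, A) (extChartAt 𝓘(ℝ, A) x₀).symm X
      (Set.range 𝓘(ℝ, A)) u = vecInChart X x₀ u := by
  rw [mpullbackWithin_apply, ModelWithCorners.range_eq_univ, mfderivWithin_univ]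
  have h := ContinuousLinearMap.inverse_eq (mfderiv_symm_comp_extChartAt hu)
    (mfderiv_extChartAt_comp_symm hu)
  exact DFunLike.congr_fun h _

theorem mpullbackWithin_eventuallyEq_vecInChart (X : (m : M) → Tan A m) (x₀ : M) :
    mpullbackWithin 𝓘(ℝ, A) 𝓘(ℝ, A) (extChartAt 𝓘(ℝ, A) x₀).symm X
      (Set.range 𝓘(ℝ, A)) =ᶠ[𝓝 (extChartAt 𝓘(ℝ, A) x₀ x₀)] vecInChart X x₀ := by
  filter_upwards [extChartAt_target_mem_nhds (I := 𝓘(ℝ, A)) x₀] with u hu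
  exact mpullbackWithin_eq_vecInChart X hu

theorem differentiableAt_vecInChart [CompleteSpace A] {X : (m : M) → Tan A m} {x₀ : M}
    (hX : MDifferentiableAt 𝓘(ℝ, A) (𝓘(ℝ, A).prod 𝓘(ℝ, A))
      (fun m => (⟨m, X m⟩ : TangentBundle 𝓘(ℝ, A) M)) x₀) :
    DifferentiableAt ℝ (vecInChart X x₀) (extChartAt 𝓘(ℝ, A) x₀ x₀) := by
  have := isManifold_two (A := A) (M := M)
  have h := MDifferentiableWithinAt.differentiableWithinAt_mpullbackWithin_vectorField
    (s := Set.univ) hX.mdifferentiableWithinAt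
  have hu : (extChartAt 𝓘(ℝ, A) x₀).symm ⁻¹' Set.univ ∩ Set.range 𝓘(ℝ, A) = Set.univ := by simp
  rw [hu] at h
  exact (mpullbackWithin_eventuallyEq_vecInChart X x₀).differentiableAt_iff.1
    (differentiableWithinAt_univ.1 h)

theorem vecInChart_self (X : (m : M) → Tan A m) (x₀ : M) :
    vecInChart X x₀ (extChartAt 𝓘(ℝ, A) x₀ x₀) = X x₀ := by
  have := isManifold_one (A := A) (M := M)
  rw [vecInChart, extChartAt_to_inv, mfderiv_extChartAt_self]
  rfl

theorem mlieBracket_eq_vecInChart (X Y : (m : M) → Tan A m) (x₀ : M) :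
    (mlieBracket 𝓘(ℝ, A) X Y x₀ : A) =
      fderiv ℝ (vecInChart Y x₀) (extChartAt 𝓘(ℝ, A) x₀ x₀) (X x₀)
        - fderiv ℝ (vecInChart X x₀) (extChartAt 𝓘(ℝ, A) x₀ x₀) (Y x₀) := by
  have := isManifold_one (A := A) (M := M)
  have hinv : ∀ T : A →L[ℝ] A, T = ContinuousLinearMap.id ℝ A → ∀ w, T.inverse w = w := by
    rintro T rfl w
    rw [ContinuousLinearMap.inverse_id]
    rfl
  have eX := mpullbackWithin_eventuallyEq_vecInChart X x₀
  have eY := mpullbackWithin_eventuallyEq_vecInChart Y x₀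
  refine (hinv _ mfderiv_extChartAt_self _).trans ?_
  have hu : (extChartAt 𝓘(ℝ, A) x₀).symm ⁻¹' Set.univ ∩ Set.range 𝓘(ℝ, A) = Set.univ := by simp
  rw [hu]
  refine (congrFun lieBracketWithin_univ _).trans ?_
  refine (eX.lieBracket_vectorField_eq eY).trans ?_
  rw [lieBracket, vecInChart_self, vecInChart_self]

theorem dif_eq_fderiv {f : M → ℝ} {x₀ : M} {u : A} (hu : u ∈ (extChartAt 𝓘(ℝ, A) x₀).target)
    (hf : MDifferentiableAt 𝓘(ℝ, A) 𝓘(ℝ, ℝ) f ((extChartAt 𝓘(ℝ, A) x₀).symm u)) :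
    fderiv ℝ (f ∘ (extChartAt 𝓘(ℝ, A) x₀).symm) u =
      (dif A f ((extChartAt 𝓘(ℝ, A) x₀).symm u) : A →L[ℝ] ℝ).comp
        (mfderiv 𝓘(ℝ, A) 𝓘(ℝ, A) (extChartAt 𝓘(ℝ, A) x₀).symm u : A →L[ℝ] A) := by
  have := isManifold_one (A := A) (M := M)
  rw [← mfderiv_eq_fderiv]
  refine mfderiv_comp (I' := 𝓘(ℝ, A)) u hf ?_
  have h := mdifferentiableWithinAt_extChartAt_symm (I := 𝓘(ℝ, A)) hu
  rwa [ModelWithCorners.range_eq_univ, mdifferentiableWithinAt_univ] at h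

theorem fderiv_vecInChart {f : M → ℝ} {x₀ : M} {u : A} (hu : u ∈ (extChartAt 𝓘(ℝ, A) x₀).target)
    (hf : MDifferentiableAt 𝓘(ℝ, A) 𝓘(ℝ, ℝ) f ((extChartAt 𝓘(ℝ, A) x₀).symm u))
    (X : (m : M) → Tan A m) :
    fderiv ℝ (f ∘ (extChartAt 𝓘(ℝ, A) x₀).symm) u (vecInChart X x₀ u) =
      dif A f ((extChartAt 𝓘(ℝ, A) x₀).symm u) (X ((extChartAt 𝓘(ℝ, A) x₀).symm u)) := by
  rw [dif_eq_fderiv hu hf]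
  have h := DFunLike.congr_fun (mfderiv_symm_comp_extChartAt hu)
    (X ((extChartAt 𝓘(ℝ, A) x₀).symm u))
  exact congrArg _ h

theorem contDiffAt_comp_symm {f : M → ℝ} (hf : ContMDiff 𝓘(ℝ, A) 𝓘(ℝ, ℝ) ∞ f) (x₀ : M) :
    ContDiffAt ℝ ∞ (f ∘ (extChartAt 𝓘(ℝ, A) x₀).symm) (extChartAt 𝓘(ℝ, A) x₀ x₀) := by
  rw [← contMDiffAt_iff_contDiffAt]
  refine hf.contMDiffAt.comp _ ?_
  exact (contMDiffOn_extChartAt_symm x₀).contMDiffAt (extChartAt_target_mem_nhds x₀)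

/-- A bracket of vector fields acts on functions as a commutator. -/
theorem dif_mlieBracket [CompleteSpace A] {f : M → ℝ} (hf : ContMDiff 𝓘(ℝ, A) 𝓘(ℝ, ℝ) ∞ f)
    {X Y : (m : M) → Tan A m} {x₀ : M}
    (hX : MDifferentiableAt 𝓘(ℝ, A) (𝓘(ℝ, A).prod 𝓘(ℝ, A))
      (fun m => (⟨m, X m⟩ : TangentBundle 𝓘(ℝ, A) M)) x₀)
    (hY : MDifferentiableAt 𝓘(ℝ, A) (𝓘(ℝ, A).prod 𝓘(ℝ, A))
      (fun m => (⟨m, Y m⟩ : TangentBundle 𝓘(ℝ, A) M)) x₀)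
    (hXf : MDifferentiableAt 𝓘(ℝ, A) 𝓘(ℝ, ℝ) (fun m => dif A f m (X m)) x₀)
    (hYf : MDifferentiableAt 𝓘(ℝ, A) 𝓘(ℝ, ℝ) (fun m => dif A f m (Y m)) x₀) :
    dif A f x₀ (mlieBracket 𝓘(ℝ, A) X Y x₀) =
      dif A (fun m => dif A f m (Y m)) x₀ (X x₀) - dif A (fun m => dif A f m (X m)) x₀ (Y x₀) := by
  set φ := extChartAt 𝓘(ℝ, A) x₀ with hφ
  set h := f ∘ φ.symm with hh
  have h2 := contDiffAt_comp_symm hf x₀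
  have hd : DifferentiableAt ℝ (fderiv ℝ h) (φ x₀) :=
    (h2.fderiv_right (m := 1) (WithTop.coe_le_coe.2 le_top)).differentiableAt one_ne_zero
  have hfd : MDifferentiable 𝓘(ℝ, A) 𝓘(ℝ, ℝ) f := hf.mdifferentiable (by simp)
  -- the product rule in the chart, for the function `df(Z)`
  have key : ∀ Z : (m : M) → Tan A m, MDifferentiableAt 𝓘(ℝ, A) (𝓘(ℝ, A).prod 𝓘(ℝ, A))
      (fun m => (⟨m, Z m⟩ : TangentBundle 𝓘(ℝ, A) M)) x₀ →
      MDifferentiableAt 𝓘(ℝ, A) 𝓘(ℝ, ℝ) (fun m => dif A f m (Z m)) x₀ → ∀ v : A,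
      (dif A (fun m => dif A f m (Z m)) x₀ : A →L[ℝ] ℝ) v =
        fderiv ℝ (fderiv ℝ h) (φ x₀) v (Z x₀) + fderiv ℝ h (φ x₀)
          (fderiv ℝ (vecInChart Z x₀) (φ x₀) v) := by
    intro Z hZ hZf v
    rw [dif_eq_fderiv_self hZf]
    have e : (fun m => dif A f m (Z m)) ∘ φ.symm =ᶠ[𝓝 (φ x₀)]
        fun u => fderiv ℝ h u (vecInChart Z x₀ u) := by
      filter_upwards [extChartAt_target_mem_nhds (I := 𝓘(ℝ, A)) x₀] with u hu
      exact (fderiv_vecInChart hu hfd.mdifferentiableAt Z).symm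
    rw [e.fderiv_eq, fderiv_clm_apply hd (differentiableAt_vecInChart hZ), vecInChart_self]
    exact add_comm _ _
  -- the second derivatives of `f` cancel in the commutator
  have e1 := key X hX hXf (Y x₀)
  have e2 := key Y hY hYf (X x₀)
  have sym : fderiv ℝ (fderiv ℝ h) (φ x₀) (X x₀) (Y x₀) =
      fderiv ℝ (fderiv ℝ h) (φ x₀) (Y x₀) (X x₀) :=
    (h2.isSymmSndFDerivAt minSmoothness_two_le) _ _
  have e0 := dif_eq_fderiv_self (hfd x₀)
  have e3 := mlieBracket_eq_vecInChart X Y x₀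
  refine Eq.trans ?_ (congrArg₂ (· - ·) e2 e1).symm
  refine (DFunLike.congr_fun e0 _).trans ?_
  refine (congrArg (fderiv ℝ h (φ x₀)) e3).trans ?_
  rw [map_sub, sym]
  ring

/-- Exact forms are closed. -/
theorem iotaD_dif {f : M → ℝ} (hf : ContMDiff 𝓘(ℝ, A) 𝓘(ℝ, ℝ) ∞ f) (x₀ : M) (X : Tan A x₀) :
    iotaD (dif A f) x₀ X = 0 := by
  set φ := extChartAt 𝓘(ℝ, A) x₀ with hφ
  have h2 := contDiffAt_comp_symm hf x₀
  have hfd : MDifferentiable 𝓘(ℝ, A) 𝓘(ℝ, ℝ) f := hf.mdifferentiable (by simp)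
  have e : formInChart (dif A f) x₀ =ᶠ[𝓝 (φ x₀)] fderiv ℝ (f ∘ φ.symm) := by
    filter_upwards [extChartAt_target_mem_nhds (I := 𝓘(ℝ, A)) x₀] with u hu
    exact (dif_eq_fderiv hu hfd.mdifferentiableAt).symm
  have sym := h2.isSymmSndFDerivAt minSmoothness_two_le
  refine ContinuousLinearMap.ext fun Y => ?_
  have h : ∀ B : A →L[ℝ] A →L[ℝ] ℝ, B = fderiv ℝ (fderiv ℝ (f ∘ φ.symm)) (φ x₀) →
      ∀ v w, (B v - B.flip v) w = 0 := by
    rintro B rfl v w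
    exact sub_eq_zero.2 (sym _ _)
  exact h _ e.fderiv_eq _ _

end Charts

/-! ### Smoothness of vector fields and forms -/

section SmoothFields

variable {F : Type*} [NormedAddCommGroup F] [NormedSpace ℝ F]
  {A : Type*} [NormedAddCommGroup A] [NormedSpace ℝ A]
  {M : Type*} [TopologicalSpace M] [ChartedSpace A M]

theorem contMDiffAt_of_forall_dual {B : Type*} [NormedAddCommGroup B] [NormedSpace ℝ B]
    [FiniteDimensional ℝ B] {f : M → B} {x : M}
    (h : ∀ l : B →L[ℝ] ℝ, ContMDiffAt 𝓘(ℝ, A) 𝓘(ℝ, ℝ) ∞ (fun m => l (f m)) x) :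
    ContMDiffAt 𝓘(ℝ, A) 𝓘(ℝ, B) ∞ f x := by
  have hd : Module.finrank ℝ B = Module.finrank ℝ (Fin (Module.finrank ℝ B) → ℝ) := by simp
  let e := ContinuousLinearEquiv.ofFinrankEq hd
  have h1 : ContMDiffAt 𝓘(ℝ, A) 𝓘(ℝ, Fin (Module.finrank ℝ B) → ℝ) ∞ (fun m => e (f m)) x :=
    contMDiffAt_pi_space.2 fun i =>
      h ((ContinuousLinearMap.proj (R := ℝ) (φ := fun _ => ℝ) i).comp
        (e : B →L[ℝ] Fin (Module.finrank ℝ B) → ℝ))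
  have h2 := (e.symm.contDiff (n := ∞)).contMDiff.contMDiffAt.comp x h1
  refine h2.congr_of_eventuallyEq (Eventually.of_forall fun m => ?_)
  simp

theorem contMDiff_clm_of_apply {B : Type*} [NormedAddCommGroup B] [NormedSpace ℝ B]
    [FiniteDimensional ℝ F] {f : M → F →L[ℝ] B}
    (h : ∀ y, ContMDiff 𝓘(ℝ, A) 𝓘(ℝ, B) ∞ fun m => f m y) :
    ContMDiff 𝓘(ℝ, A) 𝓘(ℝ, F →L[ℝ] B) ∞ f := by
  have hd : Module.finrank ℝ F = Module.finrank ℝ (Fin (Module.finrank ℝ F) → ℝ) := by simp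
  let e₁ := ContinuousLinearEquiv.ofFinrankEq hd
  let e₂ := (e₁.arrowCongr (1 : B ≃L[ℝ] B)).trans
    (ContinuousLinearEquiv.piRing (Fin (Module.finrank ℝ F)))
  have h1 : ContMDiff 𝓘(ℝ, A) 𝓘(ℝ, Fin (Module.finrank ℝ F) → B) ∞ (fun m => e₂ (f m)) :=
    contMDiff_pi_space.2 fun i => h _
  have h2 := (e₂.symm.contDiff (n := ∞)).contMDiff.comp h1
  refine h2.congr fun m => ?_
  simp

variable [IsManifold 𝓘(ℝ, A) ∞ M]

theorem smoothForm_dif {f : M → ℝ} (hf : ContMDiff 𝓘(ℝ, A) 𝓘(ℝ, ℝ) ∞ f) :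
    SmoothForm (dif A f) := by
  intro X hX
  have h1 : ContMDiff 𝓘(ℝ, A).tangent 𝓘(ℝ, ℝ).tangent ∞ (tangentMap 𝓘(ℝ, A) 𝓘(ℝ, ℝ) f) :=
    hf.contMDiff_tangentMap (by exact le_rfl)
  exact (contMDiff_snd_tangentBundle_modelSpace ℝ 𝓘(ℝ, ℝ)).comp (h1.comp hX)

theorem SmoothVec.mdifferentiableAt {X : (m : M) → Tan A m} (hX : SmoothVec X) (x : M) :
    MDifferentiableAt 𝓘(ℝ, A) (𝓘(ℝ, A).prod 𝓘(ℝ, A))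
      (fun m => (⟨m, X m⟩ : TangentBundle 𝓘(ℝ, A) M)) x :=
  (hX x).mdifferentiableAt (by simp)

theorem SmoothVec.add {X Y : (m : M) → Tan A m} (hX : SmoothVec X) (hY : SmoothVec Y) :
    SmoothVec fun m => X m + Y m := by
  have := isManifold_one (A := A) (M := M)
  exact ContMDiff.add_section hX hY

theorem SmoothVec.sum {ι : Type*} {s : Finset ι} {X : ι → (m : M) → Tan A m}
    (hX : ∀ i ∈ s, SmoothVec (X i)) : SmoothVec fun m => ∑ i ∈ s, X i m := by
  have := isManifold_one (A := A) (M := M)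
  exact ContMDiff.sum_section hX

theorem SmoothVec.smul {X : (m : M) → Tan A m} {f : M → ℝ}
    (hf : ContMDiff 𝓘(ℝ, A) 𝓘(ℝ, ℝ) ∞ f) (hX : SmoothVec X) :
    SmoothVec fun m => f m • X m := by
  have := isManifold_one (A := A) (M := M)
  exact ContMDiff.smul_section hf hX

/-- A vector field is smooth if it maps smooth functions to smooth functions. Bump functions extend
the coordinates of a chart to smooth functions on the manifold. -/
theorem smoothVec_of_dif [FiniteDimensional ℝ A] [T2Space M] {X : (m : M) → Tan A m}
    (h : ∀ f : M → ℝ, ContMDiff 𝓘(ℝ, A) 𝓘(ℝ, ℝ) ∞ f →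
      ContMDiff 𝓘(ℝ, A) 𝓘(ℝ, ℝ) ∞ fun m => dif A f m (X m)) : SmoothVec X := by
  have := isManifold_one (A := A) (M := M)
  intro x₀
  rw [Bundle.contMDiffAt_section]
  refine contMDiffAt_of_forall_dual fun l => ?_
  obtain ⟨b⟩ : Nonempty (SmoothBumpFunction 𝓘(ℝ, A) x₀) := inferInstance
  set φ := extChartAt 𝓘(ℝ, A) x₀ with hφ
  have hs : ContMDiff 𝓘(ℝ, A) 𝓘(ℝ, ℝ) ∞ fun m => b m • l (φ m) := by
    refine b.contMDiff_smul ?_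
    exact l.contDiff.contMDiff.comp_contMDiffOn (contMDiffOn_extChartAt (x := x₀))
  refine (h _ hs x₀).congr_of_eventuallyEq ?_
  filter_upwards [b.eventuallyEq_one.eventuallyEq_nhds,
    (chartAt A x₀).open_source.mem_nhds (mem_chart_source A x₀)] with m hm hmx
  have e : (fun m => b m • l (φ m)) =ᶠ[𝓝 m] l ∘ φ := by
    filter_upwards [hm] with y hy
    simp [hy]
  have hd : dif A (fun m => b m • l (φ m)) m =
      l.comp (mfderiv 𝓘(ℝ, A) 𝓘(ℝ, A) φ m : A →L[ℝ] A) := by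
    refine e.mfderiv_eq.trans ?_
    refine (mfderiv_comp (I' := 𝓘(ℝ, A)) m l.mdifferentiableAt
      (mdifferentiableAt_extChartAt hmx)).trans ?_
    rw [l.mfderiv_eq]
    rfl
  rw [hd]
  refine congrArg l ?_
  have h2 := TangentBundle.continuousLinearMapAt_trivializationAt (I := 𝓘(ℝ, A)) hmx
  have h3 := Bundle.Trivialization.coe_linearMapAt_of_mem (R := ℝ)
    (trivializationAt A (TangentSpace 𝓘(ℝ, A)) x₀) (b := m)
    (by simpa [TangentBundle.trivializationAt_baseSet] using hmx)
  refine Eq.trans ?_ (DFunLike.congr_fun h2 (X m))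
  exact (congrFun h3 (X m)).symm

end SmoothFields

/-! ### Derivatives of products and inverses in Lie groups -/

section ChainRules

variable {A : Type*} [NormedAddCommGroup A] [NormedSpace ℝ A]
  {B : Type*} [NormedAddCommGroup B] [NormedSpace ℝ B]
  {C : Type*} [NormedAddCommGroup C] [NormedSpace ℝ C]
  {D : Type*} [NormedAddCommGroup D] [NormedSpace ℝ D]
  {M : Type*} [TopologicalSpace M] [ChartedSpace A M]
  {N : Type*} [TopologicalSpace N] [ChartedSpace B N]
  {K : Type*} [TopologicalSpace K] [ChartedSpace C K]
  {L : Type*} [TopologicalSpace L] [ChartedSpace D L]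

variable (A B) in
/-- The derivative of a map of manifolds, as a map between the model spaces. Forgetting the base
points of the tangent spaces (which are all copies of the model space) allows derivatives at points
which are only propositionally equal to be compared. -/
noncomputable def der (f : M → N) (x : M) : A →L[ℝ] B := (mfderiv 𝓘(ℝ, A) 𝓘(ℝ, B) f x :)

theorem der_comp {f : M → N} {g : N → K} {x : M} (y : N) (hy : f x = y)
    (hg : MDifferentiableAt 𝓘(ℝ, B) 𝓘(ℝ, C) g y) (hf : MDifferentiableAt 𝓘(ℝ, A) 𝓘(ℝ, B) f x) :
    der A C (fun t => g (f t)) x = (der B C g y).comp (der A B f x) := by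
  subst hy
  exact mfderiv_comp x hg hf

theorem der_comp₂ {h : N × K → L} {f : M → N} {g : M → K} {x : M} (y : N) (hy : f x = y)
    (z : K) (hz : g x = z)
    (hh : MDifferentiableAt (𝓘(ℝ, B).prod 𝓘(ℝ, C)) 𝓘(ℝ, D) h (y, z))
    (hf : MDifferentiableAt 𝓘(ℝ, A) 𝓘(ℝ, B) f x) (hg : MDifferentiableAt 𝓘(ℝ, A) 𝓘(ℝ, C) g x)
    (v : A) :
    der A D (fun t => h (f t, g t)) x v =
      der B D (fun a => h (a, z)) y (der A B f x v)
        + der C D (fun b => h (y, b)) z (der A C g x v) := by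
  subst hy hz
  have h1 := mfderiv_comp x hh (hf.prodMk hg)
  have h2 := mfderiv_prod_eq_add_apply (v := mfderiv 𝓘(ℝ, A) (𝓘(ℝ, B).prod 𝓘(ℝ, C))
    (fun t => (f t, g t)) x v) hh
  have h3 := hf.mfderiv_prod hg
  refine (DFunLike.congr_fun h1 v).trans (h2.trans ?_)
  rw [h3]
  rfl

theorem der_eq_fderiv_self {f : M → B} {x₀ : M}
    (hf : MDifferentiableAt 𝓘(ℝ, A) 𝓘(ℝ, B) f x₀) :
    der A B f x₀ =
      fderiv ℝ (f ∘ (extChartAt 𝓘(ℝ, A) x₀).symm) (extChartAt 𝓘(ℝ, A) x₀ x₀) := by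
  have h := hf.mfderiv
  rw [ModelWithCorners.range_eq_univ, fderivWithin_univ] at h
  exact h

end ChainRules

section LieGroup

variable {F : Type*} [NormedAddCommGroup F] [NormedSpace ℝ F]
  {G : Type*} [TopologicalSpace G] [ChartedSpace F G] [Group G]

/-- The left translation of elements of the Lie algebra, with values in the model space. -/
noncomputable def lT (g : G) : F →L[ℝ] F := der F F (fun h : G => g * h) 1

/-- The right translation of elements of the Lie algebra, with values in the model space. -/
noncomputable def rT (g : G) : F →L[ℝ] F := der F F (fun h : G => h * g) 1

variable [LieGroup 𝓘(ℝ, F) ∞ G]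

theorem mdifferentiable_mul : MDifferentiable (𝓘(ℝ, F).prod 𝓘(ℝ, F)) 𝓘(ℝ, F)
    (fun p : G × G => p.1 * p.2) :=
  (contMDiff_mul 𝓘(ℝ, F) ∞).mdifferentiable (by simp)

theorem mdifferentiable_mul_left (g : G) :
    MDifferentiable 𝓘(ℝ, F) 𝓘(ℝ, F) (fun h : G => g * h) :=
  (contMDiff_mul_left (I := 𝓘(ℝ, F)) (n := ∞)).mdifferentiable (by simp)

theorem mdifferentiable_mul_right (g : G) :
    MDifferentiable 𝓘(ℝ, F) 𝓘(ℝ, F) (fun h : G => h * g) :=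
  (contMDiff_mul_right (I := 𝓘(ℝ, F)) (n := ∞)).mdifferentiable (by simp)

theorem mdifferentiable_conj (g : G) :
    MDifferentiable 𝓘(ℝ, F) 𝓘(ℝ, F) (fun h : G => g * h * g⁻¹) :=
  (mdifferentiable_mul_right g⁻¹).comp (mdifferentiable_mul_left g)

theorem mdifferentiable_inv : MDifferentiable 𝓘(ℝ, F) 𝓘(ℝ, F) (fun h : G => h⁻¹) :=
  (contMDiff_inv 𝓘(ℝ, F) ∞).mdifferentiable (by simp)

variable {A : Type*} [NormedAddCommGroup A] [NormedSpace ℝ A]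
  {M : Type*} [TopologicalSpace M] [ChartedSpace A M]

/-- The product of two maps into a Lie group, whose derivatives are given by left and right
translations of elements of the Lie algebra with matching inner ends. -/
theorem der_mul_of_anchor {f k : M → G} {x : M} {v : A} {a b c : F}
    (hf : MDifferentiableAt 𝓘(ℝ, A) 𝓘(ℝ, F) f x) (hk : MDifferentiableAt 𝓘(ℝ, A) 𝓘(ℝ, F) k x)
    (hfv : der A F f x v = -rT (f x) a + lT (f x) b)
    (hkv : der A F k x v = -rT (k x) b + lT (k x) c) :
    der A F (fun t => f t * k t) x v = -rT (f x * k x) a + lT (f x * k x) c := by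
  have h := der_comp₂ (h := fun p : G × G => p.1 * p.2) (f x) rfl (k x) rfl
    (mdifferentiable_mul _) hf hk v
  refine h.trans ?_
  rw [hfv, hkv]
  have e1 := der_comp (f := fun h : G => h * f x) (g := fun h : G => h * k x) (x := 1) (f x)
    (one_mul _) (mdifferentiable_mul_right (F := F) _ _) (mdifferentiable_mul_right (F := F) _ _)
  have e2 := der_comp (f := fun h : G => k x * h) (g := fun h : G => f x * h) (x := 1) (k x)
    (mul_one _) (mdifferentiable_mul_left (F := F) _ _) (mdifferentiable_mul_left (F := F) _ _)
  have e3 := der_comp (f := fun h : G => f x * h) (g := fun h : G => h * k x) (x := 1) (f x)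
    (mul_one _) (mdifferentiable_mul_right (F := F) _ _) (mdifferentiable_mul_left (F := F) _ _)
  have e4 := der_comp (f := fun h : G => h * k x) (g := fun h : G => f x * h) (x := 1) (k x)
    (one_mul _) (mdifferentiable_mul_left (F := F) _ _) (mdifferentiable_mul_right (F := F) _ _)
  simp only [mul_assoc] at e1 e3
  simp only [← mul_assoc] at e2
  have e1' := DFunLike.congr_fun e1 a
  have e2' := DFunLike.congr_fun e2 c
  have e3' := DFunLike.congr_fun (e3.symm.trans e4) b
  simp only [ContinuousLinearMap.comp_apply] at e1' e2' e3'
  simp only [map_add, map_neg, rT, lT, e1', e2', e3']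
  abel

theorem der_inv_one (x : F) : der F F (fun h : G => h⁻¹) 1 x = -x := by
  have h := der_comp₂ (h := fun p : G × G => p.1 * p.2) (f := fun g : G => g)
    (g := fun g : G => g⁻¹) (x := 1) (1 : G) rfl (1 : G) inv_one (mdifferentiable_mul _)
    mdifferentiableAt_id (mdifferentiable_inv 1) x
  have h0 : der F F (fun t : G => t * t⁻¹) 1 = 0 := by
    simp only [mul_inv_cancel]
    exact mfderiv_const
  have h1 : der F F (fun t : G => t) 1 = ContinuousLinearMap.id ℝ F := mfderiv_id
  simp only [mul_one, one_mul, h0, h1] at h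
  exact (neg_eq_of_add_eq_zero_right h.symm).symm

/-- Inversion exchanges the ends of an edge. -/
theorem der_inv_of_anchor {f : M → G} {x : M} {v : A} {a b : F}
    (hf : MDifferentiableAt 𝓘(ℝ, A) 𝓘(ℝ, F) f x)
    (hfv : der A F f x v = -rT (f x) a + lT (f x) b) :
    der A F (fun t => (f t)⁻¹) x v = -rT (f x)⁻¹ b + lT (f x)⁻¹ a := by
  rw [der_comp (f x) rfl (mdifferentiable_inv _) hf, ContinuousLinearMap.comp_apply, hfv]
  have e1 := der_comp (f := fun h : G => h * f x) (g := fun h : G => h⁻¹) (x := 1) (f x)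
    (one_mul _) (mdifferentiable_inv (F := F) _) (mdifferentiable_mul_right (F := F) _ _)
  have e2 := der_comp (f := fun h : G => h⁻¹) (g := fun h : G => (f x)⁻¹ * h) (x := 1) 1
    inv_one (mdifferentiable_mul_left (F := F) _ _) (mdifferentiable_inv (F := F) _)
  have e3 := der_comp (f := fun h : G => f x * h) (g := fun h : G => h⁻¹) (x := 1) (f x)
    (mul_one _) (mdifferentiable_inv (F := F) _) (mdifferentiable_mul_left (F := F) _ _)
  have e4 := der_comp (f := fun h : G => h⁻¹) (g := fun h : G => h * (f x)⁻¹) (x := 1) 1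
    inv_one (mdifferentiable_mul_right (F := F) _ _) (mdifferentiable_inv (F := F) _)
  simp only [mul_inv_rev] at e1 e3
  have e1' := DFunLike.congr_fun (e1.symm.trans e2) a
  have e2' := DFunLike.congr_fun (e3.symm.trans e4) b
  simp only [ContinuousLinearMap.comp_apply, der_inv_one, map_neg] at e1' e2'
  simp only [map_add, map_neg, rT, lT, e1', e2']
  abel

end LieGroup

/-! ### The derivative of the adjoint action -/

section Adjoint

variable {F : Type*} [NormedAddCommGroup F] [NormedSpace ℝ F]
  (G : Type*) [TopologicalSpace G] [ChartedSpace F G] [Group G]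

/-- The multiplication of a Lie group, read in the chart at the identity. -/
noncomputable def chartMul (p : F × F) : F :=
  extChartAt 𝓘(ℝ, F) (1 : G)
    ((extChartAt 𝓘(ℝ, F) (1 : G)).symm p.1 * (extChartAt 𝓘(ℝ, F) (1 : G)).symm p.2)

/-- The conjugation action of a Lie group on itself, read in the chart at the identity. -/
noncomputable def chartConj (p : F × F) : F :=
  extChartAt 𝓘(ℝ, F) (1 : G)
    ((extChartAt 𝓘(ℝ, F) (1 : G)).symm p.1 * (extChartAt 𝓘(ℝ, F) (1 : G)).symm p.2 *
      ((extChartAt 𝓘(ℝ, F) (1 : G)).symm p.1)⁻¹)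

variable [LieGroup 𝓘(ℝ, F) ∞ G]

theorem contDiffAt_chart_comp {f : F × F → G} {p : F × F}
    (hf : ContMDiffAt 𝓘(ℝ, F × F) 𝓘(ℝ, F) ∞ f p)
    (hp : f p ∈ (extChartAt 𝓘(ℝ, F) (1 : G)).source) :
    ContDiffAt ℝ ∞ (fun q => extChartAt 𝓘(ℝ, F) (1 : G) (f q)) p := by
  have : IsManifold 𝓘(ℝ, F) ∞ G := inferInstance
  rw [← contMDiffAt_iff_contDiffAt]
  refine ContMDiffAt.comp (I' := 𝓘(ℝ, F)) p ?_ hf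
  exact contMDiffAt_extChartAt' (by simpa using hp)

theorem contMDiffAt_symm_fst {p : F × F} (h : p.1 ∈ (extChartAt 𝓘(ℝ, F) (1 : G)).target) :
    ContMDiffAt 𝓘(ℝ, F × F) 𝓘(ℝ, F) ∞ (fun q : F × F => (extChartAt 𝓘(ℝ, F) (1 : G)).symm q.1)
      p := by
  have : IsManifold 𝓘(ℝ, F) ∞ G := inferInstance
  refine ContMDiffAt.comp (I' := 𝓘(ℝ, F)) p ?_ contDiff_fst.contMDiff.contMDiffAt
  exact (contMDiffOn_extChartAt_symm (1 : G)).contMDiffAt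
    ((isOpen_extChartAt_target (1 : G)).mem_nhds h)

theorem contMDiffAt_symm_snd {p : F × F} (h : p.2 ∈ (extChartAt 𝓘(ℝ, F) (1 : G)).target) :
    ContMDiffAt 𝓘(ℝ, F × F) 𝓘(ℝ, F) ∞ (fun q : F × F => (extChartAt 𝓘(ℝ, F) (1 : G)).symm q.2)
      p := by
  have : IsManifold 𝓘(ℝ, F) ∞ G := inferInstance
  refine ContMDiffAt.comp (I' := 𝓘(ℝ, F)) p ?_ contDiff_snd.contMDiff.contMDiffAt
  exact (contMDiffOn_extChartAt_symm (1 : G)).contMDiffAt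
    ((isOpen_extChartAt_target (1 : G)).mem_nhds h)

theorem contDiffAt_chartMul {p : F × F} (h1 : p.1 ∈ (extChartAt 𝓘(ℝ, F) (1 : G)).target)
    (h2 : p.2 ∈ (extChartAt 𝓘(ℝ, F) (1 : G)).target)
    (h : (extChartAt 𝓘(ℝ, F) (1 : G)).symm p.1 * (extChartAt 𝓘(ℝ, F) (1 : G)).symm p.2 ∈
      (extChartAt 𝓘(ℝ, F) (1 : G)).source) :
    ContDiffAt ℝ ∞ (chartMul (F := F) G) p :=
  contDiffAt_chart_comp G ((contMDiffAt_symm_fst G h1).mul (contMDiffAt_symm_snd G h2)) h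

theorem contDiffAt_chartConj {p : F × F} (h1 : p.1 ∈ (extChartAt 𝓘(ℝ, F) (1 : G)).target)
    (h2 : p.2 ∈ (extChartAt 𝓘(ℝ, F) (1 : G)).target)
    (h : (extChartAt 𝓘(ℝ, F) (1 : G)).symm p.1 * (extChartAt 𝓘(ℝ, F) (1 : G)).symm p.2 *
      ((extChartAt 𝓘(ℝ, F) (1 : G)).symm p.1)⁻¹ ∈ (extChartAt 𝓘(ℝ, F) (1 : G)).source) :
    ContDiffAt ℝ ∞ (chartConj (F := F) G) p :=
  contDiffAt_chart_comp G (((contMDiffAt_symm_fst G h1).mul (contMDiffAt_symm_snd G h2)).mul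
    (contMDiffAt_symm_fst G h1).inv) h

variable {G}

theorem der_extChartAt_one :
    der F F (extChartAt 𝓘(ℝ, F) (1 : G)) 1 = ContinuousLinearMap.id ℝ F := by
  have : IsManifold 𝓘(ℝ, F) ∞ G := inferInstance
  have := isManifold_one (A := F) (M := G)
  exact mfderiv_extChartAt_self

theorem mdifferentiableAt_extChartAt_one {g : G} (hg : g ∈ (extChartAt 𝓘(ℝ, F) (1 : G)).source) :
    MDifferentiableAt 𝓘(ℝ, F) 𝓘(ℝ, F) (extChartAt 𝓘(ℝ, F) (1 : G)) g := by
  have : IsManifold 𝓘(ℝ, F) ∞ G := inferInstance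
  have := isManifold_one (A := F) (M := G)
  exact mdifferentiableAt_extChartAt (by simpa using hg)

variable {u : F}

/-- Left invariant vector fields in the chart at the identity. -/
theorem der_mul_left_chart (hu : u ∈ (extChartAt 𝓘(ℝ, F) (1 : G)).target) (y : F) :
    der F F (fun h : G => extChartAt 𝓘(ℝ, F) (1 : G) ((extChartAt 𝓘(ℝ, F) (1 : G)).symm u * h))
        1 y =
      fderiv ℝ (chartMul (F := F) G) (u, extChartAt 𝓘(ℝ, F) (1 : G) 1) (0, y) := by
  set φ := extChartAt 𝓘(ℝ, F) (1 : G) with hφ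
  have hs : φ.symm u ∈ φ.source := φ.map_target hu
  have hm : MDifferentiableAt 𝓘(ℝ, F) 𝓘(ℝ, F) (fun h : G => φ (φ.symm u * h)) 1 :=
    MDifferentiableAt.comp (I' := 𝓘(ℝ, F)) (1 : G) (g := φ)
      (mdifferentiableAt_extChartAt_one (by rwa [mul_one])) (mdifferentiable_mul_left _ _)
  rw [der_eq_fderiv_self hm]
  have hd : DifferentiableAt ℝ (chartMul (F := F) G) (u, φ 1) :=
    (contDiffAt_chartMul G hu (mem_extChartAt_target (1 : G))
      (by simpa [hφ] using hs)).differentiableAt (by simp)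
  have h := fderiv_comp (φ 1) hd (f := fun w => (u, w)) (by fun_prop)
  have h2 : fderiv ℝ (fun w : F => (u, w)) (φ 1) = ContinuousLinearMap.inr ℝ F F :=
    (hasFDerivAt_prodMk_right u (φ 1)).fderiv
  rw [h2] at h
  exact DFunLike.congr_fun h y

/-- Right invariant vector fields in the chart at the identity. -/
theorem der_mul_right_chart (hu : u ∈ (extChartAt 𝓘(ℝ, F) (1 : G)).target) (y : F) :
    der F F (fun h : G => extChartAt 𝓘(ℝ, F) (1 : G) (h * (extChartAt 𝓘(ℝ, F) (1 : G)).symm u))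
        1 y =
      fderiv ℝ (chartMul (F := F) G) (extChartAt 𝓘(ℝ, F) (1 : G) 1, u) (y, 0) := by
  set φ := extChartAt 𝓘(ℝ, F) (1 : G) with hφ
  have hs : φ.symm u ∈ φ.source := φ.map_target hu
  have hm : MDifferentiableAt 𝓘(ℝ, F) 𝓘(ℝ, F) (fun h : G => φ (h * φ.symm u)) 1 :=
    MDifferentiableAt.comp (I' := 𝓘(ℝ, F)) (1 : G) (g := φ)
      (mdifferentiableAt_extChartAt_one (by rwa [one_mul])) (mdifferentiable_mul_right _ _)
  rw [der_eq_fderiv_self hm]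
  have hd : DifferentiableAt ℝ (chartMul (F := F) G) (φ 1, u) :=
    (contDiffAt_chartMul G (mem_extChartAt_target (1 : G)) hu
      (by simpa [hφ] using hs)).differentiableAt (by simp)
  have h := fderiv_comp (φ 1) hd (f := fun w => (w, u)) (by fun_prop)
  have h2 : fderiv ℝ (fun w : F => (w, u)) (φ 1) = ContinuousLinearMap.inl ℝ F F :=
    (hasFDerivAt_prodMk_left (φ 1) u).fderiv
  rw [h2] at h
  exact DFunLike.congr_fun h y

/-- The adjoint action in the chart at the identity. -/
theorem Ad_chart (hu : u ∈ (extChartAt 𝓘(ℝ, F) (1 : G)).target) (y : F) :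
    Ad ((extChartAt 𝓘(ℝ, F) (1 : G)).symm u) y =
      fderiv ℝ (chartConj (F := F) G) (u, extChartAt 𝓘(ℝ, F) (1 : G) 1) (0, y) := by
  set φ := extChartAt 𝓘(ℝ, F) (1 : G) with hφ
  have h1s : (1 : G) ∈ φ.source := mem_extChartAt_source (1 : G)
  have e : φ.symm u * 1 * (φ.symm u)⁻¹ = 1 := by simp
  have hφ1 : MDifferentiableAt 𝓘(ℝ, F) 𝓘(ℝ, F) φ 1 := mdifferentiableAt_extChartAt_one h1s
  have hm : MDifferentiableAt 𝓘(ℝ, F) 𝓘(ℝ, F) (fun h : G => φ (φ.symm u * h * (φ.symm u)⁻¹)) 1 :=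
    MDifferentiableAt.comp (I' := 𝓘(ℝ, F)) (1 : G) (g := φ) (by rw [e]; exact hφ1)
      (mdifferentiable_conj _ _)
  have h0 := der_comp (f := fun h : G => φ.symm u * h * (φ.symm u)⁻¹) (g := φ) (x := 1) 1 e
    hφ1 (mdifferentiable_conj _ _)
  rw [der_extChartAt_one, ContinuousLinearMap.id_comp] at h0
  refine (DFunLike.congr_fun h0 y).symm.trans ?_
  rw [der_eq_fderiv_self hm]
  have hd : DifferentiableAt ℝ (chartConj (F := F) G) (u, φ 1) :=
    (contDiffAt_chartConj G hu (mem_extChartAt_target (1 : G))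
      (by simp [hφ])).differentiableAt (by simp)
  have h := fderiv_comp (φ 1) hd (f := fun w => (u, w)) (by fun_prop)
  have h2 : fderiv ℝ (fun w : F => (u, w)) (φ 1) = ContinuousLinearMap.inr ℝ F F :=
    (hasFDerivAt_prodMk_right u (φ 1)).fderiv
  rw [h2] at h
  exact DFunLike.congr_fun h y

/-- `x^L(g) = (Ad_g x)^R(g)`, in the chart at the identity. -/
theorem fderiv_chartMul_Ad (hu : u ∈ (extChartAt 𝓘(ℝ, F) (1 : G)).target) (y : F) :
    fderiv ℝ (chartMul (F := F) G) (u, extChartAt 𝓘(ℝ, F) (1 : G) 1) (0, y) =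
      fderiv ℝ (chartMul (F := F) G) (extChartAt 𝓘(ℝ, F) (1 : G) 1, u)
        (Ad ((extChartAt 𝓘(ℝ, F) (1 : G)).symm u) y, 0) := by
  rw [← der_mul_left_chart hu, ← der_mul_right_chart hu]
  set φ := extChartAt 𝓘(ℝ, F) (1 : G) with hφ
  have hs : φ.symm u ∈ φ.source := φ.map_target hu
  have hm : MDifferentiableAt 𝓘(ℝ, F) 𝓘(ℝ, F) (fun h : G => φ (h * φ.symm u)) 1 :=
    MDifferentiableAt.comp (I' := 𝓘(ℝ, F)) (1 : G) (g := φ)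
      (mdifferentiableAt_extChartAt_one (by rwa [one_mul])) (mdifferentiable_mul_right _ _)
  have h0 := der_comp (f := fun h : G => φ.symm u * h * (φ.symm u)⁻¹)
    (g := fun h : G => φ (h * φ.symm u)) (x := 1) 1 (by simp) hm (mdifferentiable_conj _ _)
  simp only [inv_mul_cancel_right] at h0
  exact DFunLike.congr_fun h0 y

theorem vecInChart_mulInvariant (hu : u ∈ (extChartAt 𝓘(ℝ, F) (1 : G)).target) (y : F) :
    vecInChart (A := F) (M := G) (mulInvariantVectorField (I := 𝓘(ℝ, F)) (G := G) y) 1 u =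
      fderiv ℝ (chartMul (F := F) G) (u, extChartAt 𝓘(ℝ, F) (1 : G) 1) (0, y) := by
  rw [← der_mul_left_chart hu]
  have hs := (extChartAt 𝓘(ℝ, F) (1 : G)).map_target hu
  have h := der_comp (f := fun h : G => (extChartAt 𝓘(ℝ, F) (1 : G)).symm u * h)
    (g := extChartAt 𝓘(ℝ, F) (1 : G)) (x := 1) _ (mul_one _)
    (mdifferentiableAt_extChartAt_one hs) (mdifferentiable_mul_left _ _)
  exact (DFunLike.congr_fun h y).symm

omit [LieGroup 𝓘(ℝ, F) ∞ G] in
theorem Ad_one : (Ad (1 : G) : F →L[ℝ] F) = ContinuousLinearMap.id ℝ F := by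
  have h : (fun h : G => 1 * h * 1⁻¹) = id := by
    funext h
    simp
  have h2 : der F F (id : G → G) 1 = ContinuousLinearMap.id ℝ F := mfderiv_id
  rw [← h] at h2
  exact h2

/-- The derivative of the adjoint action at the identity is the bracket. With `m` the multiplication
read in the chart, the equation `x^L(g) = (Ad_g x)^R(g)` is differentiated at the identity; this
expresses the derivative of `Ad` by the mixed second derivatives of `m`, as does the definition of
the bracket by left invariant vector fields. -/
theorem exists_hasFDerivAt_Ad : ∃ T : F →L[ℝ] F →L[ℝ] F,
    HasFDerivAt (fun u : F => (Ad ((extChartAt 𝓘(ℝ, F) (1 : G)).symm u) : F →L[ℝ] F)) T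
      (extChartAt 𝓘(ℝ, F) (1 : G) 1) ∧ ∀ x y, T x y = lieBr G x y := by
  set φ := extChartAt 𝓘(ℝ, F) (1 : G) with hφ
  have hc : φ 1 ∈ φ.target := mem_extChartAt_target (1 : G)
  have hc1 : φ.symm (φ 1) = 1 := extChartAt_to_inv 1
  have h1s : (1 : G) ∈ φ.source := mem_extChartAt_source (1 : G)
  have hnhds := extChartAt_target_mem_nhds (I := 𝓘(ℝ, F)) (1 : G)
  set D := fderiv ℝ (chartMul (F := F) G) with hD
  have hm := contDiffAt_chartMul G (p := (φ 1, φ 1)) hc hc (by rw [hc1, mul_one]; exact h1s)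
  have hk := contDiffAt_chartConj G (p := (φ 1, φ 1)) hc hc (by
    change φ.symm (φ 1) * φ.symm (φ 1) * (φ.symm (φ 1))⁻¹ ∈ φ.source
    rwa [hc1, one_mul, one_mul, inv_one])
  have hm1 : DifferentiableAt ℝ D (φ 1, φ 1) :=
    (hm.fderiv_right (m := 1) (WithTop.coe_le_coe.2 le_top)).differentiableAt one_ne_zero
  have hk1 : DifferentiableAt ℝ (fderiv ℝ (chartConj (F := F) G)) (φ 1, φ 1) :=
    (hk.fderiv_right (m := 1) (WithTop.coe_le_coe.2 le_top)).differentiableAt one_ne_zero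
  have dl : HasFDerivAt (fun u : F => (u, φ 1)) (ContinuousLinearMap.inl ℝ F F) (φ 1) :=
    hasFDerivAt_prodMk_left (φ 1) (φ 1)
  have dr : HasFDerivAt (fun u : F => (φ 1, u)) (ContinuousLinearMap.inr ℝ F F) (φ 1) :=
    hasFDerivAt_prodMk_right (φ 1) (φ 1)
  have dmL : HasFDerivAt (fun u => D (u, φ 1))
      ((fderiv ℝ D (φ 1, φ 1)).comp (ContinuousLinearMap.inl ℝ F F)) (φ 1) :=
    HasFDerivAt.comp (f := fun u : F => (u, φ 1)) (φ 1) hm1.hasFDerivAt dl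
  have dmR : HasFDerivAt (fun u => D (φ 1, u))
      ((fderiv ℝ D (φ 1, φ 1)).comp (ContinuousLinearMap.inr ℝ F F)) (φ 1) :=
    hm1.hasFDerivAt.comp (φ 1) dr
  have hAd : DifferentiableAt ℝ (fun u : F => (Ad (φ.symm u) : F →L[ℝ] F)) (φ 1) := by
    have h1 : DifferentiableAt ℝ (fun u => (fderiv ℝ (chartConj (F := F) G) (u, φ 1)).comp
        (ContinuousLinearMap.inr ℝ F F)) (φ 1) :=
      (HasFDerivAt.comp (f := fun u : F => (u, φ 1)) (φ 1) hk1.hasFDerivAt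
        dl).differentiableAt.clm_comp (differentiableAt_const _)
    refine h1.congr_of_eventuallyEq ?_
    filter_upwards [hnhds] with u hu
    exact ContinuousLinearMap.ext fun y => Ad_chart hu y
  refine ⟨_, hAd.hasFDerivAt, fun x y => ?_⟩
  set T := fderiv ℝ (fun u : F => (Ad (φ.symm u) : F →L[ℝ] F)) (φ 1) with hT
  -- `D` at the base point, on vectors in the first factor
  have hD0 : ∀ z, D (φ 1, φ 1) (z, 0) = z := by
    intro z
    have h := der_mul_right_chart (G := G) hc z
    rw [← hφ, hc1] at h
    simp only [mul_one] at h
    rw [← h]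
    exact DFunLike.congr_fun der_extChartAt_one z
  -- the derivative of `x^L(g) = (Ad_g x)^R(g)`
  have e1 : HasFDerivAt (fun u => D (u, φ 1) (0, y)) _ (φ 1) :=
    dmL.clm_apply (hasFDerivAt_const ((0, y) : F × F) (φ 1))
  have dA : HasFDerivAt (fun u : F => ContinuousLinearMap.inl ℝ F F (Ad (φ.symm u) y)) _ (φ 1) :=
    (ContinuousLinearMap.inl ℝ F F).hasFDerivAt.comp (φ 1)
      (hAd.hasFDerivAt.clm_apply (hasFDerivAt_const y (φ 1)))
  have e2 := dmR.clm_apply dA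
  have ee : (fun u => D (u, φ 1) (0, y)) =ᶠ[𝓝 (φ 1)]
      fun u => D (φ 1, u) (ContinuousLinearMap.inl ℝ F F (Ad (φ.symm u) y)) := by
    filter_upwards [hnhds] with u hu
    exact fderiv_chartMul_Ad hu y
  have e3 := DFunLike.congr_fun (e1.unique (e2.congr_of_eventuallyEq ee)) x
  have hAd1 : (Ad (φ.symm (φ 1)) : F →L[ℝ] F) y = y := by
    rw [hc1, Ad_one]
    rfl
  simp only [add_apply, ContinuousLinearMap.comp_apply, ContinuousLinearMap.flip_apply,
    ContinuousLinearMap.inl_apply, ContinuousLinearMap.inr_apply, zero_apply, map_zero, zero_add,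
    hAd1, hD0] at e3
  have sym := hm.isSymmSndFDerivAt minSmoothness_two_le (0, x) (y, 0)
  -- the bracket in the chart
  have hv : ∀ z w w' : F, w' = w → fderiv ℝ (vecInChart (A := F) (M := G)
      (mulInvariantVectorField (I := 𝓘(ℝ, F)) (G := G) z) 1) (φ 1) w' =
      fderiv ℝ D (φ 1, φ 1) (w, 0) (0, z) := by
    rintro z w _ rfl
    have ev : vecInChart (A := F) (M := G)
        (mulInvariantVectorField (I := 𝓘(ℝ, F)) (G := G) z) 1 =ᶠ[𝓝 (φ 1)]
        fun u => D (u, φ 1) (0, z) := by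
      filter_upwards [hnhds] with u hu
      exact vecInChart_mulInvariant hu z
    rw [ev.fderiv_eq, (dmL.clm_apply (hasFDerivAt_const ((0, z) : F × F) (φ 1))).fderiv]
    simp
  have hi : ∀ z : F, (mulInvariantVectorField (I := 𝓘(ℝ, F)) (G := G) z 1 : F) = z := by
    intro z
    have h : (fun h : G => 1 * h) = id := by
      funext h
      simp
    have h2 : der F F (id : G → G) 1 = ContinuousLinearMap.id ℝ F := mfderiv_id
    rw [← h] at h2
    exact DFunLike.congr_fun h2 z
  have hb : lieBr G x y = _ := mlieBracket_eq_vecInChart (A := F) (M := G)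
    (mulInvariantVectorField (I := 𝓘(ℝ, F)) (G := G) x)
    (mulInvariantVectorField (I := 𝓘(ℝ, F)) (G := G) y) 1
  refine Eq.trans ?_ (hb.trans (congrArg₂ (· - ·) (hv y x _ (hi x)) (hv x y _ (hi y)))).symm
  rw [e3]
  exact eq_sub_of_add_eq (congrArg (T x y + ·) sym.symm)

variable [FiniteDimensional ℝ F]

theorem ad_apply (x y : F) : ad G x y = lieBr G x y := rfl

variable {s : F ⊗[ℝ] F}

omit [LieGroup 𝓘(ℝ, F) ∞ G] [FiniteDimensional ℝ F] in
theorem Ad_sharp (hs_inv : ∀ g : G,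
    TensorProduct.map (Ad (F := F) g).toLinearMap (Ad (F := F) g).toLinearMap s = s)
    (g : G) (a : F →L[ℝ] ℝ) : Ad g (sharp s (a.comp (Ad g))) = sharp s a := by
  rw [← sharp_map, hs_inv]

/-- The map `s^♯` intertwines the coadjoint and the adjoint representation of the Lie algebra: the
infinitesimal form of the invariance of `s`. -/
theorem sharp_coad (hs_inv : ∀ g : G,
    TensorProduct.map (Ad (F := F) g).toLinearMap (Ad (F := F) g).toLinearMap s = s)
    (x : F) (a : F →L[ℝ] ℝ) : sharp s (coad G x a) = lieBr G x (sharp s a) := by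
  obtain ⟨T, hT, hTad⟩ := exists_hasFDerivAt_Ad (F := F) (G := G)
  set φ := extChartAt 𝓘(ℝ, F) (1 : G) with hφ
  have hc1 : φ.symm (φ 1) = 1 := extChartAt_to_inv 1
  let S : (F →L[ℝ] ℝ) →L[ℝ] F := LinearMap.toContinuousLinearMap (sharp s)
  have h1 : HasFDerivAt (fun u : F => S (a.comp (Ad (φ.symm u) : F →L[ℝ] F))) _ (φ 1) :=
    S.hasFDerivAt.comp (φ 1)
      ((ContinuousLinearMap.compL ℝ F F ℝ a).hasFDerivAt.comp (φ 1) hT)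
  -- the constant function `u ↦ Ad_u (s^♯(a ∘ Ad_u))` is differentiated
  have h2 := hT.clm_apply h1
  have h3 : (fun u : F => (Ad (φ.symm u) : F →L[ℝ] F) (S (a.comp (Ad (φ.symm u) : F →L[ℝ] F))))
      = fun _ => sharp s a := by
    funext u
    exact Ad_sharp hs_inv _ a
  rw [h3] at h2
  have h4 := DFunLike.congr_fun (h2.unique (hasFDerivAt_const _ _)) x
  have hAd1 : (Ad (φ.symm (φ 1)) : F →L[ℝ] F) = ContinuousLinearMap.id ℝ F := by
    rw [hc1, Ad_one]
  have hTx : T x = ad G x := ContinuousLinearMap.ext fun y => hTad x y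
  simp only [add_apply, ContinuousLinearMap.comp_apply, ContinuousLinearMap.flip_apply,
    hAd1, ContinuousLinearMap.comp_id, ContinuousLinearMap.compL_apply, hTx, zero_apply,
    ContinuousLinearMap.id_apply, ad_apply] at h4
  have h5 : S (a.comp (ad G x)) = -sharp s (coad G x a) := by
    simp [S, coad]
  rw [h5] at h4
  exact (neg_add_eq_zero.1 h4)

end Adjoint

/-! ### Infinitesimal actions and the fused action -/

section Actions

variable {F : Type*} [NormedAddCommGroup F] [NormedSpace ℝ F]
  {A : Type*} [NormedAddCommGroup A] [NormedSpace ℝ A]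
  {M : Type*} [TopologicalSpace M] [ChartedSpace A M]
  {V : Type*} [Fintype V] [DecidableEq V]
  {G : Type*} [TopologicalSpace G] [ChartedSpace F G] [Group G]

/-- The action `Φ` of `G^V` is smooth, in the sense that each factor acts smoothly. -/
abbrev SmoothAction (F A : Type*) [NormedAddCommGroup F] [NormedSpace ℝ F]
    [NormedAddCommGroup A] [NormedSpace ℝ A]
    {M : Type*} [TopologicalSpace M] [ChartedSpace A M]
    {V : Type*} [DecidableEq V]
    {G : Type*} [TopologicalSpace G] [ChartedSpace F G] [Group G]
    (Φ : (V → G) →* Equiv.Perm M) : Prop :=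
  ∀ v, ContMDiff (𝓘(ℝ, F).prod 𝓘(ℝ, A)) 𝓘(ℝ, A) ∞
    fun p : G × M => Φ (Pi.mulSingle v p.1) p.2

variable {Φ : (V → G) →* Equiv.Perm M}

omit [Fintype V] in
theorem infActAt_apply (v : V) (m : M) (x : F) :
    (infActAt F A Φ v m x : A) = -der F A (fun g : G => Φ (Pi.mulSingle v g) m) 1 x := rfl

theorem infAct_apply (m : M) (x : V → F) :
    infAct F A Φ m x = ∑ v, infActAt F A Φ v m (x v) := by
  simp [infAct]

theorem infAct_single (m : M) (v : V) (x : F) :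
    infAct F A Φ m (Pi.single v x) = infActAt F A Φ v m x := by
  rw [infAct_apply, Finset.sum_eq_single v]
  · simp
  · intro w _ hw
    simp [hw]
  · simp

omit [Fintype V] in
theorem SmoothAction.left (hΦ : SmoothAction F A Φ) (v : V) (m : M) :
    ContMDiff 𝓘(ℝ, F) 𝓘(ℝ, A) ∞ fun g : G => Φ (Pi.mulSingle v g) m :=
  (hΦ v).comp (contMDiff_id.prodMk contMDiff_const)

theorem SmoothAction.contMDiff (hΦ : SmoothAction F A Φ) (g : V → G) :
    ContMDiff 𝓘(ℝ, A) 𝓘(ℝ, A) ∞ (Φ g) := by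
  let S : Submonoid (V → G) :=
    { carrier := {g | ContMDiff 𝓘(ℝ, A) 𝓘(ℝ, A) ∞ (Φ g)}
      one_mem' := by
        simp only [Set.mem_ofPred_eq, map_one]
        exact contMDiff_id
      mul_mem' := by
        intro a b ha hb
        simp only [Set.mem_ofPred_eq, map_mul] at *
        exact ha.comp hb }
  have h : g ∈ S := by
    rw [← Finset.noncommProd_mulSingle g]
    refine Submonoid.noncommProd_mem _ _ _ _ fun v _ => ?_
    exact (hΦ v).comp (contMDiff_const.prodMk contMDiff_id)
  exact h

section Fields

variable [LieGroup 𝓘(ℝ, F) ∞ G] [IsManifold 𝓘(ℝ, A) ∞ M]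

omit [Fintype V] in
/-- Generating vector fields are smooth: `v ↦ ρ(x)` is the composite of the derivative of the action
map with the smooth section `m ↦ ((1, m), (x, 0))`. -/
theorem smoothVec_infActAt_const (hΦ : SmoothAction F A Φ) (v : V) (x : F) :
    SmoothVec fun m => infActAt F A Φ v m x := by
  have := isManifold_one (A := A) (M := M)
  have : IsManifold 𝓘(ℝ, F) ∞ G := inferInstance
  have := isManifold_one (A := F) (M := G)
  let fg : M → TangentBundle 𝓘(ℝ, A) M := fun m => Bundle.TotalSpace.mk' A m 0
  have sfg : ContMDiff 𝓘(ℝ, A) 𝓘(ℝ, A).tangent ∞ fg := Bundle.contMDiff_zeroSection _ _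
  let fv : M → TangentBundle 𝓘(ℝ, F) G := fun _ => Bundle.TotalSpace.mk' F 1 (-x)
  have sfv : ContMDiff 𝓘(ℝ, A) 𝓘(ℝ, F).tangent ∞ fv := contMDiff_const
  have S₁ := sfv.prodMk sfg
  have S₂ : ContMDiff (𝓘(ℝ, F).tangent.prod 𝓘(ℝ, A).tangent) (𝓘(ℝ, F).prod 𝓘(ℝ, A)).tangent ∞
    (equivTangentBundleProd 𝓘(ℝ, F) G 𝓘(ℝ, A) M).symm := contMDiff_equivTangentBundleProd_symm
  have S₃ := (hΦ v).contMDiff_tangentMap (m := ∞) le_rfl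
  refine ((S₃.comp S₂).comp S₁).congr fun m => ?_
  have h : Φ (Pi.mulSingle v 1) m = m := by simp
  have h2 := mfderiv_prod_eq_add_apply (p := ((1 : G), m)) (v := ((-x, 0) : F × A))
    ((hΦ v).mdifferentiable (by simp) ((1 : G), m))
  have key : ∀ m', m' = m → ∀ Z Z' : A, Z = Z' →
      (⟨m, Z⟩ : TangentBundle 𝓘(ℝ, A) M) = ⟨m', Z'⟩ := by
    rintro _ rfl _ _ rfl
    rfl
  refine key _ h _ _ ?_
  refine Eq.trans ?_ h2.symm
  have h3 : (mfderiv 𝓘(ℝ, A) 𝓘(ℝ, A) (fun z : M => Φ (Pi.mulSingle v (1 : G)) z) m : A →L[ℝ] A) 0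
      = 0 := map_zero _
  refine Eq.trans ?_ (congrArg₂ (fun a b : A => a + b)
    (map_neg (der F A (fun g : G => Φ (Pi.mulSingle v g) m) 1) x) h3).symm
  exact (add_zero _).symm

omit [Fintype V] in
theorem smoothVec_infActAt [FiniteDimensional ℝ F] (hΦ : SmoothAction F A Φ) (v : V) {z : M → F}
    (hz : ContMDiff 𝓘(ℝ, A) 𝓘(ℝ, F) ∞ z) : SmoothVec fun m => infActAt F A Φ v m (z m) := by
  let ξ := Module.finBasis ℝ F
  have h : SmoothVec fun m => ∑ i, (ξ.coord i).toContinuousLinearMap (z m) •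
      infActAt F A Φ v m (ξ i) :=
    SmoothVec.sum fun i _ => SmoothVec.smul
      ((ξ.coord i).toContinuousLinearMap.contDiff.contMDiff.comp hz)
      (smoothVec_infActAt_const hΦ v (ξ i))
  convert h using 2 with m
  simp only [← map_smul, ← map_sum]
  congr 1
  exact (ξ.sum_repr (z m)).symm

omit [Fintype V] in
theorem contMDiff_form_infActAt [FiniteDimensional ℝ F] (hΦ : SmoothAction F A Φ) (v : V)
    {α : (m : M) → Cot A m} (hα : SmoothForm α) :
    ContMDiff 𝓘(ℝ, A) 𝓘(ℝ, F →L[ℝ] ℝ) ∞ fun m => (α m).comp (infActAt F A Φ v m) :=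
  contMDiff_clm_of_apply fun x => hα _ (smoothVec_infActAt_const hΦ v x)

end Fields

/-- Equivariance of the infinitesimal action. -/
theorem der_infActAt [LieGroup 𝓘(ℝ, F) ∞ G] (hΦ : SmoothAction F A Φ) (g : V → G) (m : M)
    (v : V) (x : F) :
    der A A (Φ g) m (infActAt F A Φ v m x) = infActAt F A Φ v (Φ g m) (Ad (g v) x) := by
  rw [infActAt_apply, infActAt_apply, map_neg]
  have hg : MDifferentiable 𝓘(ℝ, A) 𝓘(ℝ, A) (Φ g) := (hΦ.contMDiff g).mdifferentiable (by simp)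
  have h1 := der_comp (f := fun h : G => Φ (Pi.mulSingle v h) m) (g := Φ g) (x := 1) m
    (by simp) (hg m) ((hΦ.left v m).mdifferentiable (by simp) 1)
  have h2 := der_comp (f := fun h : G => g v * h * (g v)⁻¹)
    (g := fun h : G => Φ (Pi.mulSingle v h) (Φ g m)) (x := 1) 1
    (by simp) ((hΦ.left v (Φ g m)).mdifferentiable (by simp) 1) (mdifferentiable_conj _ _)
  have e : (fun h : G => Φ g (Φ (Pi.mulSingle v h) m)) =
      fun h : G => Φ (Pi.mulSingle v (g v * h * (g v)⁻¹)) (Φ g m) := by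
    funext h
    rw [← Equiv.Perm.mul_apply, ← Equiv.Perm.mul_apply, ← map_mul, ← map_mul]
    congr 2
    funext w
    by_cases hw : w = v
    · subst hw
      simp
    · simp [hw]
  rw [e] at h1
  have h3 := DFunLike.congr_fun (h1.symm.trans h2) x
  exact congrArg _ h3

section Fused

variable {P Q : V} (h : P ≠ Q)

omit [Fintype V] in
theorem collapse_ne {v : V} (hv : v ≠ Q) : collapse h v = ⟨v, hv⟩ := by
  simp [collapse, hv]

omit [Fintype V] in
theorem collapse_right : collapse h Q = ⟨P, h⟩ := by
  simp [collapse]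

omit [Fintype V] [TopologicalSpace M] [TopologicalSpace G] in
theorem fuseAction_apply (g : {v : V // v ≠ Q} → G) (m : M) :
    fuseAction h Φ g m = Φ (fun v => g (collapse h v)) m := rfl

omit [Fintype V] [TopologicalSpace M] [TopologicalSpace G] in
theorem fuseAction_mulSingle_merged (g : G) (m : M) :
    fuseAction h Φ (Pi.mulSingle ⟨P, h⟩ g) m = Φ (Pi.mulSingle P g) (Φ (Pi.mulSingle Q g) m) := by
  rw [fuseAction_apply, ← Equiv.Perm.mul_apply, ← map_mul]
  congr 2
  funext w
  by_cases hw : w = Q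
  · subst hw
    simp [collapse_right, h.symm]
  · by_cases hP : w = P
    · subst hP
      simp [collapse_ne h hw, hw]
    · simp [collapse_ne h hw, hw, hP]

omit [Fintype V] [TopologicalSpace M] [TopologicalSpace G] in
theorem fuseAction_mulSingle_of_ne {v : {v : V // v ≠ Q}} (hv : v.1 ≠ P) (g : G) (m : M) :
    fuseAction h Φ (Pi.mulSingle v g) m = Φ (Pi.mulSingle v.1 g) m := by
  rw [fuseAction_apply]
  congr 2
  funext w
  by_cases hw : w = Q
  · subst hw
    have h1 : (⟨P, h⟩ : {v : V // v ≠ w}) ≠ v := fun e => hv (by rw [← e])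
    simp [collapse_right, h1, v.2.symm]
  · simp [collapse_ne h hw, Pi.mulSingle_apply, Subtype.ext_iff]

omit [Fintype V] in
theorem SmoothAction.fuse (hΦ : SmoothAction F A Φ) : SmoothAction F A (fuseAction h Φ) := by
  intro v
  by_cases hv : v.1 = P
  · obtain ⟨v, hvQ⟩ := v
    subst hv
    simp only [fuseAction_mulSingle_merged]
    exact (hΦ v).comp (contMDiff_fst.prodMk (hΦ Q))
  · simp only [fuseAction_mulSingle_of_ne h hv]
    exact hΦ v.1

omit [Fintype V] in
theorem infActAt_fuse_of_ne {v : {v : V // v ≠ Q}} (hv : v.1 ≠ P) (m : M) :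
    infActAt F A (fuseAction h Φ) v m = infActAt F A Φ v.1 m := by
  have e : (fun g : G => fuseAction h Φ (Pi.mulSingle v g) m) =
      fun g : G => Φ (Pi.mulSingle v.1 g) m :=
    funext fun g => fuseAction_mulSingle_of_ne h hv g m
  exact ContinuousLinearMap.ext fun x => congrArg (fun f : G → M => -(der F A f 1 x)) e

omit [Fintype V] in
theorem infActAt_fuse_merged (hΦ : SmoothAction F A Φ) (m : M) :
    infActAt F A (fuseAction h Φ) ⟨P, h⟩ m = infActAt F A Φ P m + infActAt F A Φ Q m := by
  refine ContinuousLinearMap.ext fun x => ?_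
  rw [add_apply]
  have e := der_comp₂ (h := fun p : G × M => Φ (Pi.mulSingle P p.1) p.2) (f := fun g : G => g)
    (g := fun g : G => Φ (Pi.mulSingle Q g) m) (x := 1) 1 rfl m (by simp)
    ((hΦ P).mdifferentiable (by simp) _) mdifferentiableAt_id
    ((hΦ.left Q m).mdifferentiable (by simp) 1) x
  have h1 : der F F (fun t : G => t) 1 = ContinuousLinearMap.id ℝ F := mfderiv_id
  have h2 : der A A (fun t : M => t) m = ContinuousLinearMap.id ℝ A := mfderiv_id
  simp only [← fuseAction_mulSingle_merged h, Pi.mulSingle_one, map_one, Equiv.Perm.one_apply,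
    h1, h2, ContinuousLinearMap.id_apply] at e
  have e' := congrArg Neg.neg e
  rw [neg_add] at e'
  exact e'

theorem infAct_fuse (hΦ : SmoothAction F A Φ) (m : M) (y : {v : V // v ≠ Q} → F) :
    infAct F A (fuseAction h Φ) m y = infAct F A Φ m (fun v => y (collapse h v)) := by
  have e : ∀ v : {v : V // v ≠ Q}, infActAt F A (fuseAction h Φ) v m (y v) =
      infActAt F A Φ v.1 m (y v) + if v = ⟨P, h⟩ then infActAt F A Φ Q m (y v) else 0 := by
    intro v
    by_cases hv : v.1 = P
    · obtain rfl : v = ⟨P, h⟩ := Subtype.ext hv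
      rw [infActAt_fuse_merged h hΦ, if_pos rfl, add_apply]
    · rw [infActAt_fuse_of_ne h hv, if_neg fun hv' => hv (congrArg Subtype.val hv'), add_zero]
  rw [infAct_apply, infAct_apply, Fintype.sum_eq_add_sum_subtype_ne _ Q]
  simp only [e, Finset.sum_add_distrib, Finset.sum_ite_eq', Finset.mem_univ, if_true]
  rw [add_comm, collapse_right]
  congr 1
  exact Finset.sum_congr rfl fun v _ => by rw [collapse_ne h v.2]

end Fused
end Actions

/-! ### The explicit form of quasi-Hamiltonian structures and of their fusion -/

section Duality

variable {B : Type*} [NormedAddCommGroup B] [NormedSpace ℝ B]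

theorem exists_eval_eq [FiniteDimensional ℝ B] (f : (B →L[ℝ] ℝ) →ₗ[ℝ] ℝ) :
    ∃ x : B, ∀ b : B →L[ℝ] ℝ, b x = f b := by
  let e : Module.Dual ℝ B ≃ₗ[ℝ] (B →L[ℝ] ℝ) := LinearMap.toContinuousLinearMap
  refine ⟨(Module.evalEquiv ℝ B).symm (f.comp e.toLinearMap), fun b => ?_⟩
  have h := Module.apply_evalEquiv_symm_apply ℝ B (e.symm b) (f.comp e.toLinearMap)
  exact h

theorem eq_of_forall_dual {x y : B} (h : ∀ b : B →L[ℝ] ℝ, b x = b y) : x = y :=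
  (SeparatingDual.eq_iff_forall_dual_eq (R := ℝ)).2 h

theorem exists_tan_eq {A : Type*} [NormedAddCommGroup A] [NormedSpace ℝ A] [FiniteDimensional ℝ A]
    {M : Type*} [TopologicalSpace M] [ChartedSpace A M] {m : M} (f : Cot A m →ₗ[ℝ] ℝ) :
    ∃ X : Tan A m, ∀ β : Cot A m, β X = f β :=
  exists_eval_eq (B := A) f

end Duality

section StdForm

variable {F : Type*} [NormedAddCommGroup F] [NormedSpace ℝ F] [FiniteDimensional ℝ F]
  {A : Type*} [NormedAddCommGroup A] [NormedSpace ℝ A]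
  {M : Type*} [TopologicalSpace M] [ChartedSpace A M]
  {V : Type*} [Fintype V] [DecidableEq V]
  {G : Type*} [TopologicalSpace G] [ChartedSpace F G] [Group G]

/-- The explicit form of the quasi-Hamiltonian structure corresponding to `(Φ, π)`:
it consists of the triples `(ξ, X, α)` for which the component of `ξ_v` in `𝔭` is `ρ_v^* α`, and
`X = ρ(x) + π(α, ·)` where `x_v + a_v - ½ s^♯(a_v)` is the decomposition of `ξ_v` along `𝔤` and
the complement. -/
def StdForm (s : F ⊗[ℝ] F) (Φ : (V → G) →* Equiv.Perm M) (π : Bivector A M)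
    (R : (m : M) → Submodule ℝ (Fibre F A V m)) : Prop :=
  ∀ (m : M) (ξ : V → Double F) (X : Tan A m) (α : Cot A m), (ξ, X, α) ∈ R m ↔
    (∀ v, (ξ v).2 = α.comp (infActAt F A Φ v m)) ∧
    ∀ β : Cot A m,
      β X = β (infAct F A Φ m fun v => (ξ v).1 + (1 / 2 : ℝ) • sharp s (ξ v).2) + π m α β

variable {s : F ⊗[ℝ] F} {Φ : (V → G) →* Equiv.Perm M} {π : Bivector A M}
  {R : (m : M) → Submodule ℝ (Fibre F A V m)}

omit [FiniteDimensional ℝ F] in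
theorem form_infAct (m : M) (α : Cot A m) (x : V → F) :
    α (infAct F A Φ m x) = ∑ v, α.comp (infActAt F A Φ v m) (x v) := by
  rw [infAct_apply, map_sum]
  rfl

omit [FiniteDimensional ℝ F] in
theorem skew_swap {m : M} (hπ : ∀ m α, π m α α = 0) (α β : Cot A m) : π m α β = -π m β α := by
  have h := hπ m (α + β)
  simp only [map_add, LinearMap.add_apply, hπ] at h
  linarith

omit [FiniteDimensional ℝ F] [DecidableEq V] in
theorem sum_pairing_unit (ξ : V → Double F) (x : V → F) :
    ∑ v, pairing s (ξ v) (unit x v) = ∑ v, (ξ v).2 (x v) := by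
  simp [pairing, unit]

/-- The `𝔭`-components of an element of `R` are determined by its 1-form: `R` is isotropic and
contains `ρ(x) ∼ x`. -/
theorem form_component {E : Type*} [LieGroup 𝓘(ℝ, F) ∞ G] [IsManifold 𝓘(ℝ, A) ∞ M]
    {Γ : PermGraph V E} {μ : M → E → G} (hR : Corresponds Γ s Φ π μ R)
    {m : M} {ξ : V → Double F} {X : Tan A m} {α : Cot A m} (h : (ξ, X, α) ∈ R m) (v : V) :
    (ξ v).2 = α.comp (infActAt F A Φ v m) := by
  refine ContinuousLinearMap.ext fun x => ?_
  have h1 := (hR.morphism.lagrangian m _).1 h _ (hR.compatible m (Pi.single v x))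
  simp only [fibrePairing, sum_pairing_unit, infAct_single, zero_apply, add_zero] at h1
  rw [Finset.sum_eq_single v (fun w _ hw => by simp [hw]) (by simp), Pi.single_eq_same] at h1
  exact sub_eq_zero.1 h1

/-- Every element of `R` over a covector differs from the one over the complement by an element
of the form `ρ(x) ∼ x`, as `R` meets `TM` trivially. -/
theorem Corresponds.stdForm [FiniteDimensional ℝ A] {E : Type*} [LieGroup 𝓘(ℝ, F) ∞ G]
    [IsManifold 𝓘(ℝ, A) ∞ M]
    {Γ : PermGraph V E} {μ : M → E → G} (hR : Corresponds Γ s Φ π μ R) : StdForm s Φ π R := by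
  intro m ξ X α
  obtain ⟨Y, hY⟩ := exists_tan_eq (π m α)
  obtain ⟨κ, hκ, hκR⟩ := (hR.graph m Y α).2 hY
  have hκ2 := form_component hR hκR
  have hκ1 : ∀ v, (κ v).1 = -(1 / 2 : ℝ) • sharp s (κ v).2 := fun v => by
    obtain ⟨a, ha⟩ := hκ v
    rw [ha]
  have hsub : (∀ v, (ξ v).2 = α.comp (infActAt F A Φ v m)) →
      ξ = κ + unit (fun v => (ξ v).1 + (1 / 2 : ℝ) • sharp s (ξ v).2) := by
    intro h
    funext v
    refine Prod.ext ?_ ?_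
    · simp only [Pi.add_apply, Prod.fst_add, unit, hκ1, hκ2, h]
      module
    · simp only [Pi.add_apply, Prod.snd_add, unit, hκ2, h, add_zero]
  set x : V → F := fun v => (ξ v).1 + (1 / 2 : ℝ) • sharp s (ξ v).2 with hx
  constructor
  · intro h
    have h2 := form_component hR h
    refine ⟨h2, fun β => ?_⟩
    have h3 := (R m).sub_mem ((R m).sub_mem h hκR) (hR.compatible m x)
    have h4 : ((ξ, X, α) - (κ, Y, α) - (unit x, infAct F A Φ m x, 0) : Fibre F A V m) =
        (0, X - Y - infAct F A Φ m x, 0) := by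
      refine Prod.ext ?_ (Prod.ext rfl ?_)
      · change ξ - κ - unit x = 0
        rw [sub_sub, sub_eq_zero]
        exact hsub h2
      · change α - α - 0 = 0
        rw [sub_self, sub_zero]
    rw [h4] at h3
    have h5 := hR.morphism.ker_inf m _ h3
    rw [sub_sub, sub_eq_zero] at h5
    rw [h5, map_add, add_comm, hY β]
  · rintro ⟨h2, h3⟩
    have h4 := (R m).add_mem hκR (hR.compatible m x)
    have h5 : ((κ, Y, α) + (unit x, infAct F A Φ m x, 0) : Fibre F A V m) = (ξ, X, α) := by
      refine Prod.ext (hsub h2).symm (Prod.ext ?_ ?_)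
      · refine eq_of_forall_dual (B := A) fun β => ?_
        refine Eq.trans ?_ (h3 β).symm
        rw [← hY β, add_comm]
        exact map_add β _ _
      · exact add_zero α
    rwa [h5] at h4

omit [FiniteDimensional ℝ F] in
theorem StdForm.unit_mem (hR : StdForm s Φ π R) (m : M) (x : V → F) :
    (unit x, infAct F A Φ m x, 0) ∈ R m := by
  refine (hR m _ _ _).2 ⟨fun v => by simp [unit], fun β => ?_⟩
  simp [unit]

omit [FiniteDimensional ℝ F] in
theorem StdForm.complement_mem (hR : StdForm s Φ π R) {m : M} {α : Cot A m} {X : Tan A m}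
    (hX : ∀ β : Cot A m, β X = π m α β) :
    ((fun v => (-(1 / 2 : ℝ) • sharp s (α.comp (infActAt F A Φ v m)),
      α.comp (infActAt F A Φ v m))), X, α) ∈ R m := by
  refine (hR m _ _ _).2 ⟨fun v => rfl, fun β => ?_⟩
  rw [hX β]
  have : (fun v => -(1 / 2 : ℝ) • sharp s (α.comp (infActAt F A Φ v m)) +
      (1 / 2 : ℝ) • sharp s (α.comp (infActAt F A Φ v m))) = (0 : V → F) := by
    funext v
    simp only [Pi.zero_apply]
    module
  rw [this, map_zero, map_zero, zero_add]

omit [FiniteDimensional ℝ F] in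
theorem StdForm.lagrangian [FiniteDimensional ℝ A] (hs : TensorProduct.comm ℝ F F s = s)
    (hπ : ∀ m α, π m α α = 0) (hR : StdForm s Φ π R) (m : M) (r : Fibre F A V m) :
    r ∈ R m ↔ ∀ r' ∈ R m, fibrePairing s r r' = 0 := by
  obtain ⟨ξ, X, α⟩ := r
  constructor
  · rintro h ⟨ξ', X', α'⟩ h'
    obtain ⟨h1, h2⟩ := (hR m _ _ _).1 h
    obtain ⟨h1', h2'⟩ := (hR m _ _ _).1 h'
    simp only [fibrePairing, h2, h2', form_infAct, ← h1, ← h1', skew_swap hπ α α']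
    rw [sub_eq_zero, add_add_add_comm, add_neg_cancel, add_zero, ← Finset.sum_add_distrib]
    refine Finset.sum_congr rfl fun v _ => ?_
    simp only [pairing, map_add, map_smul, smul_eq_mul]
    rw [sharp_symm hs (ξ' v).2 (ξ v).2]
    ring
  · intro h
    have hα : ∀ v, (ξ v).2 = α.comp (infActAt F A Φ v m) := by
      intro v
      refine ContinuousLinearMap.ext fun x => ?_
      -- orthogonality to `ρ(x) ∼ x` determines the `𝔭`-components
      have h1 := h _ (hR.unit_mem m (Pi.single v x))
      simp only [fibrePairing, sum_pairing_unit, infAct_single, zero_apply, add_zero] at h1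
      rw [Finset.sum_eq_single v (fun w _ hw => by simp [hw]) (by simp), Pi.single_eq_same] at h1
      exact sub_eq_zero.1 h1
    refine (hR m _ _ _).2 ⟨hα, fun β => ?_⟩
    obtain ⟨Y, hY⟩ := exists_tan_eq (π m β)
    -- orthogonality to the elements over the complement determines the vector
    have h1 := h _ (hR.complement_mem hY)
    have hYα : α Y = π m β α := hY α
    simp only [fibrePairing, hYα] at h1
    rw [form_infAct, skew_swap hπ α β]
    have h2 : ∀ v, pairing s (ξ v) (-(1 / 2 : ℝ) • sharp s (β.comp (infActAt F A Φ v m)),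
        β.comp (infActAt F A Φ v m)) = β.comp (infActAt F A Φ v m)
          ((ξ v).1 + (1 / 2 : ℝ) • sharp s (ξ v).2) := by
      intro v
      simp only [pairing, map_add, map_smul, smul_eq_mul]
      rw [sharp_symm hs (β.comp (infActAt F A Φ v m)) (ξ v).2]
      ring
    simp only [h2] at h1
    linarith

omit [FiniteDimensional ℝ F] in
theorem StdForm.image_le (hR : StdForm s Φ π R) (m : M) (ξ : V → Double F) (X : Tan A m)
    (h : (ξ, X, 0) ∈ R m) : ∃ x : V → F, ξ = unit x := by
  refine ⟨fun v => (ξ v).1, funext fun v => Prod.ext rfl ?_⟩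
  rw [((hR m _ _ _).1 h).1 v]
  simp [unit]

omit [FiniteDimensional ℝ F] in
theorem StdForm.ker_inf (hR : StdForm s Φ π R) (m : M) (X : Tan A m)
    (h : (0, X, 0) ∈ R m) : X = 0 := by
  refine eq_of_forall_dual (B := A) fun β => ?_
  refine (((hR m _ _ _).1 h).2 β).trans ?_
  have : (fun v : V => ((0 : V → Double F) v).1 + (1 / 2 : ℝ) • sharp s ((0 : V → Double F) v).2)
      = 0 := by
    funext v
    simp
  rw [this]
  simp only [map_zero]
  exact add_zero (β 0)

omit [FiniteDimensional ℝ F] in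
theorem StdForm.isGraphOf (hR : StdForm s Φ π R) : IsGraphOf s R π := by
  intro m X α
  constructor
  · rintro ⟨κ, hκ, h⟩ β
    rw [((hR m _ _ _).1 h).2 β]
    have : (fun v => (κ v).1 + (1 / 2 : ℝ) • sharp s (κ v).2) = 0 := by
      funext v
      obtain ⟨a, ha⟩ := hκ v
      rw [ha]
      simp only [Pi.zero_apply]
      module
    rw [this, map_zero, map_zero, zero_add]
  · intro h
    exact ⟨_, fun v => ⟨_, rfl⟩, hR.complement_mem h⟩

omit [FiniteDimensional ℝ F] [Fintype V] [DecidableEq V] in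
theorem IsGraphOf.unique [FiniteDimensional ℝ A] {π' : Bivector A M}
    (h : IsGraphOf s R π) (h' : IsGraphOf s R π') : π' = π := by
  funext m
  refine LinearMap.ext fun α => LinearMap.ext fun β => ?_
  obtain ⟨X, hX⟩ := exists_tan_eq (π m α)
  have hX' := (h' m X α).1 ((h m X α).2 hX)
  rw [← hX' β]
  exact hX β

end StdForm

section FusedForm

variable {F : Type*} [NormedAddCommGroup F] [NormedSpace ℝ F] [FiniteDimensional ℝ F]
  {A : Type*} [NormedAddCommGroup A] [NormedSpace ℝ A]
  {M : Type*} [TopologicalSpace M] [ChartedSpace A M]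
  {V E : Type*} [Fintype V] [DecidableEq V] [DecidableEq E]
  {G : Type*} [TopologicalSpace G] [ChartedSpace F G] [Group G]
  {s : F ⊗[ℝ] F} {Φ : (V → G) →* Equiv.Perm M} {π : Bivector A M}
  {R : (m : M) → Submodule ℝ (Fibre F A V m)} {P Q : V}

omit [FiniteDimensional ℝ F] in
theorem pushBivector_fusionTensor {ι : Type*} [Fintype ι] (ξ : Module.Basis ι ℝ F) (m : M)
    (α β : Cot A m) :
    pushBivector Φ (fusionTensor ξ s P Q) m α β = (1 / 2) *
      (β.comp (infActAt F A Φ Q m) (sharp s (α.comp (infActAt F A Φ P m)))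
      - α.comp (infActAt F A Φ Q m) (sharp s (β.comp (infActAt F A Φ P m)))) := by
  refine (fusionTensor_apply ξ s P Q _ _).trans ?_
  have e : ∀ (γ : Cot A m) (v : V), (γ.comp (infAct F A Φ m)).comp
      (ContinuousLinearMap.single ℝ (fun _ => F) v) = γ.comp (infActAt F A Φ v m) := by
    intro γ v
    refine ContinuousLinearMap.ext fun x => ?_
    exact congrArg γ (infAct_single m v x)
  simp only [e]

omit [FiniteDimensional ℝ F] in
/-- The explicit form of the fused structure. Composability of `ξ_Q` and `ξ_P` moves the component
of `ξ_P` along `𝔤` by `½ s^♯(a_Q)` and that of `ξ_Q` by `-½ s^♯(a_P)`; under `ρ` these shifts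
become the correction `ρ(τ)` of the bivector field. -/
theorem StdForm.fuse {ι : Type*} [Fintype ι] (ξb : Module.Basis ι ℝ F)
    (hs : TensorProduct.comm ℝ F F s = s) (hΦ : SmoothAction F A Φ)
    (hR : StdForm s Φ π R) (Γ : PermGraph V E) (μ : M → E → G) (h : P ≠ Q) :
    StdForm s (fuseAction h Φ) (π + pushBivector Φ (fusionTensor ξb s P Q))
      (fuseMorphism Γ s P Q μ R) := by
  intro m η X α
  have key : ∀ ξ : V → Double F, (∀ v, (ξ v).2 = α.comp (infActAt F A Φ v m)) →
      (ξ Q).1 = (ξ P).1 + sharp s (ξ P).2 →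
      (∀ v, η v = if v.1 = P then comp (ξ Q) (ξ P) else ξ v.1) → ∀ β : Cot A m,
      β (infAct F A (fuseAction h Φ) m fun v => (η v).1 + (1 / 2 : ℝ) • sharp s (η v).2) +
        (π + pushBivector Φ (fusionTensor ξb s P Q) : Bivector A M) m α β =
      β (infAct F A Φ m fun v => (ξ v).1 + (1 / 2 : ℝ) • sharp s (ξ v).2) + π m α β := by
    intro ξ h2 hc hη β
    have e1 : (fun v => (η (collapse h v)).1 + (1 / 2 : ℝ) • sharp s (η (collapse h v)).2) =
        (fun v => (ξ v).1 + (1 / 2 : ℝ) • sharp s (ξ v).2) +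
          (Pi.single P ((1 / 2 : ℝ) • sharp s (ξ Q).2) +
            Pi.single Q (-(1 / 2 : ℝ) • sharp s (ξ P).2)) := by
      funext v
      by_cases hQ : v = Q
      · subst hQ
        rw [collapse_right, hη]
        simp only [if_true, comp, Pi.add_apply, Pi.single_eq_same, hc, map_add,
          Pi.single_eq_of_ne h.symm, smul_add]
        module
      · rw [collapse_ne h hQ, hη]
        by_cases hP : v = P
        · subst hP
          simp only [if_true, comp, Pi.add_apply, Pi.single_eq_same, map_add,
            Pi.single_eq_of_ne h, smul_add]
          module
        · simp [hP, hQ]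
    rw [infAct_fuse h hΦ, e1, map_add, map_add, map_add, map_add, infAct_single, infAct_single,
      Pi.add_apply, LinearMap.add_apply, LinearMap.add_apply, pushBivector_fusionTensor,
      sharp_symm hs (β.comp (infActAt F A Φ P m)), map_smul, map_smul, map_smul, map_smul, ← h2,
      ← h2]
    simp only [ContinuousLinearMap.comp_apply, smul_eq_mul]
    ring
  constructor
  · rintro ⟨ξ, hξ, -, hc, hη⟩
    obtain ⟨h1, h2⟩ := (hR m _ _ _).1 hξ
    refine ⟨fun v => ?_, fun β => (h2 β).trans (key ξ h1 hc hη β).symm⟩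
    have hv := hη v
    dsimp only at hv
    by_cases hP : v.1 = P
    · obtain rfl : v = ⟨P, h⟩ := Subtype.ext hP
      rw [if_pos hP] at hv
      rw [hv, infActAt_fuse_merged h hΦ, ContinuousLinearMap.comp_add, ← h1, ← h1, add_comm]
      rfl
    · rw [if_neg hP] at hv
      rw [hv, infActAt_fuse_of_ne h hP, h1]
  · rintro ⟨h1, h2⟩
    -- the only composable lift with the prescribed `𝔭`-components
    let ξ : V → Double F := fun v => if hv : v = Q then
        ((η ⟨P, h⟩).1 + sharp s (α.comp (infActAt F A Φ P m)), α.comp (infActAt F A Φ Q m))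
      else ((η ⟨v, hv⟩).1, α.comp (infActAt F A Φ v m))
    have hξ2 : ∀ v, (ξ v).2 = α.comp (infActAt F A Φ v m) := by
      intro v
      by_cases hv : v = Q
      · subst hv
        simp [ξ]
      · simp [ξ, hv]
    have hc : (ξ Q).1 = (ξ P).1 + sharp s (ξ P).2 := by
      simp [ξ, h]
    have hη : ∀ v, η v = if v.1 = P then comp (ξ Q) (ξ P) else ξ v.1 := by
      intro v
      by_cases hP : v.1 = P
      · obtain rfl : v = ⟨P, h⟩ := Subtype.ext hP
        rw [if_pos hP]
        refine Prod.ext ?_ ?_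
        · simp [comp, ξ, h]
        · rw [h1, infActAt_fuse_merged h hΦ, ContinuousLinearMap.comp_add, comp, hξ2, hξ2, add_comm]
      · rw [if_neg hP]
        refine Prod.ext ?_ ?_
        · simp [ξ, v.2]
        · rw [h1, infActAt_fuse_of_ne h hP, hξ2]
    exact ⟨ξ, (hR m _ _ _).2 ⟨hξ2, fun β => (h2 β).trans (key ξ hξ2 hc hη β)⟩, rfl, hc, hη⟩

end FusedForm

/-! ### Smoothness and anchor of the fused morphism -/

section FusedMorphism

variable {F : Type*} [NormedAddCommGroup F] [NormedSpace ℝ F] [FiniteDimensional ℝ F]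
  {A : Type*} [NormedAddCommGroup A] [NormedSpace ℝ A]
  {M : Type*} [TopologicalSpace M] [ChartedSpace A M] [IsManifold 𝓘(ℝ, A) ∞ M]
  {V E : Type*} [Fintype V] [DecidableEq V] [DecidableEq E]
  {G : Type*} [TopologicalSpace G] [ChartedSpace F G] [Group G] [LieGroup 𝓘(ℝ, F) ∞ G]
  {s : F ⊗[ℝ] F} {Φ : (V → G) →* Equiv.Perm M} {π : Bivector A M}
  {R : (m : M) → Submodule ℝ (Fibre F A V m)} {P Q : V}

/-- The fused morphism is a smooth subbundle: a smooth section of `R` is made composable by adding a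
section of the form `(z, ρ(z), 0)`, supported at the vertex `Q`. -/
theorem fuse_smooth (hΦ : SmoothAction F A Φ) (hc : CompatibleWithAction Φ R)
    (hR : ∀ m, ∀ r ∈ R m, ∃ e : Sec F A M V, e.Smooth ∧ (∀ x, e.val x ∈ R x) ∧ e.val m = r)
    (Γ : PermGraph V E) (μ : M → E → G) (h : P ≠ Q) (m : M)
    (r : Fibre F A {v : V // v ≠ Q} m) (hr : r ∈ fuseMorphism Γ s P Q μ R m) :
    ∃ e : Sec F A M {v : V // v ≠ Q}, e.Smooth ∧
      (∀ x, e.val x ∈ fuseMorphism Γ s P Q μ R x) ∧ e.val m = r := by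
  obtain ⟨η, X, α⟩ := r
  obtain ⟨ξ, hξ, -, hcomp, hη⟩ := hr
  obtain ⟨e, he, heR, hem⟩ := hR m _ hξ
  have hem1 : e.ξ m = ξ := congrArg (fun r => r.1) hem
  have hem2 : e.X m = X := congrArg (fun r => r.2.1) hem
  have hem3 : e.α m = α := congrArg (fun r => r.2.2) hem
  have hξv : ∀ v, ContMDiff 𝓘(ℝ, A) 𝓘(ℝ, Double F) ∞ fun x => e.ξ x v :=
    contMDiff_pi_space.1 he.ξ
  have h1 : ∀ v, ContMDiff 𝓘(ℝ, A) 𝓘(ℝ, F) ∞ fun x => (e.ξ x v).1 := fun v =>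
    (contDiff_fst (𝕜 := ℝ) (E := F) (F := F →L[ℝ] ℝ)).contMDiff.comp (hξv v)
  have h2 : ∀ v, ContMDiff 𝓘(ℝ, A) 𝓘(ℝ, F →L[ℝ] ℝ) ∞ fun x => (e.ξ x v).2 := fun v =>
    (contDiff_snd (𝕜 := ℝ) (E := F) (F := F →L[ℝ] ℝ)).contMDiff.comp (hξv v)
  let S : (F →L[ℝ] ℝ) →L[ℝ] F := LinearMap.toContinuousLinearMap (sharp s)
  have hS : ∀ v, ContMDiff 𝓘(ℝ, A) 𝓘(ℝ, F) ∞ fun x => sharp s (e.ξ x v).2 := fun v =>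
    S.contDiff.contMDiff.comp (h2 v)
  -- the defect of composability
  let z : M → F := fun x => tgt s (e.ξ x P) - src (e.ξ x Q)
  have hz : ContMDiff 𝓘(ℝ, A) 𝓘(ℝ, F) ∞ z := ((h1 P).add (hS P)).sub (h1 Q)
  have hzm : z m = 0 := by
    simp only [z, hem1]
    exact sub_eq_zero.2 hcomp.symm
  let e' : Sec F A M {v : V // v ≠ Q} :=
    { ξ := fun x v => if v.1 = P then ((e.ξ x P).1, (e.ξ x Q).2 + (e.ξ x P).2) else e.ξ x v.1
      X := fun x => e.X x + infActAt F A Φ Q x (z x)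
      α := e.α }
  refine ⟨e', ⟨?_, ?_, he.α⟩, fun x => ?_, ?_⟩
  · refine contMDiff_pi_space.2 fun v => ?_
    by_cases hv : v.1 = P
    · simp only [e', hv, if_true]
      exact (h1 P).prodMk_space ((h2 Q).add (h2 P))
    · simp only [e', hv, if_false]
      exact hξv v.1
  · exact he.X.add (smoothVec_infActAt hΦ Q hz)
  · refine ⟨e.ξ x + unit (Pi.single Q (z x)), ?_, rfl, ?_, fun v => ?_⟩
    · have h3 := (R x).add_mem (heR x) (hc x (Pi.single Q (z x)))
      rw [infAct_single] at h3
      have h4 : (e.val x + (unit (Pi.single Q (z x)), infActAt F A Φ Q x (z x), 0) :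
          Fibre F A V x) = (e.ξ x + unit (Pi.single Q (z x)), (e'.val x).2) :=
        Prod.ext rfl (Prod.ext rfl (add_zero _))
      rwa [h4] at h3
    · simp [src, tgt, unit, z, h]
    · by_cases hv : v.1 = P
      · simp [e', Sec.val, hv, comp, unit, h]
      · simp [e', Sec.val, hv, unit, v.2]
  · refine Prod.ext ?_ (Prod.ext ?_ hem3)
    · funext v
      have hv := hη v
      dsimp only at hv
      refine Eq.trans ?_ hv.symm
      simp only [e', Sec.val, hem1, comp]
    · change e.X m + infActAt F A Φ Q m (z m) = X
      rw [hzm, map_zero, add_zero, hem2]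

omit [Fintype V] [DecidableEq V] [FiniteDimensional ℝ F] [IsManifold 𝓘(ℝ, A) ∞ M] in
theorem fuseHol_smooth {Γ : PermGraph V E} {μ : M → E → G} (P Q : V)
    (hμ : ∀ e, ContMDiff 𝓘(ℝ, A) 𝓘(ℝ, F) ∞ fun m => μ m e) (e : {e : E // e ≠ Γ.edgeIn Q}) :
    ContMDiff 𝓘(ℝ, A) 𝓘(ℝ, F) ∞ fun m => fuseHol Γ P Q (μ m) e := by
  by_cases he : e.1 = Γ.edgeOut P
  · simp only [fuseHol, he, if_true]
    exact (hμ _).mul (hμ _)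
  · simp only [fuseHol, he, if_false]
    exact hμ _

omit [Fintype V] [FiniteDimensional ℝ F] [IsManifold 𝓘(ℝ, A) ∞ M] in
/-- The anchor of the fused morphism is tangent to the graph of the fused map. On the composed edge
the contributions at the inner end cancel by composability. -/
theorem fuse_anchor {Γ : PermGraph V E} {μ : M → E → G}
    (hμ : ∀ e, ContMDiff 𝓘(ℝ, A) 𝓘(ℝ, F) ∞ fun m => μ m e)
    (hR : ∀ m, ∀ r ∈ R m, ∀ e, mfderiv 𝓘(ℝ, A) 𝓘(ℝ, F) (fun x => μ x e) m r.2.1 =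
      anchorAt Γ s r.1 e (μ m e)) (h : P ≠ Q) (m : M)
    (r : Fibre F A {v : V // v ≠ Q} m) (hr : r ∈ fuseMorphism Γ s P Q μ R m)
    (e : {e : E // e ≠ Γ.edgeIn Q}) :
    mfderiv 𝓘(ℝ, A) 𝓘(ℝ, F) (fun x => fuseHol Γ P Q (μ x) e) m r.2.1 =
      anchorAt (Γ.fuse h) s r.1 e (fuseHol Γ P Q (μ m) e) := by
  obtain ⟨ξ, hξ, -, hcomp, hη⟩ := hr
  dsimp only at hη
  have hd : ∀ e, MDifferentiable 𝓘(ℝ, A) 𝓘(ℝ, F) fun m => μ m e :=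
    fun e => (hμ e).mdifferentiable (by simp)
  -- sources and targets of the labels of the fused graph
  have hsrc : ∀ v : {v : V // v ≠ Q}, src (r.1 v) = src (ξ v.1) := by
    intro v
    rw [hη v]
    by_cases hv : v.1 = P
    · rw [if_pos hv, hv]
      rfl
    · rw [if_neg hv]
  have htgt : ∀ v : V, v ≠ P → tgt s (r.1 (collapse h v)) = tgt s (ξ v) := by
    intro v hv
    rw [hη]
    by_cases hvQ : v = Q
    · rw [hvQ, collapse_right, if_pos rfl]
      simp only [src, tgt] at hcomp
      simp only [comp, tgt, hcomp, map_add]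
      abel
    · rw [collapse_ne h hvQ, if_neg hv]
  have hin : (Γ.fuse h).inn e = ⟨Γ.inn e.1, fun he =>
    e.2 ((Equiv.eq_symm_apply _).2 he)⟩ := rfl
  have hout : (Γ.fuse h).out e = fuseOut Γ h e := rfl
  have hPo : Γ.out (Γ.edgeOut P) = P := by simp [PermGraph.edgeOut]
  have hQi : Γ.inn (Γ.edgeIn Q) = Q := by simp [PermGraph.edgeIn]
  have goal : der A F (fun x => fuseHol Γ P Q (μ x) e) m r.2.1 =
      -rT (fuseHol Γ P Q (μ m) e) (src (r.1 ((Γ.fuse h).inn e))) +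
        lT (fuseHol Γ P Q (μ m) e) (tgt s (r.1 ((Γ.fuse h).out e))) := by
    rw [hin, hsrc, hout]
    by_cases he : e.1 = Γ.edgeOut P
    · simp only [fuseHol, he, if_true, fuseOut]
      rw [htgt _ fun hv => e.2 (by
        rw [he, PermGraph.edgeOut, Equiv.symm_apply_eq, hv])]
      refine der_mul_of_anchor (b := tgt s (ξ P)) (hd _ m) (hd _ m) ?_ ?_
      · have h1 := hR m _ hξ (Γ.edgeOut P)
        rw [anchorAt, hPo] at h1
        exact h1
      · have h1 := hR m _ hξ (Γ.edgeIn Q)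
        rw [anchorAt, hQi, hcomp] at h1
        exact h1
    · simp only [fuseHol, he, if_false, fuseOut]
      rw [htgt _ fun hv => he (by rw [PermGraph.edgeOut, Equiv.eq_symm_apply, hv])]
      exact hR m _ hξ e.1
  exact goal

end FusedMorphism

/-! ### The double as a groupoid in Lie algebras, and involutivity of the fused morphism -/

section DoubleGroupoid

variable {F : Type*} [NormedAddCommGroup F] [NormedSpace ℝ F] [FiniteDimensional ℝ F]
  {G : Type*} [TopologicalSpace G] [ChartedSpace F G] [Group G] [LieGroup 𝓘(ℝ, F) ∞ G]
  {s : F ⊗[ℝ] F}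

theorem lieBr_skew (x y : F) : lieBr G x y = -lieBr G y x := by
  have := lieGroup_three (F := F) G
  exact (lie_skew (L := GroupLieAlgebra 𝓘(ℝ, F) G) x y).symm

theorem lieBr_add_right (x y z : F) : lieBr G x (y + z) = lieBr G x y + lieBr G x z :=
  map_add (ad G x) y z

theorem lieBr_smul_right (c : ℝ) (x y : F) : lieBr G x (c • y) = c • lieBr G x y :=
  map_smul (ad G x) c y

theorem lieBr_add_left (x y z : F) : lieBr G (x + y) z = lieBr G x z + lieBr G y z := by
  rw [lieBr_skew, lieBr_add_right, lieBr_skew z x, lieBr_skew z y]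
  abel

theorem lieBr_smul_left (c : ℝ) (x y : F) : lieBr G (c • x) y = c • lieBr G x y := by
  rw [lieBr_skew, lieBr_smul_right, lieBr_skew y x, smul_neg, neg_neg]

theorem coad_apply (x y : F) (a : F →L[ℝ] ℝ) : coad G x a y = -a (lieBr G x y) := rfl

/-- The target map of the double is a morphism of Lie algebras. -/
theorem tgt_doubleBr (hs_inv : ∀ g : G,
    TensorProduct.map (Ad (F := F) g).toLinearMap (Ad (F := F) g).toLinearMap s = s)
    (u v : Double F) : tgt s (doubleBr G s u v) = lieBr G (tgt s u) (tgt s v) := by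
  simp only [tgt, doubleBr, map_add, map_sub, sharp_coad hs_inv, lieBr_add_right, lieBr_add_left]
  rw [lieBr_skew v.1 (sharp s u.2)]
  abel

/-- The composition of the double is a morphism of Lie algebras. -/
theorem comp_doubleBr (hs : TensorProduct.comm ℝ F F s = s) (hs_inv : ∀ g : G,
    TensorProduct.map (Ad (F := F) g).toLinearMap (Ad (F := F) g).toLinearMap s = s)
    {u w u' w' : Double F} (h : src u = tgt s w) (h' : src u' = tgt s w') :
    doubleBr G s (comp u w) (comp u' w') = comp (doubleBr G s u u') (doubleBr G s w w') := by
  refine Prod.ext rfl (ContinuousLinearMap.ext fun z => ?_)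
  -- invariance of `s` makes the mixed terms cancel
  have e : u'.2 (lieBr G (sharp s w.2) z) + w.2 (lieBr G (sharp s u'.2) z) = 0 := by
    have h1 := sharp_symm hs (coad G z w.2) u'.2
    rw [sharp_coad hs_inv, coad_apply] at h1
    rw [lieBr_skew _ z, lieBr_skew _ z, map_neg, map_neg, h1, neg_neg, add_neg_cancel]
  have e' : u.2 (lieBr G (sharp s w'.2) z) + w'.2 (lieBr G (sharp s u.2) z) = 0 := by
    have h1 := sharp_symm hs (coad G z w'.2) u.2
    rw [sharp_coad hs_inv, coad_apply] at h1
    rw [lieBr_skew _ z, lieBr_skew _ z, map_neg, map_neg, h1, neg_neg, add_neg_cancel]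
  simp only [src, tgt] at h h'
  simp only [doubleBr, comp, add_apply, sub_apply, coad_apply, map_add, lieBr_add_left, h, h']
  linarith

omit [FiniteDimensional ℝ F] in
/-- The graph of the composition of the double is isotropic. -/
theorem pairWith_comp (hs : TensorProduct.comm ℝ F F s = s)
    {u w u' w' : Double F} (h : src u = tgt s w) (h' : src u' = tgt s w') :
    pairWith s (comp u w) (comp u' w') = pairWith s u u' + pairWith s w w' := by
  have e := sharp_symm hs u.2 w'.2
  simp only [src, tgt] at h h'
  simp only [pairWith, comp, add_apply, ContinuousLinearMap.comp_apply, map_add,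
    ContinuousLinearMap.apply_apply, ContinuousLinearMap.coe_fst', ContinuousLinearMap.coe_snd',
    h, h', e]
  ring

end DoubleGroupoid

section Involutive

variable {F : Type*} [NormedAddCommGroup F] [NormedSpace ℝ F] [FiniteDimensional ℝ F]
  {A : Type*} [NormedAddCommGroup A] [NormedSpace ℝ A]
  {M : Type*} [TopologicalSpace M] [ChartedSpace A M]
  {V E : Type*} [Fintype V] [DecidableEq V] [DecidableEq E]
  {G : Type*} [TopologicalSpace G] [ChartedSpace F G] [Group G]
  {s : F ⊗[ℝ] F} {Φ : (V → G) →* Equiv.Perm M} {π : Bivector A M}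
  {R : (m : M) → Submodule ℝ (Fibre F A V m)} {P Q : V}

variable (s Φ) in
/-- The unique lift of a section of the fused morphism to a section of `R`: the `𝔭`-components are
determined by the 1-form, the `𝔤`-component at `P` is that of the composite, and the one at `Q` is
the target of the component at `P`. -/
noncomputable def liftSec (h : P ≠ Q) (e : Sec F A M {v : V // v ≠ Q}) : Sec F A M V where
  ξ x v := if hv : v = Q then
      ((e.ξ x ⟨P, h⟩).1 + sharp s ((e.α x).comp (infActAt F A Φ P x)),
        (e.α x).comp (infActAt F A Φ Q x))
    else ((e.ξ x ⟨v, hv⟩).1, (e.α x).comp (infActAt F A Φ v x))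
  X := e.X
  α := e.α

omit [FiniteDimensional ℝ F] [Fintype V] in
theorem liftSec_X (h : P ≠ Q) (e : Sec F A M {v : V // v ≠ Q}) (x : M) :
    (liftSec s Φ h e).X x = e.X x := rfl

omit [FiniteDimensional ℝ F] in
theorem liftSec_spec (hR : StdForm s Φ π R) {Γ : PermGraph V E} {μ : M → E → G} (h : P ≠ Q)
    {e : Sec F A M {v : V // v ≠ Q}} {x : M} (he : e.val x ∈ fuseMorphism Γ s P Q μ R x) :
    (liftSec s Φ h e).val x ∈ R x ∧
      src ((liftSec s Φ h e).ξ x Q) = tgt s ((liftSec s Φ h e).ξ x P) ∧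
      ∀ v, e.ξ x v = if v.1 = P then
        comp ((liftSec s Φ h e).ξ x Q) ((liftSec s Φ h e).ξ x P)
        else (liftSec s Φ h e).ξ x v.1 := by
  obtain ⟨ξ, hξ, -, hcomp, hη⟩ := he
  have h2 := ((hR x _ _ _).1 hξ).1
  have h1 : ∀ v : {v : V // v ≠ Q}, (e.ξ x v).1 = (ξ v.1).1 := by
    intro v
    refine (congrArg Prod.fst (hη v)).trans ?_
    by_cases hv : v.1 = P
    · rw [if_pos hv, hv]
      rfl
    · rw [if_neg hv]
  have e1 : (liftSec s Φ h e).ξ x = ξ := by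
    funext v
    by_cases hv : v = Q
    · subst hv
      refine Prod.ext ?_ ?_
      · simp only [liftSec, dif_pos, h1]
        refine Eq.trans ?_ hcomp.symm
        simp only [tgt, h2]
      · simp only [liftSec, dif_pos, h2]
    · simp only [liftSec, hv, dif_neg, not_false_eq_true, h1]
      exact Prod.ext rfl (h2 v).symm
  refine ⟨?_, ?_, ?_⟩
  · rw [Sec.val, e1]
    exact hξ
  · rw [e1]
    exact hcomp
  · rw [e1]
    exact hη

variable [LieGroup 𝓘(ℝ, F) ∞ G] [IsManifold 𝓘(ℝ, A) ∞ M]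

theorem liftSec_smooth (hΦ : SmoothAction F A Φ) (h : P ≠ Q) {e : Sec F A M {v : V // v ≠ Q}}
    (he : e.Smooth) : (liftSec s Φ h e).Smooth where
  ξ := by
    have h1 : ∀ v, ContMDiff 𝓘(ℝ, A) 𝓘(ℝ, F) ∞ fun x => (e.ξ x v).1 := fun v =>
      (contDiff_fst (𝕜 := ℝ) (E := F) (F := F →L[ℝ] ℝ)).contMDiff.comp (contMDiff_pi_space.1 he.ξ v)
    have h2 := fun v => contMDiff_form_infActAt hΦ v he.α
    let S : (F →L[ℝ] ℝ) →L[ℝ] F := LinearMap.toContinuousLinearMap (sharp s)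
    refine contMDiff_pi_space.2 fun v => ?_
    by_cases hv : v = Q
    · simp only [liftSec, hv, dif_pos]
      exact ((h1 _).add (S.contDiff.contMDiff.comp (h2 P))).prodMk_space (h2 Q)
    · simp only [liftSec, hv, dif_neg, not_false_eq_true]
      exact (h1 _).prodMk_space (h2 v)
  X := he.X
  α := he.α

omit [IsManifold 𝓘(ℝ, A) ∞ M] in
theorem der_clm_comp {B C : Type*} [NormedAddCommGroup B] [NormedSpace ℝ B]
    [NormedAddCommGroup C] [NormedSpace ℝ C] (l : B →L[ℝ] C) {f : M → B} {x : M}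
    (hf : MDifferentiableAt 𝓘(ℝ, A) 𝓘(ℝ, B) f x) :
    der A C (fun y => l (f y)) x = l.comp (der A B f x) := by
  rw [der_comp (f x) rfl l.mdifferentiableAt hf]
  congr 1
  exact l.mfderiv_eq

/-- The fused morphism is involutive: brackets are computed on the lifts to `R`, and composition in
the double is compatible with the brackets and the metrics. -/
theorem fuse_involutive (hs : TensorProduct.comm ℝ F F s = s) (hs_inv : ∀ g : G,
    TensorProduct.map (Ad (F := F) g).toLinearMap (Ad (F := F) g).toLinearMap s = s)
    (hΦ : SmoothAction F A Φ) (hR : StdForm s Φ π R)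
    (hinv : ∀ e₁ e₂ : Sec F A M V, e₁.Smooth → e₂.Smooth →
      (∀ x, e₁.val x ∈ R x) → (∀ x, e₂.val x ∈ R x) → ∀ x, (Sec.bracket G s e₁ e₂).val x ∈ R x)
    (Γ : PermGraph V E) (μ : M → E → G) (h : P ≠ Q) (e₁ e₂ : Sec F A M {v : V // v ≠ Q})
    (he₁ : e₁.Smooth) (he₂ : e₂.Smooth)
    (h₁ : ∀ x, e₁.val x ∈ fuseMorphism Γ s P Q μ R x)
    (h₂ : ∀ x, e₂.val x ∈ fuseMorphism Γ s P Q μ R x) (x : M) :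
    (Sec.bracket G s e₁ e₂).val x ∈ fuseMorphism Γ s P Q μ R x := by
  have hs₁ := liftSec_smooth (s := s) hΦ h he₁
  have hs₂ := liftSec_smooth (s := s) hΦ h he₂
  have hb := hinv _ _ hs₁ hs₂ (fun x => (liftSec_spec hR h (h₁ x)).1)
    (fun x => (liftSec_spec hR h (h₂ x)).1) x
  -- composition and the defect of composability are linear
  let K : (V → Double F) →L[ℝ] ({v : V // v ≠ Q} → Double F) := LinearMap.toContinuousLinearMap
    { toFun := fun ξ v => if v.1 = P then comp (ξ Q) (ξ P) else ξ v.1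
      map_add' := fun ξ ξ' => by
        funext v
        by_cases hv : v.1 = P
        · simp only [hv, if_true, comp, Pi.add_apply, Prod.fst_add, Prod.snd_add, Prod.mk_add_mk]
          rw [add_add_add_comm]
        · simp [hv]
      map_smul' := fun c ξ => by
        funext v
        by_cases hv : v.1 = P
        · simp [hv, comp]
        · simp [hv] }
  let L : (V → Double F) →L[ℝ] F := LinearMap.toContinuousLinearMap
    { toFun := fun ξ => src (ξ Q) - tgt s (ξ P)
      map_add' := fun ξ ξ' => by
        simp only [src, tgt, Pi.add_apply, Prod.fst_add, Prod.snd_add, map_add]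
        abel
      map_smul' := fun c ξ => by
        simp [src, tgt, smul_sub] }
  have hder : ∀ e : Sec F A M {v : V // v ≠ Q}, e.Smooth →
      (∀ x, e.val x ∈ fuseMorphism Γ s P Q μ R x) → ∀ Y : Tan A x,
      (∀ v, e.dξ x Y v = if v.1 = P then
        comp ((liftSec s Φ h e).dξ x Y Q) ((liftSec s Φ h e).dξ x Y P)
        else (liftSec s Φ h e).dξ x Y v.1) ∧
      src ((liftSec s Φ h e).dξ x Y Q) = tgt s ((liftSec s Φ h e).dξ x Y P) := by
    intro e he heR Y
    have hd : MDifferentiableAt 𝓘(ℝ, A) 𝓘(ℝ, V → Double F) (liftSec s Φ h e).ξ x :=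
      (liftSec_smooth (s := s) hΦ h he).ξ.mdifferentiableAt (by simp)
    constructor
    · intro v
      have hK : e.ξ = fun y => K ((liftSec s Φ h e).ξ y) := by
        funext y v
        exact (liftSec_spec hR h (heR y)).2.2 v
      have h3 := der_clm_comp K hd
      rw [← hK] at h3
      exact congrFun (DFunLike.congr_fun h3 Y) v
    · have hL : (fun y => L ((liftSec s Φ h e).ξ y)) = fun _ => (0 : F) := by
        funext y
        exact sub_eq_zero.2 (liftSec_spec hR h (heR y)).2.1
      have h3 := der_clm_comp L hd
      rw [hL] at h3
      have h4 : der A F (fun _ : M => (0 : F)) x = 0 := mfderiv_const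
      rw [h4] at h3
      exact sub_eq_zero.1 (DFunLike.congr_fun h3 Y).symm
  obtain ⟨hK₂, hL₂⟩ := hder e₂ he₂ h₂ (e₁.X x)
  obtain ⟨hK₁, hL₁⟩ := hder e₁ he₁ h₁ (e₂.X x)
  obtain ⟨-, hc₁, hη₁⟩ := liftSec_spec hR h (h₁ x)
  obtain ⟨-, hc₂, hη₂⟩ := liftSec_spec hR h (h₂ x)
  refine ⟨(Sec.bracket G s (liftSec s Φ h e₁) (liftSec s Φ h e₂)).ξ x, ?_, rfl, ?_, fun v => ?_⟩
  · have hα : (Sec.bracket G s (liftSec s Φ h e₁) (liftSec s Φ h e₂)).α x =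
        (Sec.bracket G s e₁ e₂).α x := by
      refine congrArg₂ (· - ·) rfl ?_
      refine ContinuousLinearMap.ext fun Y => ?_
      obtain ⟨hK, hL⟩ := hder e₁ he₁ h₁ Y
      rw [sum_apply, sum_apply]
      -- the term at the merged vertex splits by compatibility of the composition with the metrics
      have hQ := Fintype.sum_eq_add_sum_subtype_ne (fun v => pairWith s
        ((liftSec s Φ h e₂).ξ x v) ((liftSec s Φ h e₁).dξ x Y v)) Q
      have hP := pairWith_comp hs hc₂ hL
      have h5 : ∀ v : {v : V // v ≠ Q}, pairWith s (e₂.ξ x v) (e₁.dξ x Y v) =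
          pairWith s ((liftSec s Φ h e₂).ξ x v.1) ((liftSec s Φ h e₁).dξ x Y v.1) +
          if v = ⟨P, h⟩ then pairWith s ((liftSec s Φ h e₂).ξ x Q)
            ((liftSec s Φ h e₁).dξ x Y Q) else 0 := by
        intro v
        rw [hη₂, hK]
        by_cases hv : v.1 = P
        · obtain rfl : v = ⟨P, h⟩ := Subtype.ext hv
          simp only [if_true, hP]
          rw [add_comm]
        · have hv' : v ≠ ⟨P, h⟩ := fun e => hv (congrArg Subtype.val e)
          simp only [hv, hv', if_false, add_zero]
      have h6 := Finset.sum_congr rfl fun v (_ : v ∈ Finset.univ) => h5 v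
      rw [Finset.sum_add_distrib, Finset.sum_ite_eq' Finset.univ, if_pos (Finset.mem_univ _)] at h6
      refine hQ.trans (Eq.trans ?_ h6.symm)
      rw [add_comm]
    have h7 : (Sec.bracket G s (liftSec s Φ h e₁) (liftSec s Φ h e₂)).val x =
        ((Sec.bracket G s (liftSec s Φ h e₁) (liftSec s Φ h e₂)).ξ x,
          ((Sec.bracket G s e₁ e₂).val x).2) := Prod.ext rfl (Prod.ext rfl hα)
    rwa [h7] at hb
  · have e := tgt_doubleBr hs_inv ((liftSec s Φ h e₁).ξ x P) ((liftSec s Φ h e₂).ξ x P)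
    simp only [src, tgt] at e hc₁ hc₂ hL₁ hL₂
    simp only [Sec.bracket, liftSec_X, src, tgt, Prod.fst_add, Prod.snd_add, Prod.fst_sub,
      Prod.snd_sub, map_add, map_sub]
    refine (congrArg₂ (· - ·) (congrArg₂ (· + ·) (congrArg₂ (lieBr G) hc₁ hc₂) hL₂) hL₁).trans ?_
    rw [← e]
    abel
  · have e := comp_doubleBr hs hs_inv hc₁ hc₂
    have e1 : (Sec.bracket G s e₁ e₂).ξ x v = doubleBr G s (e₁.ξ x v) (e₂.ξ x v) +
      e₂.dξ x (e₁.X x) v - e₁.dξ x (e₂.X x) v := rfl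
    refine e1.trans ?_
    rw [hη₁, hη₂, hK₁, hK₂]
    by_cases hv : v.1 = P
    · simp only [hv, if_true, e]
      refine Prod.ext rfl ?_
      simp only [comp, Sec.bracket, liftSec_X, Prod.snd_add, Prod.snd_sub]
      abel
    · simp only [hv, if_false]
      rfl

end Involutive

/-! ### The Jacobi identity from involutivity -/

section Jacobi

variable {F : Type*} [NormedAddCommGroup F] [NormedSpace ℝ F] [FiniteDimensional ℝ F]
  {A : Type*} [NormedAddCommGroup A] [NormedSpace ℝ A]
  {M : Type*} [TopologicalSpace M] [ChartedSpace A M]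
  {V : Type*} [Fintype V] [DecidableEq V]
  {G : Type*} [TopologicalSpace G] [ChartedSpace F G] [Group G]
  {s : F ⊗[ℝ] F} {Φ : (V → G) →* Equiv.Perm M} {π : Bivector A M}
  {R : (m : M) → Submodule ℝ (Fibre F A V m)}

/-- The parametrization `a ↦ a - ½ s^♯(a)` of the complement of `𝔤^V`, as a continuous linear
map. -/
noncomputable def complementMap (V : Type*) [Fintype V] (s : F ⊗[ℝ] F) :
    (V → F →L[ℝ] ℝ) →L[ℝ] (V → Double F) :=
  LinearMap.toContinuousLinearMap
    { toFun := fun a v => (-(1 / 2 : ℝ) • sharp s (a v), a v)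
      map_add' := fun a b => by
        funext v
        simp
      map_smul' := fun c a => by
        funext v
        simp [smul_comm c] }

omit [DecidableEq V] in
theorem complementMap_apply (a : V → F →L[ℝ] ℝ) (v : V) :
    complementMap V s a v = (-(1 / 2 : ℝ) • sharp s (a v), a v) := rfl

omit [DecidableEq V] in
/-- The complement is isotropic. -/
theorem pairWith_complementMap (hs : TensorProduct.comm ℝ F F s = s) (a b : V → F →L[ℝ] ℝ) (v : V) :
    pairWith s (complementMap V s a v) (complementMap V s b v) = 0 := by
  simp only [complementMap_apply, pairWith, add_apply, ContinuousLinearMap.comp_apply,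
    ContinuousLinearMap.apply_apply, ContinuousLinearMap.coe_fst', ContinuousLinearMap.coe_snd',
    map_add, map_smul, smul_apply, smul_eq_mul, sharp_symm hs (a v) (b v)]
  ring

/-- The `𝔤`-component of the bracket of two elements of the complement; this is where
the trivector `φ` comes from. -/
theorem doubleBr_complement [LieGroup 𝓘(ℝ, F) ∞ G] (hs_inv : ∀ g : G,
    TensorProduct.map (Ad (F := F) g).toLinearMap (Ad (F := F) g).toLinearMap s = s)
    (a b : F →L[ℝ] ℝ) :
    (doubleBr G s (-(1 / 2 : ℝ) • sharp s a, a) (-(1 / 2 : ℝ) • sharp s b, b)).1 +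
      (1 / 2 : ℝ) • sharp s
        (doubleBr G s (-(1 / 2 : ℝ) • sharp s a, a) (-(1 / 2 : ℝ) • sharp s b, b)).2 =
      (1 / 4 : ℝ) • lieBr G (sharp s a) (sharp s b) := by
  simp only [doubleBr, map_add, map_sub, sharp_coad hs_inv, lieBr_smul_left, lieBr_smul_right]
  rw [lieBr_skew (sharp s b)]
  module

variable (s Φ) in
/-- The section of `R` over a Hamiltonian vector field `X` of the function `f`. -/
noncomputable def hamSec (f : M → ℝ) (X : (m : M) → Tan A m) : Sec F A M V where
  ξ m := complementMap V s fun v => (dif A f m).comp (infActAt F A Φ v m)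
  X := X
  α := dif A f

variable [LieGroup 𝓘(ℝ, F) ∞ G] [IsManifold 𝓘(ℝ, A) ∞ M]

theorem contMDiff_momenta (hΦ : SmoothAction F A Φ) {f : M → ℝ}
    (hf : ContMDiff 𝓘(ℝ, A) 𝓘(ℝ, ℝ) ∞ f) :
    ContMDiff 𝓘(ℝ, A) 𝓘(ℝ, V → F →L[ℝ] ℝ) ∞
      fun m v => (dif A f m).comp (infActAt F A Φ v m) :=
  contMDiff_pi_space.2 fun v => contMDiff_form_infActAt hΦ v (smoothForm_dif hf)

theorem hamSec_smooth (hΦ : SmoothAction F A Φ) {f : M → ℝ}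
    (hf : ContMDiff 𝓘(ℝ, A) 𝓘(ℝ, ℝ) ∞ f) {X : (m : M) → Tan A m} (hX : SmoothVec X) :
    (hamSec s Φ f X).Smooth where
  ξ := (complementMap V s).contDiff.contMDiff.comp (contMDiff_momenta hΦ hf)
  X := hX
  α := smoothForm_dif hf

theorem hamSec_dξ (hΦ : SmoothAction F A Φ) {f : M → ℝ} (hf : ContMDiff 𝓘(ℝ, A) 𝓘(ℝ, ℝ) ∞ f)
    (X : (m : M) → Tan A m) (m : M) (Y : Tan A m) :
    ∃ a, (hamSec s Φ f X).dξ m Y = complementMap V s a := by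
  have h := der_clm_comp (complementMap V s)
    ((contMDiff_momenta hΦ hf).mdifferentiable (by simp) m)
  exact ⟨_, DFunLike.congr_fun h Y⟩

/-- The Jacobi identity up to `φ` is the involutivity of `R`, evaluated on the sections of `R` over
Hamiltonian vector fields. -/
theorem jacobi_of_involutive [FiniteDimensional ℝ A] [T2Space M]
    (hs : TensorProduct.comm ℝ F F s = s) (hs_inv : ∀ g : G,
    TensorProduct.map (Ad (F := F) g).toLinearMap (Ad (F := F) g).toLinearMap s = s)
    (hΦ : SmoothAction F A Φ) (hskew : ∀ m α, π m α α = 0)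
    (hsmooth : ∀ f g : M → ℝ, ContMDiff 𝓘(ℝ, A) 𝓘(ℝ, ℝ) ∞ f → ContMDiff 𝓘(ℝ, A) 𝓘(ℝ, ℝ) ∞ g →
      ContMDiff 𝓘(ℝ, A) 𝓘(ℝ, ℝ) ∞ (poisson π f g)) (hR : StdForm s Φ π R)
    (hinv : ∀ e₁ e₂ : Sec F A M V, e₁.Smooth → e₂.Smooth →
      (∀ x, e₁.val x ∈ R x) → (∀ x, e₂.val x ∈ R x) → ∀ x, (Sec.bracket G s e₁ e₂).val x ∈ R x)
    {f g h : M → ℝ} (hf : ContMDiff 𝓘(ℝ, A) 𝓘(ℝ, ℝ) ∞ f) (hg : ContMDiff 𝓘(ℝ, A) 𝓘(ℝ, ℝ) ∞ g)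
    (hh : ContMDiff 𝓘(ℝ, A) 𝓘(ℝ, ℝ) ∞ h) (m : M) :
    poisson π f (poisson π g h) m + poisson π g (poisson π h f) m + poisson π h (poisson π f g) m
      = (1 / 4) * ∑ v, (dif A h m).comp (infActAt F A Φ v m)
          (lieBr G (sharp s ((dif A f m).comp (infActAt F A Φ v m)))
            (sharp s ((dif A g m).comp (infActAt F A Φ v m)))) := by
  have : CompleteSpace A := FiniteDimensional.complete ℝ A
  -- Hamiltonian vector fields
  have hex : ∀ k : M → ℝ, ∃ X : (m : M) → Tan A m, ∀ (m : M) (β : Cot A m),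
      β (X m) = π m (dif A k m) β := by
    intro k
    choose X hX using fun m => exists_tan_eq (π m (dif A k m))
    exact ⟨X, hX⟩
  obtain ⟨X, hX⟩ := hex f
  obtain ⟨Y, hY⟩ := hex g
  have hXs : SmoothVec X := smoothVec_of_dif fun k hk => by
    have e : (fun m => dif A k m (X m)) = poisson π f k := funext fun m => hX m _
    rw [e]
    exact hsmooth f k hf hk
  have hYs : SmoothVec Y := smoothVec_of_dif fun k hk => by
    have e : (fun m => dif A k m (Y m)) = poisson π g k := funext fun m => hY m _
    rw [e]
    exact hsmooth g k hg hk
  have hb := hinv _ _ (hamSec_smooth (s := s) hΦ hf hXs) (hamSec_smooth (s := s) hΦ hg hYs)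
    (fun x => hR.complement_mem (hX x)) (fun x => hR.complement_mem (hY x)) m
  obtain ⟨-, hb2⟩ := (hR m _ _ _).1 hb
  have h1 := hb2 (dif A h m)
  have hα : (Sec.bracket G s (hamSec s Φ f X) (hamSec s Φ g Y)).α m = dif A (poisson π f g) m := by
    have e : (fun x => (hamSec s Φ g Y).α x ((hamSec s Φ f X).X x)) = poisson π f g :=
      funext fun x => hX x _
    have e1 : iotaD (hamSec s Φ g Y).α m ((hamSec s Φ f X).X m) = 0 := iotaD_dif hg m _
    have e2 : iotaD (hamSec s Φ f X).α m ((hamSec s Φ g Y).X m) = 0 := iotaD_dif hf m _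
    have e3 : ∑ v, (pairWith s ((hamSec s Φ g Y).ξ m v)).comp
        ((ContinuousLinearMap.proj v).comp ((hamSec s Φ f X).dξ m)) = 0 := by
      refine Finset.sum_eq_zero fun v _ => ContinuousLinearMap.ext fun Z => ?_
      obtain ⟨a, ha⟩ := hamSec_dξ (s := s) hΦ hf X m Z
      refine Eq.trans ?_ (pairWith_complementMap hs
        (fun v => (dif A g m).comp (infActAt F A Φ v m)) a v)
      exact congrArg (fun ζ : V → Double F => pairWith s ((hamSec s Φ g Y).ξ m v) (ζ v)) ha
    simp only [Sec.bracket]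
    rw [e, e1, e2, e3, add_zero, sub_zero, sub_zero]
  have hξ : (fun v => ((Sec.bracket G s (hamSec s Φ f X) (hamSec s Φ g Y)).ξ m v).1 +
      (1 / 2 : ℝ) • sharp s ((Sec.bracket G s (hamSec s Φ f X) (hamSec s Φ g Y)).ξ m v).2) =
      fun v => (1 / 4 : ℝ) • lieBr G (sharp s ((dif A f m).comp (infActAt F A Φ v m)))
            (sharp s ((dif A g m).comp (infActAt F A Φ v m))) := by
    funext v
    obtain ⟨a, ha⟩ := hamSec_dξ (s := s) hΦ hf X m (Y m)
    obtain ⟨b, hb⟩ := hamSec_dξ (s := s) hΦ hg Y m (X m)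
    rw [← doubleBr_complement hs_inv]
    have e : (Sec.bracket G s (hamSec s Φ f X) (hamSec s Φ g Y)).ξ m v =
        doubleBr G s ((hamSec s Φ f X).ξ m v) ((hamSec s Φ g Y).ξ m v) +
          (hamSec s Φ g Y).dξ m (X m) v - (hamSec s Φ f X).dξ m (Y m) v := rfl
    rw [e, ha, hb]
    simp only [hamSec, complementMap_apply, Prod.fst_add, Prod.fst_sub, Prod.snd_add, Prod.snd_sub,
      map_add, map_sub]
    module
  have h2 := dif_mlieBracket hh (hXs.mdifferentiableAt m) (hYs.mdifferentiableAt m)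
    ((smoothForm_dif hh X hXs).mdifferentiable (by simp) m)
    ((smoothForm_dif hh Y hYs).mdifferentiable (by simp) m)
  have eX : (fun m => dif A h m (X m)) = poisson π f h := funext fun m => hX m _
  have eY : (fun m => dif A h m (Y m)) = poisson π g h := funext fun m => hY m _
  have h3 : dif A h m ((Sec.bracket G s (hamSec s Φ f X) (hamSec s Φ g Y)).X m) =
      dif A (poisson π g h) m (X m) - dif A (poisson π f h) m (Y m) := by
    rw [← eX, ← eY]
    exact h2
  rw [hX, hY] at h3
  have h4 : dif A (poisson π h f) m = -dif A (poisson π f h) m := by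
    have e : poisson π h f = -poisson π f h := funext fun m => skew_swap hskew _ _
    rw [e]
    exact mfderiv_neg
  have h5 : poisson π g (poisson π h f) m = -poisson π g (poisson π f h) m := by
    simp only [poisson] at h4 ⊢
    rw [h4, map_neg]
  have h6 : poisson π h (poisson π f g) m = -π m (dif A (poisson π f g) m) (dif A h m) :=
    skew_swap hskew _ _
  have h7 := h3.symm.trans h1
  rw [hα, hξ, form_infAct] at h7
  rw [h5, h6, Finset.mul_sum]
  simp only [map_smul, smul_eq_mul] at h7
  simp only [poisson] at h7 ⊢
  linarith

end Jacobi

/-! ### The moment map condition from the anchor -/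

section Moment

variable {F : Type*} [NormedAddCommGroup F] [NormedSpace ℝ F] [FiniteDimensional ℝ F]
  {A : Type*} [NormedAddCommGroup A] [NormedSpace ℝ A]
  {M : Type*} [TopologicalSpace M] [ChartedSpace A M]
  {V : Type*} [Fintype V] [DecidableEq V]
  {G : Type*} [TopologicalSpace G] [ChartedSpace F G] [Group G] [LieGroup 𝓘(ℝ, F) ∞ G]
  {s : F ⊗[ℝ] F} {Φ : (V → G) →* Equiv.Perm M} {π : Bivector A M}
  {R : (m : M) → Submodule ℝ (Fibre F A V m)}

omit [FiniteDimensional ℝ F] in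
/-- The moment map condition is the anchor condition on `R`, evaluated on the elements of `R` over
the complement of `𝔤^V`. -/
theorem moment_of_anchor [FiniteDimensional ℝ A] {E : Type*} {Γ : PermGraph V E} {μ : M → E → G}
    (hs : TensorProduct.comm ℝ F F s = s) (hskew : ∀ m α, π m α α = 0) (hR : StdForm s Φ π R)
    (hμ : ∀ e, ContMDiff 𝓘(ℝ, A) 𝓘(ℝ, F) ∞ fun m => μ m e)
    (hanchor : ∀ m, ∀ r ∈ R m, ∀ e,
      mfderiv 𝓘(ℝ, A) 𝓘(ℝ, F) (fun x => μ x e) m r.2.1 = anchorAt Γ s r.1 e (μ m e))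
    (m : M) (v : V) (θ : Cot F (vertexMap Γ μ m v)) (β : Cot A m) :
    π m (θ.comp (mfderiv 𝓘(ℝ, A) 𝓘(ℝ, F) (fun x => vertexMap Γ μ x v) m)) β
      = (1 / 2) * (β (infActAt F A Φ v m (sharp s (θ.comp (leftInv (vertexMap Γ μ m v)))))
          + β (infActAt F A Φ (Γ.backward v) m
            (sharp s (θ.comp (rightInv (vertexMap Γ μ m v)))))) := by
  obtain ⟨X, hX⟩ := exists_tan_eq (π m β)
  have h1 := hanchor m _ (hR.complement_mem hX) (Γ.edgeIn v)
  have h2 : der A F (fun x => μ x (Γ.edgeIn v)) m X =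
      -rT (μ m (Γ.edgeIn v)) (-(1 / 2 : ℝ) • sharp s (β.comp (infActAt F A Φ v m))) +
      lT (μ m (Γ.edgeIn v)) ((1 / 2 : ℝ) • sharp s (β.comp (infActAt F A Φ (Γ.backward v) m))) := by
    refine h1.trans ?_
    have e1 : Γ.inn (Γ.edgeIn v) = v := Γ.inn.apply_symm_apply v
    have e2 : Γ.out (Γ.edgeIn v) = Γ.backward v := rfl
    have e3 : -(1 / 2 : ℝ) • sharp s (β.comp (infActAt F A Φ (Γ.backward v) m)) +
        sharp s (β.comp (infActAt F A Φ (Γ.backward v) m)) =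
        (1 / 2 : ℝ) • sharp s (β.comp (infActAt F A Φ (Γ.backward v) m)) := by module
    simp only [anchorAt, src, tgt, e1, e2, e3]
    rfl
  have h3 := der_inv_of_anchor ((hμ _).mdifferentiable (by simp) m) h2
  have h4 : mfderiv 𝓘(ℝ, A) 𝓘(ℝ, F) (fun x => vertexMap Γ μ x v) m X =
      -rightInv (vertexMap Γ μ m v)
        ((1 / 2 : ℝ) • sharp s (β.comp (infActAt F A Φ (Γ.backward v) m))) +
      leftInv (vertexMap Γ μ m v) (-(1 / 2 : ℝ) • sharp s (β.comp (infActAt F A Φ v m))) := h3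
  have h5 : θ (mfderiv 𝓘(ℝ, A) 𝓘(ℝ, F) (fun x => vertexMap Γ μ x v) m X) =
      -((1 / 2) * θ (rightInv (vertexMap Γ μ m v)
        (sharp s (β.comp (infActAt F A Φ (Γ.backward v) m))))) -
      (1 / 2) * θ (leftInv (vertexMap Γ μ m v) (sharp s (β.comp (infActAt F A Φ v m)))) := by
    rw [h4, map_smul, map_smul, map_add, map_neg, map_smul, map_smul, smul_eq_mul, smul_eq_mul]
    ring
  have h6 := sharp_symm hs (θ.comp (leftInv (vertexMap Γ μ m v))) (β.comp (infActAt F A Φ v m))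
  have h7 := sharp_symm hs (θ.comp (rightInv (vertexMap Γ μ m v)))
    (β.comp (infActAt F A Φ (Γ.backward v) m))
  simp only [ContinuousLinearMap.comp_apply] at h6 h7
  rw [skew_swap hskew, ← hX, h6, h7]
  refine (congrArg Neg.neg h5).trans ?_
  ring

end Moment

/-! ### The correction term of the bivector field, and equivariance of the fused map -/

section Main

variable {F : Type*} [NormedAddCommGroup F] [NormedSpace ℝ F] [FiniteDimensional ℝ F]
  {A : Type*} [NormedAddCommGroup A] [NormedSpace ℝ A]
  {M : Type*} [TopologicalSpace M] [ChartedSpace A M]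
  {V E : Type*} [Fintype V] [DecidableEq V] [DecidableEq E]
  {G : Type*} [TopologicalSpace G] [ChartedSpace F G] [Group G]
  {s : F ⊗[ℝ] F} {Φ : (V → G) →* Equiv.Perm M} {π : Bivector A M} {P Q : V}

omit [FiniteDimensional ℝ F] in
theorem pushBivector_fusionTensor_self {ι : Type*} [Fintype ι] (ξ : Module.Basis ι ℝ F) (m : M)
    (α : Cot A m) : pushBivector Φ (fusionTensor ξ s P Q) m α α = 0 := by
  rw [pushBivector_fusionTensor, sub_self, mul_zero]

omit [FiniteDimensional ℝ F] in
theorem pushBivector_fusionTensor_swap {ι : Type*} [Fintype ι] (ξ : Module.Basis ι ℝ F)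
    (hs : TensorProduct.comm ℝ F F s = s) :
    (pushBivector Φ (fusionTensor ξ s Q P) : Bivector A M) =
      -pushBivector Φ (fusionTensor ξ s P Q) := by
  funext m
  refine LinearMap.ext fun α => LinearMap.ext fun β => ?_
  rw [Pi.neg_apply, LinearMap.neg_apply, LinearMap.neg_apply, pushBivector_fusionTensor,
    pushBivector_fusionTensor, sharp_symm hs (β.comp (infActAt F A Φ Q m)),
    sharp_symm hs (α.comp (infActAt F A Φ Q m))]
  ring

omit [Fintype V] [TopologicalSpace G] in
theorem fuseHol_equivariant {Γ : PermGraph V E} (h : P ≠ Q) {g : {v : V // v ≠ Q} → G}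
    {k k' : E → G}
    (hk : ∀ e, k' e = g (collapse h (Γ.inn e)) * k e * (g (collapse h (Γ.out e)))⁻¹)
    (e : {e : E // e ≠ Γ.edgeIn Q}) :
    fuseHol Γ P Q k' e =
      g ((Γ.fuse h).inn e) * fuseHol Γ P Q k e * (g ((Γ.fuse h).out e))⁻¹ := by
  have h1 : (Γ.fuse h).inn e = collapse h (Γ.inn e.1) := by
    rw [collapse_ne h fun hQ => e.2 ((Equiv.eq_symm_apply _).2 hQ)]
    rfl
  have h2 : (Γ.fuse h).out e = fuseOut Γ h e := rfl
  rw [h1, h2]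
  by_cases he : e.1 = Γ.edgeOut P
  · have h3 : Γ.out (Γ.edgeOut P) = P := Γ.out.apply_symm_apply P
    have h4 : Γ.inn (Γ.edgeIn Q) = Q := Γ.inn.apply_symm_apply Q
    simp only [fuseHol, fuseOut, he, if_true, hk, h3, h4, collapse_right, collapse_ne h h]
    group
  · simp only [fuseHol, fuseOut, he, if_false, hk]

variable [LieGroup 𝓘(ℝ, F) ∞ G] [IsManifold 𝓘(ℝ, A) ∞ M]

theorem contMDiff_pushBivector_fusionTensor {ι : Type*} [Fintype ι] (ξ : Module.Basis ι ℝ F)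
    (hΦ : SmoothAction F A Φ) {f g : M → ℝ} (hf : ContMDiff 𝓘(ℝ, A) 𝓘(ℝ, ℝ) ∞ f)
    (hg : ContMDiff 𝓘(ℝ, A) 𝓘(ℝ, ℝ) ∞ g) :
    ContMDiff 𝓘(ℝ, A) 𝓘(ℝ, ℝ) ∞
      fun m => pushBivector Φ (fusionTensor ξ s P Q) m (dif A f m) (dif A g m) := by
  let S : (F →L[ℝ] ℝ) →L[ℝ] F := LinearMap.toContinuousLinearMap (sharp s)
  have h1 : ∀ {k : M → ℝ}, ContMDiff 𝓘(ℝ, A) 𝓘(ℝ, ℝ) ∞ k → ∀ v,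
      ContMDiff 𝓘(ℝ, A) 𝓘(ℝ, F →L[ℝ] ℝ) ∞ fun m => (dif A k m).comp (infActAt F A Φ v m) :=
    fun hk v => contMDiff_form_infActAt hΦ v (smoothForm_dif hk)
  have h2 : ∀ {k : M → ℝ}, ContMDiff 𝓘(ℝ, A) 𝓘(ℝ, ℝ) ∞ k → ∀ v,
      ContMDiff 𝓘(ℝ, A) 𝓘(ℝ, F) ∞ fun m => sharp s ((dif A k m).comp (infActAt F A Φ v m)) :=
    fun hk v => S.contDiff.contMDiff.comp (h1 hk v)
  simp only [pushBivector_fusionTensor]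
  exact contMDiff_const.mul (((h1 hg Q).clm_apply (h2 hf P)).sub ((h1 hf Q).clm_apply (h2 hg P)))

omit [FiniteDimensional ℝ F] [IsManifold 𝓘(ℝ, A) ∞ M] in
/-- The bivector field `ρ(τ)` is invariant under the elements of `G^V` with equal components at `P`
and `Q`. -/
theorem pushBivector_fusionTensor_invariant {ι : Type*} [Fintype ι] (ξ : Module.Basis ι ℝ F)
    (hs_inv : ∀ g : G,
      TensorProduct.map (Ad (F := F) g).toLinearMap (Ad (F := F) g).toLinearMap s = s)
    (hΦ : SmoothAction F A Φ) (g : V → G) (hg : g P = g Q) (m : M) (α β : Cot A (Φ g m)) :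
    pushBivector Φ (fusionTensor ξ s P Q) (Φ g m) α β =
      pushBivector Φ (fusionTensor ξ s P Q) m (α.comp (mfderiv 𝓘(ℝ, A) 𝓘(ℝ, A) (Φ g) m))
        (β.comp (mfderiv 𝓘(ℝ, A) 𝓘(ℝ, A) (Φ g) m)) := by
  have h1 : ∀ (γ : Cot A (Φ g m)) (v : V),
      (γ.comp (mfderiv 𝓘(ℝ, A) 𝓘(ℝ, A) (Φ g) m)).comp (infActAt F A Φ v m) =
        (γ.comp (infActAt F A Φ v (Φ g m))).comp (Ad (g v)) := fun γ v =>
    ContinuousLinearMap.ext fun x => congrArg γ (der_infActAt hΦ g m v x)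
  have h2 : ∀ γ δ : F →L[ℝ] ℝ, γ.comp (Ad (g Q)) (sharp s (δ.comp (Ad (g P)))) =
      γ (sharp s δ) := by
    intro γ δ
    rw [hg, ContinuousLinearMap.comp_apply, Ad_sharp hs_inv]
  rw [pushBivector_fusionTensor, pushBivector_fusionTensor, h1, h1, h1, h1, h2, h2]

end Main

end Fusion

open Fusion in
theorem mainTheorem10
    {F : Type*} [NormedAddCommGroup F] [NormedSpace ℝ F] [FiniteDimensional ℝ F]
    {G : Type*} [TopologicalSpace G] [ChartedSpace F G] [Group G] [LieGroup 𝓘(ℝ, F) ∞ G]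
    {A : Type*} [NormedAddCommGroup A] [NormedSpace ℝ A] [FiniteDimensional ℝ A]
    {M : Type*} [TopologicalSpace M] [ChartedSpace A M] [IsManifold 𝓘(ℝ, A) ∞ M] [T2Space M]
    {V E : Type*} [Fintype V] [DecidableEq V] [DecidableEq E]
    (Γ : PermGraph V E)
    (s : F ⊗[ℝ] F) (hs_symm : TensorProduct.comm ℝ F F s = s)
    (hs_inv : ∀ g : G, TensorProduct.map (Ad (F := F) g).toLinearMap (Ad (F := F) g).toLinearMap s = s)
    (Φ : (V → G) →* Equiv.Perm M) (π : Bivector A M) (μ : M → V → G)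
    (hπ : IsQuasiPoisson s Φ π) (hμ : IsTwistedMomentMap Γ s Φ π μ)
    (R : (m : M) → Submodule ℝ (Fibre F A V m))
    (hR : Corresponds Γ s Φ π (edgeMap Γ μ) R)
    {P Q : V} (hPQ : P ≠ Q)
    {ι : Type*} [Fintype ι] (ξ : Module.Basis ι ℝ F) :
    let π' : Bivector A M := π + pushBivector Φ (fusionTensor ξ s P Q)
    let Φ' := fuseAction hPQ Φ
    let μ' : M → {e : E // e ≠ Γ.edgeIn Q} → G := fun m => fuseHol Γ P Q (edgeMap Γ μ m)
    let R' := fuseMorphism Γ s P Q (edgeMap Γ μ) R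
    Corresponds (Γ.fuse hPQ) s Φ' π' μ' R' ∧
    (∀ π'' : Bivector A M, IsGraphOf s R' π'' → π'' = π') ∧
    IsQuasiPoisson s Φ' π' ∧
    IsTwistedMomentMap (Γ.fuse hPQ) s Φ' π' (vertexMap (Γ.fuse hPQ) μ') ∧
    π' - π = -(akmFusion s ξ P Q Φ π - π) ∧
    π' = akmFusion s ξ Q P Φ π := by
  intro π' Φ' μ' R'
  have hΦ : SmoothAction F A Φ := hπ.smooth_action
  have hΦ' : SmoothAction F A Φ' := hΦ.fuse hPQ
  have hst : StdForm s Φ π R := hR.stdForm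
  have hst' : StdForm s Φ' π' R' := hst.fuse ξ hs_symm hΦ Γ (edgeMap Γ μ) hPQ
  have hskew : ∀ m α, π' m α α = 0 := fun m α => by
    simp only [π', Pi.add_apply, LinearMap.add_apply, hπ.skew, pushBivector_fusionTensor_self,
      add_zero]
  have hsmooth : ∀ f g : M → ℝ, ContMDiff 𝓘(ℝ, A) 𝓘(ℝ, ℝ) ∞ f → ContMDiff 𝓘(ℝ, A) 𝓘(ℝ, ℝ) ∞ g →
      ContMDiff 𝓘(ℝ, A) 𝓘(ℝ, ℝ) ∞ (poisson π' f g) := fun f g hf hg =>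
    (hπ.smooth f g hf hg).add (contMDiff_pushBivector_fusionTensor ξ hΦ hf hg)
  have hmap := hR.morphism.smooth_map
  have hmor : IsManinMorphism (Γ.fuse hPQ) s μ' R' :=
    { smooth_map := fuseHol_smooth P Q hmap
      smooth := fuse_smooth hΦ hR.compatible hR.morphism.smooth Γ _ hPQ
      lagrangian := hst'.lagrangian hs_symm hskew
      anchor := fuse_anchor hmap hR.morphism.anchor hPQ
      involutive := fuse_involutive hs_symm hs_inv hΦ hst hR.morphism.involutive Γ _ hPQ
      image_le := hst'.image_le
      ker_inf := hst'.ker_inf }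
  refine ⟨⟨hmor, hst'.unit_mem, hst'.isGraphOf⟩, fun π'' h => hst'.isGraphOf.unique h,
    ?_, ?_, ?_, ?_⟩
  · refine ⟨hΦ', hskew, hsmooth, fun g m α β => ?_, fun f g h hf hg hh m =>
      jacobi_of_involutive hs_symm hs_inv hΦ' hskew hsmooth hst' hmor.involutive hf hg hh m⟩
    have h1 := hπ.invariant (fun v => g (collapse hPQ v)) m α β
    have h2 := pushBivector_fusionTensor_invariant ξ hs_inv hΦ (P := P) (Q := Q)
      (fun v => g (collapse hPQ v))
      (congrArg g ((collapse_ne hPQ hPQ).trans (collapse_right hPQ).symm)) m α β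
    exact congrArg₂ (· + ·) h1 h2
  · refine ⟨fun v => (hmor.smooth_map _).inv, fun g m v => ?_,
      moment_of_anchor hs_symm hskew hst' hmor.smooth_map hmor.anchor⟩
    -- the equivariance of `μ`, in terms of the labels of the edges
    have h1 : ∀ e, edgeMap Γ μ (Φ' g m) e = g (collapse hPQ (Γ.inn e)) * edgeMap Γ μ m e *
        (g (collapse hPQ (Γ.out e)))⁻¹ := by
      intro e
      have h2 := hμ.equivariant (fun v => g (collapse hPQ v)) m (Γ.inn e)
      have h3 : Γ.backward (Γ.inn e) = Γ.out e := congrArg Γ.out (Γ.inn.symm_apply_apply e)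
      rw [h3] at h2
      refine (congrArg (·⁻¹) h2).trans ?_
      rw [mul_inv_rev, mul_inv_rev, inv_inv, ← mul_assoc]
      rfl
    have h4 := fuseHol_equivariant hPQ h1 ((Γ.fuse hPQ).edgeIn v)
    have h5 : (Γ.fuse hPQ).inn ((Γ.fuse hPQ).edgeIn v) = v := Equiv.apply_symm_apply _ v
    rw [h5] at h4
    refine (congrArg (·⁻¹) h4).trans ?_
    rw [mul_inv_rev, mul_inv_rev, inv_inv, ← mul_assoc]
    rfl
  · simp only [π', akmFusion]
    abel
  · simp only [π', akmFusion]
    rw [pushBivector_fusionTensor_swap (P := P) ξ hs_symm]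
    abel
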